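/- **Setting.** Let $M$ be a smooth ($C^\infty$) manifold (Hausdorff, second countable) of real dimension $2m$ with a complex structure $j$: a smooth $(1,1)$-tensor field with $j^2=-\mathrm{id}$ whose $(\pm i)$-eigendistributions in $TM\otimes\mathbb C$ are involutive. Let $\mathbb TM=TM\oplus T^*M$, with the split inner product $b(u+\sigma,v+\tau)=\tau(u)+\sigma(v)$ and the Courant bracket $[u+\sigma,v+\tau]=[u,v]+\mathcal L_u\tau-\mathcal L_v\sigma-\tfrac12 d(\tau(u)-\sigma(v))$. For $\ell=\pm1$ let $J_\ell=\begin{pmatrix} j&0\\0&\ell j^*\end{pmatrix}$ on $\mathbb TM$ and $b_\ell(x,y)=b(x,y)-i\,b(x,J_\ell y)$. For $\lambda,\ell=\pm1$ an *integrable $(\lambda,\ell)$-structure* on $(M,j)$ is a smooth section $S$ of $\mathrm{End}(\mathbb TM)$ with $S^2=\lambda\,\mathrm{id}$, $S$ split (its $\pm\sqrt\lambda$-eigenspaces, in $\mathbb TM\otimes\mathbb C$ if $\lambda=-1$, have the same dimension), $S$ skew-symmetric for $b$, $SJ_\ell=-J_\ell S$, and such that the smooth sections of each $\pm\sqrt\lambda$-eigenspace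 of $S$ are closed under the Courant bracket (its $\mathbb C$-bilinear extension if $\lambda=-1$). An *integrable $(1,1;n)$-structure* is an integrable $(1,1)$-structure $S$ for which the symmetric form $\beta_S(x,y)=b(SJ_{1}x,y)$ has signature $(2n,4m-2n)$ at every point. Let $\sigma_p(\lambda,\ell)\subset\mathrm{End}_{\mathbb R}(\mathbb T_pM)$ be the set of those $S$ with $S^2=\lambda\,\mathrm{id}$, $S$ split, skew-symmetric for $b$ and $SJ_\ell=-J_\ell S$; let $\sigma_p(1,1;n)$ be the set of those $S\in\sigma_p(1,1)$ with $\beta_S$ of signature $(2n,4m-2n)$. **Theorem.** The integrable $(\lambda,\ell)$-structures (respectively, $(1,1;n)$-structures) on $(M,j)$ are exactly the smooth sections of $\bigcup_p\sigma_p(\lambda,\ell)$ (respectively, $\bigcup_p\sigma_p(1,1;n)$) whose $\pm\sqrt\lambda$-eigenspaces have smooth sections closed under the Courant bracket. In each case below the corresponding union is, as a subset of the total space of $\mathrm{End}(\mathbb TM)$, a smooth fibre bundle over $M$ (locally trivial, with local trivializations that are smooth in both directions) whose typical fibre is the homogeneous manifold $G/H$, with $H$ realized as a closed subgroup of $G$: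 * $(1,1;n)$, $0\le n\le 2m$: $G=O(2m,\mathbb C)$, $H=O(n,2m-n)$; * $(1,-1)$: $G=U(m,m)$, $H=Sp(m,\mathbb R)$; * $(-1,1)$: $G=O(2m,\mathbb C)$, $H=SO^*(2m)$; * $(-1,-1)$: $m$ is even if $\sigma_p(-1,-1)\neq\emptyset$ for some $p$; and if $m=2k$, then $G=U(2k,2k)$, $H=Sp(k,k)$. Moreover, in each case, for every $p\in M$ there is a complex linear isomorphism from $\mathbb C^{2m}$ onto $(\mathbb T_pM,J_\ell)$ carrying the standard form preserved by $G$ (the form $Z^tZ'$ if $\ell=1$, $\bar z^tz'-\bar w^tw'$ if $\ell=-1$) to $b_\ell$; via it $G$ acts transitively by conjugation on the fibre over $p$, with isotropy subgroup $H$ at some point of the fibre. Here $O(p,q)$, $U(p,q)$, $Sp(p,q)$ are the groups of automorphisms of a real symmetric, complex Hermitian, quaternionic Hermitian form of signature $(p,q)$, $Sp(m,\mathbb R)$ is the group of automorphisms of a symplectic form on $\mathbb R^{2m}$, $O(2m,\mathbb C)$ that of the complex bilinear form $Z^tZ'$ on $\mathbb C^{2m}$, and $SO^*(2m)$ that of a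 nondegenerate anti-Hermitian form on $\mathbb H^m$. -/

import Mathlib

open Bundle Topology
open scoped Manifold ContDiff Quaternion Matrix

noncomputable section

/-! ## The extended tangent bundle of a smooth manifold of real dimension `2m` -/

/-- The model space `ℝ²ᵐ`. -/
abbrev RModel (m : ℕ) : Type := EuclideanSpace ℝ (Fin (2 * m))

/-- The tangent space of `M` at `x`. -/
abbrev TSpace (m : ℕ) (M : Type*) [TopologicalSpace M] [ChartedSpace (RModel m) M] (x : M) :
    Type :=
  TangentSpace 𝓘(ℝ, RModel m) x

/-- The cotangent space of `M` at `x`. -/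
abbrev CotSpace (m : ℕ) (M : Type*) [TopologicalSpace M] [ChartedSpace (RModel m) M] (x : M) :
    Type :=
  TSpace m M x →L[ℝ] Bundle.Trivial M ℝ x

/-- The extended tangent bundle `𝕋M = TM ⊕ TM*`. -/
abbrev ExtTangent (m : ℕ) (M : Type*) [TopologicalSpace M] [ChartedSpace (RModel m) M] :
    M → Type :=
  (TSpace m M) ×ᵇ (CotSpace m M)

/-- The endomorphism bundle `End (𝕋M)`. -/
abbrev ExtEnd (m : ℕ) (M : Type*) [TopologicalSpace M] [ChartedSpace (RModel m) M] (x : M) :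
    Type :=
  ExtTangent m M x →L[ℝ] ExtTangent m M x

/-- The model fibre of `𝕋M`. -/
abbrev ExtModel (m : ℕ) : Type := RModel m × (RModel m →L[ℝ] ℝ)

/-- The model fibre of `End (𝕋M)`. -/
abbrev EndModel (m : ℕ) : Type := ExtModel m →L[ℝ] ExtModel m

/-- The total space of the vector bundle `End (𝕋M)`, a smooth manifold. -/
abbrev TotEnd (m : ℕ) (M : Type*) [TopologicalSpace M] [ChartedSpace (RModel m) M]
    [IsManifold 𝓘(ℝ, RModel m) ∞ M] : Type _ :=
  TotalSpace (EndModel m) (ExtEnd m M)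

section Linear

variable {m : ℕ} {M : Type*} [TopologicalSpace M] [ChartedSpace (RModel m) M]

/-- The canonical split inner product `b (u + σ, v + τ) = τ u + σ v` on `𝕋ₓM`. -/
def extPairing {x : M} (X Y : ExtTangent m M x) : ℝ :=
  (show ℝ from Y.2 X.1) + (show ℝ from X.2 Y.1)

/-- `J_ℓ = diag (j, ℓ j*)` on `𝕋M`. -/
def JEll (j : ∀ x : M, TSpace m M x →L[ℝ] TSpace m M x) (ell : ℤˣ) (x : M)
    (X : ExtTangent m M x) : ExtTangent m M x :=
  (j x X.1, (ell : ℤ) • ContinuousLinearMap.comp X.2 (j x))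

theorem extPairing_comm {x : M} (X Y : ExtTangent m M x) : extPairing X Y = extPairing Y X :=
  add_comm _ _

theorem extPairing_add_left {x : M} (X X' Y : ExtTangent m M x) :
    extPairing (X + X') Y = extPairing X Y + extPairing X' Y := by
  have h : (show ℝ from Y.2 (X + X').1) = (show ℝ from Y.2 X.1) + (show ℝ from Y.2 X'.1) :=
    map_add Y.2 X.1 X'.1
  have h' : (show ℝ from (X + X').2 Y.1) = (show ℝ from X.2 Y.1) + (show ℝ from X'.2 Y.1) := rfl
  unfold extPairing
  rw [h, h']
  ring

theorem extPairing_smul_left {x : M} (c : ℝ) (X Y : ExtTangent m M x) :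
    extPairing (c • X) Y = c * extPairing X Y := by
  have h : (show ℝ from Y.2 (c • X).1) = c * (show ℝ from Y.2 X.1) := map_smul Y.2 c X.1
  have h' : (show ℝ from (c • X).2 Y.1) = c * (show ℝ from X.2 Y.1) := rfl
  unfold extPairing
  rw [h, h']
  ring

theorem JEll_add (j : ∀ x : M, TSpace m M x →L[ℝ] TSpace m M x) (ell : ℤˣ) (x : M)
    (X Y : ExtTangent m M x) : JEll j ell x (X + Y) = JEll j ell x X + JEll j ell x Y := by
  refine Prod.ext (map_add (j x) X.1 Y.1) ?_
  change (ell : ℤ) • (ContinuousLinearMap.comp (X.2 + Y.2) (j x)) = _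
  rw [ContinuousLinearMap.add_comp, smul_add]
  rfl

theorem JEll_smul (j : ∀ x : M, TSpace m M x →L[ℝ] TSpace m M x) (ell : ℤˣ) (x : M)
    (c : ℝ) (X : ExtTangent m M x) : JEll j ell x (c • X) = c • JEll j ell x X := by
  refine Prod.ext (map_smul (j x) c X.1) ?_
  change (ell : ℤ) • (ContinuousLinearMap.comp (c • X.2) (j x)) = _
  rw [ContinuousLinearMap.smul_comp, smul_comm]
  rfl

end Linear

section Manifold

variable {m : ℕ} {M : Type*} [TopologicalSpace M] [ChartedSpace (RModel m) M]
  [IsManifold 𝓘(ℝ, RModel m) ∞ M]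

/-- `V` is a smooth vector field. -/
def IsSmoothVectorField (V : ∀ x : M, TSpace m M x) : Prop :=
  ContMDiff 𝓘(ℝ, RModel m) (𝓘(ℝ, RModel m).prod 𝓘(ℝ, RModel m)) ∞
    (fun x => TotalSpace.mk' (RModel m) (E := TSpace m M) x (V x))

/-- `r` is a smooth tensor field of type `(1,1)`. -/
def IsSmoothTensorField (r : ∀ x : M, TSpace m M x →L[ℝ] TSpace m M x) : Prop :=
  ContMDiff 𝓘(ℝ, RModel m) (𝓘(ℝ, RModel m).prod 𝓘(ℝ, RModel m →L[ℝ] RModel m)) ∞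
    (fun x => TotalSpace.mk' (RModel m →L[ℝ] RModel m)
      (E := fun x : M => TSpace m M x →L[ℝ] TSpace m M x) x (r x))

/-- `X` is a smooth section of `𝕋M`. -/
def IsSmoothExtSection (X : ∀ x : M, ExtTangent m M x) : Prop :=
  ContMDiff 𝓘(ℝ, RModel m) (𝓘(ℝ, RModel m).prod 𝓘(ℝ, ExtModel m)) ∞
    (fun x => TotalSpace.mk' (ExtModel m) (E := ExtTangent m M) x (X x))

/-- `S` is a smooth section of `End (𝕋M)`. -/
def IsSmoothEndSection (S : ∀ x : M, ExtEnd m M x) : Prop :=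
  ContMDiff 𝓘(ℝ, RModel m) (𝓘(ℝ, RModel m).prod 𝓘(ℝ, EndModel m)) ∞
    (fun x => TotalSpace.mk' (EndModel m) (E := ExtEnd m M) x (S x))

/-- The Lie bracket of vector fields. -/
def lieBr (V W : ∀ x : M, TSpace m M x) : ∀ x : M, TSpace m M x :=
  VectorField.mlieBracket 𝓘(ℝ, RModel m) V W

/-- A complex structure on `M`: a smooth tensor field `j` of type `(1,1)` with `j² = -id` whose
`(±i)`-eigendistributions in `TM ⊗ ℂ` are involutive for the `ℂ`-bilinear extension of the Lie
bracket. A section of `TM ⊗ ℂ` is written `a + i b` with real vector fields `a`, `b`; it lies in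
the `(δ i)`-eigendistribution, `δ = ±1`, iff `j a = -δ b` and `j b = δ a`; and
`[a + i b, c + i d] = ([a, c] - [b, d]) + i ([a, d] + [b, c])`. -/
structure IsComplexStructure (j : ∀ x : M, TSpace m M x →L[ℝ] TSpace m M x) : Prop where
  smooth : IsSmoothTensorField j
  sq : ∀ x (v : TSpace m M x), j x (j x v) = -v
  involutive : ∀ (δ : ℤˣ) (a b c d : ∀ x : M, TSpace m M x),
    IsSmoothVectorField a → IsSmoothVectorField b →
    IsSmoothVectorField c → IsSmoothVectorField d →
    (∀ x, j x (a x) = -((δ : ℤ) • b x)) → (∀ x, j x (b x) = (δ : ℤ) • a x) →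
    (∀ x, j x (c x) = -((δ : ℤ) • d x)) → (∀ x, j x (d x) = (δ : ℤ) • c x) →
    ∀ x, j x (lieBr a c x - lieBr b d x) = -((δ : ℤ) • (lieBr a d x + lieBr b c x)) ∧
      j x (lieBr a d x + lieBr b c x) = (δ : ℤ) • (lieBr a c x - lieBr b d x)

/-! ## The Courant bracket -/

/-- The differential at `x` of a function, as a covector. -/
def dFun (f : M → ℝ) (x : M) : CotSpace m M x :=
  mfderiv 𝓘(ℝ, RModel m) 𝓘(ℝ, ℝ) f x

/-- The `1`-form `τ` read in the preferred chart at `x`. -/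
def oneFormInChart (τ : ∀ x : M, CotSpace m M x) (x : M) (y : RModel m) : RModel m →L[ℝ] ℝ :=
  ContinuousLinearMap.comp (τ ((extChartAt 𝓘(ℝ, RModel m) x).symm y))
    (mfderiv 𝓘(ℝ, RModel m) 𝓘(ℝ, RModel m) (extChartAt 𝓘(ℝ, RModel m) x).symm y)

/-- The contraction `ι_u dτ` at `x`, computed in the preferred chart at `x` (through which
`TₓM` is identified with `ℝ²ᵐ`): `dτ (u, w) = (D_u τ) w - (D_w τ) u`. -/
def contractExtDeriv (u : ∀ x : M, TSpace m M x) (τ : ∀ x : M, CotSpace m M x) (x : M) :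
    CotSpace m M x :=
  let A : RModel m →L[ℝ] RModel m →L[ℝ] ℝ :=
    fderiv ℝ (oneFormInChart τ x) (extChartAt 𝓘(ℝ, RModel m) x x)
  let u₀ : RModel m := u x
  (A u₀ - A.flip u₀ : RModel m →L[ℝ] ℝ)

/-- The Lie derivative `L_u τ = ι_u dτ + d (τ u)` of a `1`-form. -/
def lieDerivForm (u : ∀ x : M, TSpace m M x) (τ : ∀ x : M, CotSpace m M x) (x : M) :
    CotSpace m M x :=
  contractExtDeriv u τ x + dFun (fun y => (show ℝ from τ y (u y))) x

/-- The Courant bracket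
`[u + σ, v + τ] = [u, v] + L_u τ - L_v σ - ½ d (τ u - σ v)`. -/
def courantBr (X Y : ∀ x : M, ExtTangent m M x) (x : M) : ExtTangent m M x :=
  (lieBr (fun y => (X y).1) (fun y => (Y y).1) x,
    lieDerivForm (fun y => (X y).1) (fun y => (Y y).2) x
      - lieDerivForm (fun y => (Y y).1) (fun y => (X y).2) x
      - (1 / 2 : ℝ) • dFun (fun y =>
          (show ℝ from (Y y).2 (X y).1) - (show ℝ from (X y).2 (Y y).1)) x)

/-- The smooth sections of the `(±√lam)`-eigenspaces of `S` are closed under the Courant bracket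
(under its `ℂ`-bilinear extension to sections `A + i B` of `𝕋M ⊗ ℂ`, if `lam = -1`). -/
def IsCourantInvolutive (lam : ℤˣ) (S : ∀ x : M, ExtEnd m M x) : Prop :=
  (lam = 1 → ∀ (δ : ℤˣ) (A B : ∀ x : M, ExtTangent m M x),
    IsSmoothExtSection A → IsSmoothExtSection B →
    (∀ x, S x (A x) = (δ : ℤ) • A x) → (∀ x, S x (B x) = (δ : ℤ) • B x) →
    ∀ x, S x (courantBr A B x) = (δ : ℤ) • courantBr A B x) ∧
  (lam = -1 → ∀ (δ : ℤˣ) (A B C D : ∀ x : M, ExtTangent m M x),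
    IsSmoothExtSection A → IsSmoothExtSection B →
    IsSmoothExtSection C → IsSmoothExtSection D →
    (∀ x, S x (A x) = -((δ : ℤ) • B x)) → (∀ x, S x (B x) = (δ : ℤ) • A x) →
    (∀ x, S x (C x) = -((δ : ℤ) • D x)) → (∀ x, S x (D x) = (δ : ℤ) • C x) →
    ∀ x, S x (courantBr A C x - courantBr B D x)
          = -((δ : ℤ) • (courantBr A D x + courantBr B C x)) ∧
      S x (courantBr A D x + courantBr B C x)
          = (δ : ℤ) • (courantBr A C x - courantBr B D x))

/-! ## Integrable `(λ, ℓ)`-structures -/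

/-- For a linear map with `S² = lam • id`: the eigenspaces of `S` (of its complexification, if
`lam = -1`) for the two square roots of `lam` have the same dimension. -/
def IsSplitMap (lam : ℤˣ) {V : Type*} [AddCommGroup V] [Module ℝ V] (S : V →ₗ[ℝ] V) : Prop :=
  (lam = 1 → Module.finrank ℝ (Module.End.eigenspace S 1)
    = Module.finrank ℝ (Module.End.eigenspace S (-1))) ∧
  (lam = -1 → Module.finrank ℂ (Module.End.eigenspace (S.baseChange ℂ) Complex.I)
    = Module.finrank ℂ (Module.End.eigenspace (S.baseChange ℂ) (-Complex.I)))

/-- A generalized complex (`lam = -1`) or generalized paracomplex (`lam = 1`) structure. -/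
structure IsGeneralizedStructure (lam : ℤˣ) (S : ∀ x : M, ExtEnd m M x) : Prop where
  smooth : IsSmoothEndSection S
  sq : ∀ x X, S x (S x X) = (lam : ℤ) • X
  split : ∀ x, IsSplitMap lam (S x : ExtTangent m M x →ₗ[ℝ] ExtTangent m M x)
  skew : ∀ x X Y, extPairing (S x X) Y = -extPairing X (S x Y)
  involutive : IsCourantInvolutive lam S

/-- An integrable `(λ, ℓ)`-structure on `(M, j)`. -/
structure IsIntegrableStructure (j : ∀ x : M, TSpace m M x →L[ℝ] TSpace m M x) (lam ell : ℤˣ)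
    (S : ∀ x : M, ExtEnd m M x) : Prop where
  generalized : IsGeneralizedStructure lam S
  anticomm : ∀ x X, S x (JEll j ell x X) = -JEll j ell x (S x X)

/-- The bilinear form `β_S (X, Y) = b (S J₊ X, Y)` on `𝕋ₓM`. -/
def betaForm (j : ∀ x : M, TSpace m M x →L[ℝ] TSpace m M x) {x : M} (S : ExtEnd m M x) :
    LinearMap.BilinForm ℝ (ExtTangent m M x) :=
  LinearMap.mk₂ ℝ (fun X Y : ExtTangent m M x => extPairing (S (JEll j 1 x X)) Y)
    (fun X X' Y => by rw [JEll_add, ContinuousLinearMap.map_add, extPairing_add_left])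
    (fun c X Y => by
      rw [JEll_smul, ContinuousLinearMap.map_smul, extPairing_smul_left, smul_eq_mul])
    (fun X Y Y' => by rw [extPairing_comm, extPairing_add_left, extPairing_comm Y,
      extPairing_comm Y'])
    (fun c X Y => by rw [extPairing_comm, extPairing_smul_left, extPairing_comm Y, smul_eq_mul])

/-- `β_S` has signature `(2n, 4m - 2n)` on `𝕋ₓM`. -/
def HasBetaSignature (j : ∀ x : M, TSpace m M x →L[ℝ] TSpace m M x) (n : ℕ) {x : M}
    (S : ExtEnd m M x) : Prop :=
  sigPos (LinearMap.BilinMap.toQuadraticMap (betaForm j S)) = 2 * n ∧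
    sigNeg (LinearMap.BilinMap.toQuadraticMap (betaForm j S)) + 2 * n = 4 * m

/-- An integrable `(1, 1; n)`-structure on `(M, j)`. -/
structure IsIntegrableStructureSig (j : ∀ x : M, TSpace m M x →L[ℝ] TSpace m M x) (n : ℕ)
    (S : ∀ x : M, ExtEnd m M x) : Prop where
  integrable : IsIntegrableStructure j 1 1 S
  signature : ∀ x, HasBetaSignature j n (S x)

/-! ## The bundles of pointwise `(λ, ℓ)`-structures -/

/-- The set `σ (λ, ℓ)` at `x`: all `S ∈ End (𝕋ₓM)` with `S² = λ id`, `S` split, skew-symmetric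
for `b`, and anti-commuting with `J_ℓ`. -/
def slashFibre (j : ∀ x : M, TSpace m M x →L[ℝ] TSpace m M x) (lam ell : ℤˣ) (x : M) :
    Set (ExtEnd m M x) :=
  {S | (∀ X, S (S X) = (lam : ℤ) • X) ∧
    IsSplitMap lam (S : ExtTangent m M x →ₗ[ℝ] ExtTangent m M x) ∧
    (∀ X Y, extPairing (S X) Y = -extPairing X (S Y)) ∧
    ∀ X, S (JEll j ell x X) = -JEll j ell x (S X)}

/-- The set `σ (1, 1; n)` at `x`. -/
def slashFibreSig (j : ∀ x : M, TSpace m M x →L[ℝ] TSpace m M x) (n : ℕ) (x : M) :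
    Set (ExtEnd m M x) :=
  {S | S ∈ slashFibre j 1 1 x ∧ HasBetaSignature j n S}

/-- The total space, inside `End (𝕋M)`, of a family of subsets of the fibres of `End (𝕋M)`. -/
def totalOf (σ : ∀ x : M, Set (ExtEnd m M x)) : Set (TotEnd m M) :=
  {q | q.2 ∈ σ q.1}

/-- `S` is a smooth section of the subbundle `σ` of `End (𝕋M)`. -/
def IsSmoothSectionOf (σ : ∀ x : M, Set (ExtEnd m M x)) (S : ∀ x : M, ExtEnd m M x) : Prop :=
  IsSmoothEndSection S ∧ ∀ x, S x ∈ σ x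

/-- `B`, a subset of the total space of `End (𝕋M)`, is a smooth fibre bundle over `M` with typical
fibre the smooth manifold `F`: every point of `M` has an open neighbourhood `U` over which there is
a fibre preserving bijection `Φ` from `U × F` onto the part of `B` over `U`, smooth as a map into
`End (𝕋M)`, whose inverse `q ↦ (π q, Ψ q)` is smooth too. In particular `B` is an embedded
submanifold of `End (𝕋M)`, so that a section of `B` is smooth iff it is smooth as a section of
`End (𝕋M)`. -/
def IsSmoothFibreBundle (B : Set (TotEnd m M)) {d : ℕ} (F : Type*) [TopologicalSpace F]
    [ChartedSpace (EuclideanSpace ℝ (Fin d)) F] : Prop :=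
  ∀ p : M, ∃ U : Set M, IsOpen U ∧ p ∈ U ∧
    ∃ (Φ : M × F → TotEnd m M) (Ψ : TotEnd m M → F),
      ContMDiffOn ((𝓘(ℝ, RModel m)).prod 𝓘(ℝ, EuclideanSpace ℝ (Fin d)))
        ((𝓘(ℝ, RModel m)).prod 𝓘(ℝ, EndModel m)) ∞ Φ (U ×ˢ Set.univ) ∧
      ContMDiffOn ((𝓘(ℝ, RModel m)).prod 𝓘(ℝ, EndModel m))
        𝓘(ℝ, EuclideanSpace ℝ (Fin d)) ∞ Ψ {q | q ∈ B ∧ q.1 ∈ U} ∧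
      (∀ x ∈ U, ∀ f, (Φ (x, f)).1 = x ∧ Φ (x, f) ∈ B ∧ Ψ (Φ (x, f)) = f) ∧
      ∀ q ∈ B, q.1 ∈ U → Φ (q.1, Ψ q) = q

end Manifold

/-! ## The groups -/

/-- The group of automorphisms of the form `(x, y) ↦ x̄ᵗ F y` on `Rⁿ`. -/
def formGroup {ι R : Type*} [Fintype ι] [DecidableEq ι] [Ring R] [StarRing R]
    (F : Matrix ι ι R) : Subgroup (Matrix ι ι R)ˣ where
  carrier := {A | (A : Matrix ι ι R)ᴴ * F * (A : Matrix ι ι R) = F}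
  one_mem' := by simp
  mul_mem' := by
    intro A B hA hB
    simp only [Set.mem_ofPred_eq] at hA hB ⊢
    rw [Units.val_mul, Matrix.conjTranspose_mul]
    calc (B : Matrix ι ι R)ᴴ * (A : Matrix ι ι R)ᴴ * F * ((A : Matrix ι ι R) * B)
        = (B : Matrix ι ι R)ᴴ * ((A : Matrix ι ι R)ᴴ * F * A) * B := by
          simp only [Matrix.mul_assoc]
      _ = F := by rw [hA, hB]
  inv_mem' := by
    intro A hA
    simp only [Set.mem_ofPred_eq] at hA ⊢
    have h : ((A⁻¹ : (Matrix ι ι R)ˣ) : Matrix ι ι R)ᴴ * (A : Matrix ι ι R)ᴴ = 1 := by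
      rw [← Matrix.conjTranspose_mul, Units.mul_inv, Matrix.conjTranspose_one]
    have h' : (A : Matrix ι ι R) * ((A⁻¹ : (Matrix ι ι R)ˣ) : Matrix ι ι R) = 1 := A.mul_inv
    calc ((A⁻¹ : (Matrix ι ι R)ˣ) : Matrix ι ι R)ᴴ * F * ((A⁻¹ : (Matrix ι ι R)ˣ) : Matrix ι ι R)
        = ((A⁻¹ : (Matrix ι ι R)ˣ) : Matrix ι ι R)ᴴ * ((A : Matrix ι ι R)ᴴ * F * A)
            * ((A⁻¹ : (Matrix ι ι R)ˣ) : Matrix ι ι R) := by rw [hA]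
      _ = (((A⁻¹ : (Matrix ι ι R)ˣ) : Matrix ι ι R)ᴴ * (A : Matrix ι ι R)ᴴ) * F
            * (A * ((A⁻¹ : (Matrix ι ι R)ˣ) : Matrix ι ι R)) := by
          simp only [Matrix.mul_assoc]
      _ = F := by rw [h, h']; simp

/-- The diagonal matrix `I_{p,q}` with `p` entries `1` and `q` entries `-1`. -/
def signMatrix (R : Type*) [Ring R] (p q : ℕ) : Matrix (Fin p ⊕ Fin q) (Fin p ⊕ Fin q) R :=
  Matrix.diagonal (Sum.elim (fun _ => 1) (fun _ => -1))

/-- `O(p, q)`. -/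
abbrev realO (p q : ℕ) : Subgroup (Matrix (Fin p ⊕ Fin q) (Fin p ⊕ Fin q) ℝ)ˣ :=
  formGroup (signMatrix ℝ p q)

/-- `Sp(m, ℝ)`, the automorphisms of the standard symplectic form on `ℝ²ᵐ`. -/
abbrev realSp (m : ℕ) : Subgroup (Matrix (Fin m ⊕ Fin m) (Fin m ⊕ Fin m) ℝ)ˣ :=
  formGroup (Matrix.J (Fin m) ℝ)

/-- `U(p, q)`. -/
abbrev complexU (p q : ℕ) : Subgroup (Matrix (Fin p ⊕ Fin q) (Fin p ⊕ Fin q) ℂ)ˣ :=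
  formGroup (signMatrix ℂ p q)

/-- `Sp(p, q)`, the automorphisms of a Hermitian form of signature `(p, q)` on `ℍᵖ⁺ᑫ`. -/
abbrev quaternionSp (p q : ℕ) : Subgroup (Matrix (Fin p ⊕ Fin q) (Fin p ⊕ Fin q) ℍ[ℝ])ˣ :=
  formGroup (signMatrix ℍ[ℝ] p q)

/-- `SO*(2m)`, the automorphisms of the anti-Hermitian form `(x, y) ↦ x̄ᵗ 𝐣 y` on `ℍᵐ`. -/
abbrev quaternionSOStar (m : ℕ) : Subgroup (Matrix (Fin m) (Fin m) ℍ[ℝ])ˣ :=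
  formGroup (Matrix.diagonal (fun _ : Fin m => (⟨0, 0, 1, 0⟩ : ℍ[ℝ])))

/-- `O(n, ℂ)`, the automorphisms of the complex bilinear form `(x, y) ↦ xᵗ y` on `ℂⁿ`. -/
def complexO (n : ℕ) : Subgroup (Matrix (Fin n) (Fin n) ℂ)ˣ where
  carrier := {A | (A : Matrix (Fin n) (Fin n) ℂ)ᵀ * (A : Matrix (Fin n) (Fin n) ℂ) = 1}
  one_mem' := by simp
  mul_mem' := by
    intro A B hA hB
    simp only [Set.mem_ofPred_eq] at hA hB ⊢
    rw [Units.val_mul, Matrix.transpose_mul, Matrix.mul_assoc,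
      ← Matrix.mul_assoc _ (A : Matrix (Fin n) (Fin n) ℂ) (B : Matrix (Fin n) (Fin n) ℂ),
      hA, Matrix.one_mul, hB]
  inv_mem' := by
    intro A hA
    simp only [Set.mem_ofPred_eq] at hA ⊢
    have h : ((A⁻¹ : (Matrix (Fin n) (Fin n) ℂ)ˣ) : Matrix (Fin n) (Fin n) ℂ)
        = (A : Matrix (Fin n) (Fin n) ℂ)ᵀ := Units.inv_eq_of_mul_eq_one_left hA
    rw [h, Matrix.transpose_transpose, ← h, Units.mul_inv]

/-! ## The homogeneous space `G/H` as a smooth manifold -/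

/-- The entries of an element of a complex matrix group. -/
def entries {N : Type*} [Fintype N] [DecidableEq N] {G : Subgroup (Matrix N N ℂ)ˣ} (g : G) :
    N → N → ℂ :=
  fun i k => ((g : (Matrix N N ℂ)ˣ) : Matrix N N ℂ) i k

/-- The given charts on `G/H` (compatible with the quotient topology) form the smooth structure of
the homogeneous space `G/H`: they make it a smooth manifold such that the projection `G → G/H` is
smooth and has smooth local sections. This determines the smooth structure. Here `G` is a closed
subgroup of `GL(N, ℂ)`, hence an embedded submanifold of the space of matrices. -/
def IsHomogeneousManifold {N : Type*} [Fintype N] [DecidableEq N] (G : Subgroup (Matrix N N ℂ)ˣ)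
    (H : Subgroup G) (d : ℕ) [ChartedSpace (EuclideanSpace ℝ (Fin d)) (G ⧸ H)] : Prop :=
  IsManifold 𝓘(ℝ, EuclideanSpace ℝ (Fin d)) ∞ (G ⧸ H) ∧
  (∃ proj : (N → N → ℂ) → G ⧸ H, (∀ g : G, proj (entries g) = (g : G ⧸ H)) ∧
    ContMDiffOn 𝓘(ℝ, N → N → ℂ) 𝓘(ℝ, EuclideanSpace ℝ (Fin d)) ∞ proj
      (Set.range (entries : G → N → N → ℂ))) ∧
  ∀ y₀ : G ⧸ H, ∃ (U : Set (G ⧸ H)) (s : G ⧸ H → G), IsOpen U ∧ y₀ ∈ U ∧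
    (∀ y ∈ U, ((s y : G) : G ⧸ H) = y) ∧
    ContMDiffOn 𝓘(ℝ, EuclideanSpace ℝ (Fin d)) 𝓘(ℝ, N → N → ℂ) ∞ (fun y => entries (s y)) U

section Fibre

variable {m : ℕ} {M : Type*} [TopologicalSpace M] [ChartedSpace (RModel m) M]
  [IsManifold 𝓘(ℝ, RModel m) ∞ M]

/-- The form `b_ℓ (X, Y) = b (X, Y) - i b (X, J_ℓ Y)` on `𝕋ₓM`. -/
def bEll (j : ∀ x : M, TSpace m M x →L[ℝ] TSpace m M x) (ell : ℤˣ) {x : M}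
    (X Y : ExtTangent m M x) : ℂ :=
  (extPairing X Y : ℂ) - Complex.I * (extPairing X (JEll j ell x Y) : ℂ)

/-- `φ : ℂᴺ → (𝕋ₓM, J_ℓ)` is a complex linear isomorphism which takes the form `B` on `ℂᴺ` to
`b_ℓ`. -/
def IsAdapted (j : ∀ x : M, TSpace m M x →L[ℝ] TSpace m M x) (ell : ℤˣ) {N : Type*}
    (B : (N → ℂ) → (N → ℂ) → ℂ) {x : M} (φ : (N → ℂ) ≃L[ℝ] ExtTangent m M x) : Prop :=
  (∀ z, φ (Complex.I • z) = JEll j ell x (φ z)) ∧ ∀ z w, bEll j ell (φ z) (φ w) = B z w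

/-- The endomorphism of `𝕋ₓM` corresponding to the complex matrix `A` via `φ`. -/
def actOn {N : Type*} [Fintype N] [DecidableEq N] {x : M} (φ : (N → ℂ) ≃L[ℝ] ExtTangent m M x)
    (A : Matrix N N ℂ) : ExtEnd m M x :=
  (φ : (N → ℂ) →L[ℝ] ExtTangent m M x).comp
    (((LinearMap.toContinuousLinearMap (Matrix.toLin' A)).restrictScalars ℝ).comp
      (φ.symm : ExtTangent m M x →L[ℝ] (N → ℂ)))

/-- The action of an invertible complex matrix on `End (𝕋ₓM)` by conjugation, via `φ`. -/
def conjBy {N : Type*} [Fintype N] [DecidableEq N] {x : M} (φ : (N → ℂ) ≃L[ℝ] ExtTangent m M x)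
    (g : (Matrix N N ℂ)ˣ) (S : ExtEnd m M x) : ExtEnd m M x :=
  (actOn φ (g : Matrix N N ℂ)).comp (S.comp (actOn φ ((g⁻¹ : (Matrix N N ℂ)ˣ) : Matrix N N ℂ)))

/-- The family `σ` of subsets of the fibres of `End (𝕋M)` is a smooth fibre bundle over `M` with
typical fibre `G/H`, where `H` is realized as a closed subgroup `ι H` of `G`. Moreover, over each
point `x`, once `(𝕋ₓM, J_ℓ, b_ℓ)` is identified with `(ℂᴺ, i, B)`, the group `G` acts transitively
on `σ x` by conjugation and the isotropy subgroup at some point is `ι H`. -/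
def IsBundleWithFibre (j : ∀ x : M, TSpace m M x →L[ℝ] TSpace m M x) (ell : ℤˣ)
    {N : Type*} [Fintype N] [DecidableEq N] (B : (N → ℂ) → (N → ℂ) → ℂ)
    (G : Subgroup (Matrix N N ℂ)ˣ) (H : Type*) [Group H] [TopologicalSpace H]
    (σ : ∀ x : M, Set (ExtEnd m M x)) : Prop :=
  ∃ ι : H →* G, IsClosedEmbedding ι ∧
    (∃ (d : ℕ) (_ : ChartedSpace (EuclideanSpace ℝ (Fin d)) (G ⧸ ι.range)),
      IsHomogeneousManifold G ι.range d ∧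
      IsSmoothFibreBundle (totalOf σ) (d := d) (G ⧸ ι.range)) ∧
    ∀ x : M, ∃ φ : (N → ℂ) ≃L[ℝ] ExtTangent m M x, IsAdapted j ell B φ ∧
      ∃ S₀ ∈ σ x, (∀ S, S ∈ σ x ↔ ∃ g : G, S = conjBy φ g S₀) ∧
        ∀ g : G, conjBy φ g S₀ = S₀ ↔ g ∈ ι.range

end Fibre

end

/-!
That integrable structures are the Courant involutive smooth sections of the bundles is a
rearrangement of the definitions. The content is the description of the bundles, which is first
reduced to linear algebra on `ℂᴺ`.

**Frames.** If `ρ : ℂᵐ → TₓM` is a complex basis for `j`, explicit formulas (see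
`exists_isAdapted_symmetric`, `exists_isAdapted_hermitian`) identify `(𝕋ₓM, J_ℓ, b_ℓ)` with `ℂᴺ`
and its standard form `stdForm κ ε`, which is symmetric bilinear (`κ = id`) for `ℓ = 1` and
Hermitian (`κ` the conjugation) for `ℓ = -1`. In such a frame, `σₓ(λ, ℓ)` is the set `skewRoots`
of the real endomorphisms `T` with `T² = λ` that anticommute with `i` and are skew-symmetric for
the real part of the form; splitness is automatic, because `J_ℓ` exchanges the eigenspaces
(`mem_slashFibre_iff`). Equivalently, `T` is an antilinear square root of `λ` with
`h (T x, T y) = -λ conj h (x, y)` (`stdForm_skewRoots`).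

**Transitivity.** Splitting off `T`-stable orthogonal blocks one after the other
(`exists_block_decomposition`) gives a normal form for `T`, hence conjugacy under the
automorphisms of the form (`exists_conjEnd_eq`). For `(1, 1)`, the blocks are lines and `T` is
`diag (±i)` composed with the conjugation (`exists_diagonal_frame`); the number of entries `i` is
read off the signature of `β_S` (`hasBetaSignature_iff`). In the other three cases, the blocks are
pairs `v`, `T v` of orthogonal vectors (`exists_pair_frame`). For `(-1, -1)`, both vectors of a
pair have the same sign, so that the signature `(m, m)` of the form forces `m = 2k` with `k` pairs
of each sign (`exists_signed_pair_frame`).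

**Isotropy.** The matrices commuting with the normal form `T` are the real ones in a basis of
fixed vectors of `T` if `λ = 1` (`exists_real_isotropy`), and the quaternionic ones, in their
usual complex block form, if `λ = -1` (`exists_quaternionic_isotropy_symmetric`,
`exists_quaternionic_isotropy_hermitian`). The form then becomes, up to a constant, a real
symmetric, real symplectic, quaternionic anti-Hermitian or quaternionic Hermitian form.

**The smooth structure of `G/H`.** Near a skew root `S₀`, all the others are `g S₀ g⁻¹`, where `g`
is the Cayley transform of an element `X` of the complement `cartanPart` of the centralizer of
`S₀` in the Lie algebra. Indeed `X` anticommutes with `S₀`, so `λ (g S₀ g⁻¹) S₀ = g²`; the inverse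
Cayley transform of `g²` is `2 X (1 + X²)⁻¹`, which has an invertible differential at `X = 0`
(`exists_skewRoots_chart`). These slice charts make the orbit map `gH ↦ g S₀ g⁻¹` an embedding of
`G/H` into a vector space, and the Cayley transforms are smooth local sections of `G → G/H`
(`exists_orbit_chart`, `isEmbedding_orbitMap`, `exists_isHomogeneousManifold`). In this way
neither the closed subgroup theorem nor the theory of Lie groups is needed.

**Local triviality.** In a chart, `½ (1 - j j₀)` intertwines `j` with its constant value `j₀` at
the centre, and is invertible near it. Acting on `E ⊕ E*`, it extends an adapted frame at one
point to a smooth family (`exists_adapted_family`), in which the bundle is the product of the base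
and the orbit (`isSmoothFibreBundle_of_orbit`). The theorem `isBundleWithFibre_of_orbit` puts
these parts together.
-/

noncomputable section

/-! ### Cayley charts on spaces of skew square roots of `±1` -/

section Calculus

variable {E : Type*} [NormedAddCommGroup E] [NormedSpace ℝ E] [CompleteSpace E]

/-- The inverse function theorem with a local inverse that is smooth on its whole domain. -/
theorem exists_openPartialHomeomorph_contDiffOn_symm {f : E → E} {a : E} {s : Set E}
    (hs : IsOpen s) (ha : a ∈ s) (hf : ContDiffOn ℝ ∞ f s) (e : E ≃L[ℝ] E)
    (hf' : HasFDerivAt f (e : E →L[ℝ] E) a) :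
    ∃ h : OpenPartialHomeomorph E E, a ∈ h.source ∧ h.source ⊆ s ∧ (h : E → E) = f ∧
      ContDiffOn ℝ ∞ h.symm h.target := by
  have hfa : ContDiffAt ℝ ∞ f a := hf.contDiffAt (hs.mem_nhds ha)
  have hdc : ContinuousOn (fderiv ℝ f) s := hf.continuousOn_fderiv_of_isOpen hs (by simp)
  have hopen : IsOpen (s ∩ fderiv ℝ f ⁻¹' Set.range ((↑) : (E ≃L[ℝ] E) → E →L[ℝ] E)) :=
    hdc.isOpen_inter_preimage hs ContinuousLinearEquiv.isOpen
  let h₀ := hfa.toOpenPartialHomeomorph f hf' (by simp)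
  refine ⟨h₀.restrOpen _ hopen, ?_, ?_, rfl, ?_⟩
  · refine ⟨hfa.mem_toOpenPartialHomeomorph_source hf' (by simp), ha, ?_⟩
    exact ⟨e, hf'.fderiv.symm⟩
  · exact fun x hx => hx.2.1
  · intro y hy
    set h := h₀.restrOpen _ hopen with hh
    have hx : h.symm y ∈ h.source := h.map_target hy
    obtain ⟨e', he'⟩ := hx.2.2
    have hd : DifferentiableAt ℝ f (h.symm y) :=
      (hf.contDiffAt (hs.mem_nhds hx.2.1)).differentiableAt (by simp)
    refine (h.contDiffAt_symm (f₀' := e') hy ?_ ?_).contDiffWithinAt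
    · rw [he']
      exact hd.hasFDerivAt
    · exact hf.contDiffAt (hs.mem_nhds hx.2.1)

end Calculus

section CayleyAlgebra

variable {A : Type*} [Ring A]

/-- The Cayley transform `(1 + X) (1 - X)⁻¹`. -/
def cayley (X : A) : A := (1 + X) * Ring.inverse (1 - X)

theorem Commute.ringInverse_right {a b : A} (h : Commute a b) : Commute a (Ring.inverse b) := by
  by_cases hb : IsUnit b
  · obtain ⟨u, rfl⟩ := hb
    rw [Ring.inverse_unit]
    exact h.units_inv_right
  · rw [Ring.inverse_non_unit _ hb]
    exact Commute.zero_right a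

theorem commute_one_add_one_sub (X : A) : Commute (1 + X) (1 - X) := by
  unfold Commute SemiconjBy
  noncomm_ring

theorem cayley_mul_cayley_neg {X : A} (h₁ : IsUnit (1 + X)) (h₂ : IsUnit (1 - X)) :
    cayley X * cayley (-X) = 1 := by
  unfold cayley
  rw [sub_neg_eq_add, ← sub_eq_add_neg, mul_assoc, Ring.inverse_mul_cancel_left _ _ h₂,
    Ring.mul_inverse_cancel _ h₁]

theorem cayley_mul_one_sub {X : A} (h : IsUnit (1 - X)) : cayley X * (1 - X) = 1 + X := by
  unfold cayley
  rw [Ring.inverse_mul_cancel_right _ _ h]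

theorem one_sub_mul_cayley {X : A} (h : IsUnit (1 - X)) : (1 - X) * cayley X = 1 + X := by
  unfold cayley
  rw [← mul_assoc, ← (commute_one_add_one_sub X).eq, mul_assoc, Ring.mul_inverse_cancel _ h,
    mul_one]

theorem Commute.cayley_right {X J : A} (h : Commute J X) : Commute J (cayley X) :=
  ((Commute.one_right J).add_right h).mul_right
    ((Commute.one_right J).sub_right h).ringInverse_right

theorem mul_cayley_of_anticommute {X S : A} (h : X * S = -(S * X)) (h₁ : IsUnit (1 + X))
    (h₂ : IsUnit (1 - X)) : S * cayley (-X) = cayley X * S := by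
  refine h₁.mul_right_cancel ?_
  have e₁ : cayley (-X) * (1 + X) = 1 - X := by
    have := cayley_mul_one_sub (X := -X) (by simpa using h₁)
    simpa [sub_eq_add_neg] using this
  have e₂ : S * (1 + X) = (1 - X) * S := by
    rw [mul_add, sub_mul, h]; simp
  have e₃ : (1 + X) * S = S * (1 - X) := by
    rw [mul_sub, add_mul, h]; simp [sub_eq_add_neg]
  rw [mul_assoc, e₁, mul_assoc, e₂, ← mul_assoc, cayley_mul_one_sub h₂, e₃]

theorem cayley_sq_mul {X : A} (h : IsUnit (1 - X)) :
    cayley X * cayley X * ((1 - X) * (1 - X)) = (1 + X) * (1 + X) := by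
  calc cayley X * cayley X * ((1 - X) * (1 - X))
      = cayley X * (cayley X * (1 - X)) * (1 - X) := by noncomm_ring
    _ = cayley X * ((1 + X) * (1 - X)) := by rw [cayley_mul_one_sub h, mul_assoc]
    _ = (cayley X * (1 - X)) * (1 + X) := by rw [(commute_one_add_one_sub X).eq, mul_assoc]
    _ = _ := by rw [cayley_mul_one_sub h]

theorem mul_cayley_sq {X : A} (h : IsUnit (1 - X)) :
    ((1 - X) * (1 - X)) * (cayley X * cayley X) = (1 + X) * (1 + X) := by
  calc ((1 - X) * (1 - X)) * (cayley X * cayley X)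
      = (1 - X) * ((1 - X) * cayley X) * cayley X := by noncomm_ring
    _ = (1 - X) * (1 + X) * cayley X := by rw [one_sub_mul_cayley h]
    _ = (1 + X) * ((1 - X) * cayley X) := by rw [← (commute_one_add_one_sub X).eq, mul_assoc]
    _ = _ := by rw [one_sub_mul_cayley h]

variable [Algebra ℝ A]

/-- The map `X ↦ 2 X (1 + X²)⁻¹`: the Cayley transform of its value is the square of the Cayley
transform of `X`. -/
def cayleyDouble (X : A) : A := (2 : ℝ) • (X * Ring.inverse (1 + X * X))

/-- The inverse Cayley transform `(R - 1) (R + 1)⁻¹`. -/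
def cayleyInv (R : A) : A := (R - 1) * Ring.inverse (R + 1)

theorem cayleyDouble_mul {X : A} (h : IsUnit (1 + X * X)) :
    cayleyDouble X * (1 + X * X) = (2 : ℝ) • X := by
  unfold cayleyDouble
  rw [smul_mul_assoc, Ring.inverse_mul_cancel_right _ _ h]

theorem mul_cayleyDouble {X : A} (h : IsUnit (1 + X * X)) :
    (1 + X * X) * cayleyDouble X = (2 : ℝ) • X := by
  have hc : Commute (1 + X * X) X := by
    unfold Commute SemiconjBy
    noncomm_ring
  unfold cayleyDouble
  rw [mul_smul_comm, ← mul_assoc, hc.eq, mul_assoc, Ring.mul_inverse_cancel _ h, mul_one]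

theorem isUnit_cayley_sq_add_one {X : A} (h₂ : IsUnit (1 - X)) (h₃ : IsUnit (1 + X * X)) :
    IsUnit (cayley X * cayley X + 1) := by
  have e : (cayley X * cayley X + 1) * ((1 - X) * (1 - X)) = (2 : ℝ) • (1 + X * X) := by
    rw [add_mul, cayley_sq_mul h₂, two_smul]
    noncomm_ring
  have hu : IsUnit ((2 : ℝ) • (1 + X * X)) := by
    obtain ⟨u, hu⟩ := h₃
    refine ⟨Units.mk0 (2 : ℝ) two_ne_zero • u, ?_⟩
    rw [← hu]; rfl
  rw [← e] at hu
  exact (((h₂.mul h₂).mul_right_iff).1 hu)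

theorem cayleyInv_cayley_sq {X : A} (h₂ : IsUnit (1 - X)) (h₃ : IsUnit (1 + X * X)) :
    cayleyInv (cayley X * cayley X) = cayleyDouble X := by
  have hu := isUnit_cayley_sq_add_one h₂ h₃
  unfold cayleyInv
  refine hu.mul_right_cancel ((h₂.mul h₂).mul_right_cancel ?_)
  rw [Ring.inverse_mul_cancel_right _ _ hu, sub_mul (cayley X * cayley X), cayley_sq_mul h₂,
    mul_assoc (cayleyDouble X), add_mul (cayley X * cayley X), cayley_sq_mul h₂]
  have e : (1 + X) * (1 + X) + 1 * ((1 - X) * (1 - X)) = (2 : ℝ) • (1 + X * X) := by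
    rw [two_smul]
    noncomm_ring
  rw [e, mul_smul_comm, cayleyDouble_mul h₃, two_smul, two_smul]
  noncomm_ring

/-- `R` is recovered from its inverse Cayley transform: this makes `cayleyDouble` and `cayleyInv`
coordinates on the squares of Cayley transforms. -/
theorem cayley_sq_eq {X R : A} (h₂ : IsUnit (1 - X)) (h₃ : IsUnit (1 + X * X))
    (hR : IsUnit (R + 1)) (h : cayleyInv R = cayleyDouble X) : cayley X * cayley X = R := by
  have e₁ : cayleyDouble X * (R + 1) = R - 1 := by
    rw [← h, cayleyInv, Ring.inverse_mul_cancel_right _ _ hR]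
  have e₂ : (1 - cayleyDouble X) * R = 1 + cayleyDouble X := by
    have : (1 - cayleyDouble X) * R = R - cayleyDouble X * (R + 1) + cayleyDouble X := by
      noncomm_ring
    rw [this, e₁]
    abel
  refine (h₂.mul h₂).mul_left_cancel ?_
  rw [mul_cayley_sq h₂]
  have e₃ : (1 - X) * (1 - X) = (1 + X * X) * (1 - cayleyDouble X) := by
    rw [mul_sub (1 + X * X), mul_cayleyDouble h₃, two_smul]
    noncomm_ring
  rw [e₃, mul_assoc, e₂, mul_add (1 + X * X), mul_cayleyDouble h₃, two_smul]
  noncomm_ring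

end CayleyAlgebra

section CayleyDouble

theorem contDiff_submodule_val {E : Type*} [NormedAddCommGroup E] [NormedSpace ℝ E]
    (p : Submodule ℝ E) : ContDiff ℝ ∞ (fun x : p => (x : E)) :=
  p.subtypeL.contDiff

theorem exists_contDiff_retraction {E : Type*} [NormedAddCommGroup E] [NormedSpace ℝ E]
    [FiniteDimensional ℝ E] (p : Submodule ℝ E) :
    ∃ r : E →ₗ[ℝ] p, ContDiff ℝ ∞ r ∧ ∀ x : p, r x = x := by
  obtain ⟨q, hc⟩ := p.exists_isCompl
  exact ⟨p.projectionOnto q hc, (LinearMap.toContinuousLinearMap (p.projectionOnto q hc)).contDiff,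
    Submodule.projectionOnto_apply_left hc⟩

variable {A : Type*} [NormedRing A] [NormedAlgebra ℝ A]

theorem contDiffOn_ringInverse [CompleteSpace A] :
    ContDiffOn ℝ ∞ (Ring.inverse : A → A) {x | IsUnit x} := by
  rintro _ ⟨u, rfl⟩
  exact (contDiffAt_ringInverse ℝ u).contDiffWithinAt

theorem contDiffOn_cayley [CompleteSpace A] :
    ContDiffOn ℝ ∞ (cayley : A → A) {X | IsUnit (1 - X)} := by
  unfold cayley
  exact ContDiffOn.mul (by fun_prop)
    (contDiffOn_ringInverse.comp (t := {x | IsUnit x}) (by fun_prop) fun X hX => hX)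

theorem contDiffOn_cayleyInv [CompleteSpace A] :
    ContDiffOn ℝ ∞ (cayleyInv : A → A) {R | IsUnit (R + 1)} := by
  unfold cayleyInv
  exact ContDiffOn.mul (by fun_prop)
    (contDiffOn_ringInverse.comp (t := {x | IsUnit x}) (by fun_prop) fun X hX => hX)

/-- On a subspace stable under `cayleyDouble`, this map has a smooth local inverse at `0`, its
derivative there being multiplication by `2`. -/
theorem exists_cayleyDouble_openPartialHomeomorph [FiniteDimensional ℝ A] (p : Submodule ℝ A)
    (hp : ∀ X : p, cayleyDouble (X : A) ∈ p) :
    ∃ h : OpenPartialHomeomorph p p, 0 ∈ h.source ∧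
      (∀ X ∈ h.source, IsUnit (1 + (X : A)) ∧ IsUnit (1 - (X : A)) ∧
        IsUnit (1 + (X : A) * (X : A))) ∧
      (∀ X, (h X : A) = cayleyDouble (X : A)) ∧ ContDiffOn ℝ ∞ h.symm h.target := by
  have : CompleteSpace A := FiniteDimensional.complete ℝ A
  obtain ⟨r, hr, hrp⟩ := exists_contDiff_retraction p
  let s : Set p := {X | IsUnit (1 + (X : A)) ∧ IsUnit (1 - (X : A)) ∧
    IsUnit (1 + (X : A) * (X : A))}
  have hs : IsOpen s := by
    refine IsOpen.inter (Units.isOpen.preimage (by fun_prop)) (IsOpen.inter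
      (Units.isOpen.preimage (by fun_prop)) (Units.isOpen.preimage (by fun_prop)))
  let f : p → p := fun X => ⟨cayleyDouble (X : A), hp X⟩
  have hfeq : f = fun X : p => r (cayleyDouble (X : A)) := by
    funext X
    exact (hrp (f X)).symm
  have hval := contDiff_submodule_val p
  have hinv : ContDiffOn ℝ ∞ (fun X : p => Ring.inverse (1 + (X : A) * (X : A))) s :=
    contDiffOn_ringInverse.comp (t := {x | IsUnit x})
      (contDiff_const.add (hval.mul hval)).contDiffOn fun X hX => hX.2.2
  have hf : ContDiffOn ℝ ∞ f s := by
    rw [hfeq]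
    refine hr.comp_contDiffOn ?_
    unfold cayleyDouble
    exact ContDiffOn.const_smul _ (hval.contDiffOn.mul hinv)
  have h0s : (0 : p) ∈ s := by simp [s]
  have hf' : HasFDerivAt f ((ContinuousLinearEquiv.smulLeft (Units.mk0 (2 : ℝ) two_ne_zero) :
      p ≃L[ℝ] p) : p →L[ℝ] p) 0 := by
    have hq : DifferentiableAt ℝ (fun X : p => Ring.inverse (1 + (X : A) * (X : A))) 0 :=
      (hinv.contDiffAt (hs.mem_nhds h0s)).differentiableAt (by simp)
    have hv : HasFDerivAt (fun X : p => (X : A)) p.subtypeL 0 := p.subtypeL.hasFDerivAt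
    have hd := (LinearMap.toContinuousLinearMap r).hasFDerivAt.comp 0
      ((hv.mul' hq.hasFDerivAt).const_smul (2 : ℝ))
    rw [hfeq]
    refine HasFDerivAt.congr_fderiv hd (ContinuousLinearMap.ext fun X => ?_)
    have e : ∀ Z : A, Z = (2 : ℝ) • (X : A) → r Z = (2 : ℝ) • X := by
      rintro _ rfl
      rw [map_smul, hrp]
    refine e _ ?_
    simp
  obtain ⟨h, h0, hsub, hhf, hsymm⟩ := exists_openPartialHomeomorph_contDiffOn_symm hs h0s hf _ hf'
  exact ⟨h, h0, hsub, fun X => congrArg (fun g : p → p => (g X : A)) hhf, hsymm⟩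

end CayleyDouble

section SkewRoots

variable {V : Type*} [NormedAddCommGroup V] [NormedSpace ℝ V]

/-- The endomorphisms `S` with `S² = lam`, skew-symmetric for `b` and anti-commuting with `J`. -/
def skewRoots (b : LinearMap.BilinForm ℝ V) (J : V →L[ℝ] V) (lam : ℤˣ) : Set (V →L[ℝ] V) :=
  {S | (∀ X, S (S X) = (lam : ℤ) • X) ∧ (∀ X Y, b (S X) Y = -b X (S Y)) ∧
    ∀ X, S (J X) = -J (S X)}

/-- The complement, in the Lie algebra of the `b`-orthogonal endomorphisms commuting with `J`, of
the centralizer of `S₀`. -/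
def cartanPart (b : LinearMap.BilinForm ℝ V) (J S₀ : V →L[ℝ] V) : Submodule ℝ (V →L[ℝ] V) where
  carrier := {X | (∀ u v, b (X u) v = -b u (X v)) ∧ Commute J X ∧ X * S₀ = -(S₀ * X)}
  zero_mem' := ⟨by simp, Commute.zero_right _, by simp⟩
  add_mem' := by
    rintro X Y ⟨h₁, h₂, h₃⟩ ⟨k₁, k₂, k₃⟩
    refine ⟨fun u v => ?_, h₂.add_right k₂, ?_⟩
    · simp only [add_apply, map_add, LinearMap.add_apply, h₁, k₁]
      ring
    · rw [add_mul, mul_add, h₃, k₃]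
      abel
  smul_mem' := by
    rintro c X ⟨h₁, h₂, h₃⟩
    refine ⟨fun u v => ?_, h₂.smul_right c, ?_⟩
    · simp only [smul_apply, map_smul, LinearMap.smul_apply, h₁, smul_eq_mul]
      ring
    · rw [smul_mul_assoc, h₃, mul_smul_comm, smul_neg]

variable {b : LinearMap.BilinForm ℝ V} {J S₀ : V →L[ℝ] V} {lam : ℤˣ}

theorem apply_ringInverse {T : V →L[ℝ] V} (h : IsUnit T) (v : V) : T (Ring.inverse T v) = v :=
  congrArg (fun S : V →L[ℝ] V => S v) (Ring.mul_inverse_cancel T h)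

theorem skewRoots_mul_self (h : S₀ ∈ skewRoots b J lam) : S₀ * S₀ = (lam : ℤ) • 1 := by
  ext v
  exact h.1 v

/-- The Cayley transform of a skew-symmetric endomorphism is orthogonal. -/
theorem form_cayley {X : V →L[ℝ] V} (hX : X ∈ cartanPart b J S₀) (h : IsUnit (1 - X)) (u v : V) :
    b (cayley X u) (cayley X v) = b u v := by
  set p := Ring.inverse (1 - X)
  have hu : u = (1 - X) (p u) := (apply_ringInverse h u).symm
  have hv : v = (1 - X) (p v) := (apply_ringInverse h v).symm
  have : b ((1 + X) (p u)) ((1 + X) (p v)) = b ((1 - X) (p u)) ((1 - X) (p v)) := by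
    simp only [add_apply, sub_apply, map_add, map_sub,
      LinearMap.add_apply, LinearMap.sub_apply, one_apply_eq_self, hX.1]
    ring
  rw [← hu, ← hv] at this
  exact this

theorem cayleyDouble_mem_cartanPart {X : V →L[ℝ] V} (hX : X ∈ cartanPart b J S₀) :
    cayleyDouble X ∈ cartanPart b J S₀ := by
  refine Submodule.smul_mem _ _ ?_
  by_cases h : IsUnit (1 + X * X)
  swap
  · rw [Ring.inverse_non_unit _ h, mul_zero]
    exact Submodule.zero_mem _
  set q := Ring.inverse (1 + X * X) with hq
  have hcX : Commute X q :=
    ((Commute.one_right X).add_right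
      ((Commute.refl X).mul_right (Commute.refl X))).ringInverse_right
  refine ⟨fun u v => ?_, hX.2.1.mul_right
    ((Commute.one_right J).add_right (hX.2.1.mul_right hX.2.1)).ringInverse_right, ?_⟩
  · have hs : ∀ u v, b (q u) v = b u (q v) := by
      intro u v
      have h₁ : ∀ u v, b ((1 + X * X) u) v = b u ((1 + X * X) v) := by
        intro u v
        simp only [add_apply, one_apply_eq_self, map_add,
          LinearMap.add_apply]
        have : b ((X * X) u) v = b u ((X * X) v) := by
          change b (X (X u)) v = b u (X (X v))
          rw [hX.1, hX.1, neg_neg]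
        rw [this]
      conv_lhs => rw [← apply_ringInverse h v]
      rw [← h₁, apply_ringInverse h]
    have hc : ∀ v, X (q v) = q (X v) := fun v => congrArg (fun S : V →L[ℝ] V => S v) hcX.eq
    change b (X (q u)) v = -b u (X (q v))
    rw [hX.1, hs, hc]
  · have hcS : Commute S₀ (1 + X * X) := by
      refine (Commute.one_right _).add_right ?_
      change S₀ * (X * X) = X * X * S₀
      rw [mul_assoc, hX.2.2, mul_neg, ← mul_assoc X, hX.2.2, neg_mul, neg_neg, mul_assoc]
    rw [mul_assoc, ← hcS.ringInverse_right.eq, ← mul_assoc, hX.2.2, neg_mul, mul_assoc]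

/-- For two skew roots `S`, `S₀`, the product `R = lam S S₀` is `b`-orthogonal, commutes with `J`
and satisfies `R S₀ = S₀ R⁻¹`; its inverse Cayley transform therefore lies in `cartanPart`. -/
theorem cayleyInv_mem_cartanPart (h₀ : S₀ ∈ skewRoots b J lam) {S : V →L[ℝ] V}
    (hS : S ∈ skewRoots b J lam) (hu : IsUnit ((lam : ℤ) • (S * S₀) + 1)) :
    cayleyInv ((lam : ℤ) • (S * S₀)) ∈ cartanPart b J S₀ := by
  set R := (lam : ℤ) • (S * S₀) with hR
  -- `Q` is the inverse of `R`
  set Q := (lam : ℤ) • (S₀ * S) with hQ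
  have hSS := skewRoots_mul_self h₀
  have hSS' := skewRoots_mul_self hS
  have hll : (lam : ℤ) * (lam : ℤ) = 1 := by rw [← Units.val_mul, Int.units_mul_self, Units.val_one]
  have hRS : R * S₀ = S := by
    rw [hR, smul_mul_assoc, mul_assoc, hSS, mul_smul_comm, smul_smul, hll, one_smul, mul_one]
  have hQR : Q * R = 1 := by
    rw [hQ, smul_mul_assoc, mul_assoc, hR, mul_smul_comm, ← mul_assoc S, hSS', mul_smul_comm,
      smul_mul_assoc, mul_smul_comm, one_mul, hSS, smul_smul, smul_smul, smul_smul]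
    rw [hll, one_mul, hll, one_smul]
  have hSQ : S₀ * Q = S := by
    rw [hQ, mul_smul_comm, ← mul_assoc, hSS, smul_mul_assoc, smul_smul, hll, one_smul, one_mul]
  have hRR : ∀ u v, b (R u) (R v) = b u v := by
    intro u v
    have h₁ : b (R u) (R v) = b (S (S₀ u)) (S (S₀ v)) := by
      rcases Int.units_eq_one_or lam with hl | hl <;> rw [hR, hl] <;> simp
    rw [h₁, hS.2.1, hS.1, h₀.2.1, map_zsmul, map_zsmul, h₀.1, map_zsmul, neg_neg, smul_smul, hll,
      one_smul]
  set T := Ring.inverse (R + 1) with hT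
  have hTR : Commute R T := ((Commute.refl R).add_right (Commute.one_right R)).ringInverse_right
  refine ⟨fun u v => ?_, ?_, ?_⟩
  · have e : b ((R - 1) (T u)) ((R + 1) (T v)) = -b ((R + 1) (T u)) ((R - 1) (T v)) := by
      simp only [add_apply, sub_apply, map_add, map_sub,
        LinearMap.add_apply, LinearMap.sub_apply, one_apply_eq_self, hRR]
      ring
    rw [apply_ringInverse hu, apply_ringInverse hu] at e
    exact e
  · have hJ₀ : S₀ * J = -(J * S₀) := ContinuousLinearMap.ext h₀.2.2
    have hJ₁ : S * J = -(J * S) := ContinuousLinearMap.ext hS.2.2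
    have hJR : Commute J R := by
      refine Commute.smul_right ?_ _
      change J * (S * S₀) = S * S₀ * J
      rw [mul_assoc, hJ₀, mul_neg, ← mul_assoc, ← mul_assoc, hJ₁, neg_mul, neg_neg]
    exact (hJR.sub_right (Commute.one_right J)).mul_right
      (hJR.add_right (Commute.one_right J)).ringInverse_right
  · have e₁ : (R + 1) * S₀ = S₀ * Q * (R + 1) := by
      rw [mul_assoc, mul_add, hQR, mul_one, mul_add, hSQ, add_mul, hRS, one_mul, mul_one, add_comm]
    have e₂ : S₀ * T = T * S₀ * Q := by
      calc S₀ * T = T * ((R + 1) * S₀) * T := by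
            rw [← mul_assoc, Ring.inverse_mul_cancel _ hu, one_mul]
        _ = T * S₀ * Q * ((R + 1) * T) := by rw [e₁]; noncomm_ring
        _ = _ := by rw [Ring.mul_inverse_cancel _ hu, mul_one]
    have e₃ : T * S₀ = S₀ * T * R := by rw [e₂, mul_assoc, hQR, mul_one]
    have e₄ : (R - 1) * S₀ = S₀ * (Q - 1) := by
      rw [sub_mul, mul_sub, hRS, hSQ, one_mul, mul_one]
    change (R - 1) * T * S₀ = -(S₀ * ((R - 1) * T))
    calc (R - 1) * T * S₀ = (R - 1) * S₀ * (T * R) := by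
          rw [mul_assoc, e₃]; noncomm_ring
      _ = S₀ * (Q * R - R) * T := by rw [e₄, ← hTR.eq]; noncomm_ring
      _ = _ := by rw [hQR]; noncomm_ring

/-- As `X` anticommutes with `S₀`, conjugation of `S₀` by the Cayley transform of `X` is
multiplication by its square. -/
theorem cayley_conj_eq {X : V →L[ℝ] V} (hX : X ∈ cartanPart b J S₀) (h₁ : IsUnit (1 + X))
    (h₂ : IsUnit (1 - X)) : cayley X * S₀ * cayley (-X) = cayley X * cayley X * S₀ := by
  rw [mul_assoc, mul_cayley_of_anticommute hX.2.2 h₁ h₂, mul_assoc]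

theorem conj_mem_skewRoots {S g g' : V →L[ℝ] V} (hS : S ∈ skewRoots b J lam) (hg : g * g' = 1)
    (hg' : g' * g = 1) (hb : ∀ u v, b (g u) (g v) = b u v) (hJ : Commute J g) :
    g * S * g' ∈ skewRoots b J lam := by
  have e₁ : ∀ v, g (g' v) = v := fun v => congrArg (fun S : V →L[ℝ] V => S v) hg
  have e₂ : ∀ v, g' (g v) = v := fun v => congrArg (fun S : V →L[ℝ] V => S v) hg'
  have hJ₁ : ∀ v, J (g v) = g (J v) := fun v => congrArg (fun S : V →L[ℝ] V => S v) hJ.eq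
  have hJ₂ : ∀ v, J (g' v) = g' (J v) := fun v => by rw [← e₂ (J (g' v)), ← hJ₁, e₁]
  refine ⟨fun X => ?_, fun X Y => ?_, fun X => ?_⟩
  · change g (S (g' (g (S (g' X))))) = _
    rw [e₂, hS.1, map_zsmul, e₁]
  · change b (g (S (g' X))) Y = -b X (g (S (g' Y)))
    conv_lhs => rw [← e₁ Y]
    conv_rhs => rw [← e₁ X]
    rw [hb, hb, hS.2.1]
  · change g (S (g' (J X))) = -J (g (S (g' X)))
    rw [← hJ₂, hS.2.2, map_neg, hJ₁]

end SkewRoots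

section Charts

variable {V : Type*} [NormedAddCommGroup V] [NormedSpace ℝ V] [FiniteDimensional ℝ V]
  {b : LinearMap.BilinForm ℝ V} {J S₀ : V →L[ℝ] V} {lam : ℤˣ}

/-- A chart of the space of skew roots around `S₀`: a parametrization by an open subset of the
`cartanPart`, of the form `X ↦ g S₀ g⁻¹` where `g`, the Cayley transform of `X`, is a
`b`-orthogonal automorphism commuting with `J`. The parametrization is inverted by the inverse
Cayley transform of `lam S S₀`, which is the square of the Cayley transform of `X`, followed by a
local inverse of `cayleyDouble`. -/
theorem exists_skewRoots_chart (h₀ : S₀ ∈ skewRoots b J lam) :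
    ∃ (U : Set (V →L[ℝ] V)) (W : Set (cartanPart b J S₀))
      (c : (V →L[ℝ] V) → cartanPart b J S₀),
      IsOpen U ∧ S₀ ∈ U ∧ IsOpen W ∧ ContDiffOn ℝ ∞ c U ∧
      (∀ X ∈ W, IsUnit (1 + (X : V →L[ℝ] V)) ∧ IsUnit (1 - (X : V →L[ℝ] V)) ∧
        cayley (X : V →L[ℝ] V) * S₀ * cayley (-X : V →L[ℝ] V) ∈ U ∧
        c (cayley (X : V →L[ℝ] V) * S₀ * cayley (-X : V →L[ℝ] V)) = X) ∧
      ∀ S ∈ skewRoots b J lam, S ∈ U → c S ∈ W ∧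
        cayley (c S : V →L[ℝ] V) * S₀ * cayley (-(c S) : V →L[ℝ] V) = S := by
  set 𝔪 := cartanPart b J S₀
  obtain ⟨pr, hprs, hpr⟩ := exists_contDiff_retraction 𝔪
  obtain ⟨h, h0, hsub, hhf, hsymm⟩ := exists_cayleyDouble_openPartialHomeomorph 𝔪
    fun X => cayleyDouble_mem_cartanPart X.2
  have hlin : ContDiff ℝ ∞ (fun S : V →L[ℝ] V => (lam : ℤ) • (S * S₀)) := by
    simp only [← Int.cast_smul_eq_zsmul ℝ]
    fun_prop
  let U₀ : Set (V →L[ℝ] V) := {S | IsUnit ((lam : ℤ) • (S * S₀) + 1)}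
  have hU₀ : IsOpen U₀ := Units.isOpen.preimage (by fun_prop)
  let c₀ : (V →L[ℝ] V) → 𝔪 := fun S => pr (cayleyInv ((lam : ℤ) • (S * S₀)))
  have hc₀ : ContDiffOn ℝ ∞ c₀ U₀ := by
    exact hprs.comp_contDiffOn (contDiffOn_cayleyInv.comp hlin.contDiffOn fun S hS => hS)
  have hll : (lam : ℤ) * (lam : ℤ) = 1 := by rw [← Units.val_mul, Int.units_mul_self, Units.val_one]
  have hSS := skewRoots_mul_self h₀
  have key : ∀ S : V →L[ℝ] V, (lam : ℤ) • (S * S₀ * S₀) = S := by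
    intro S
    rw [mul_assoc, hSS, mul_smul_comm, smul_smul, hll, one_smul, mul_one]
  have hfor : ∀ X ∈ h.source, IsUnit ((lam : ℤ) • (cayley (X : V →L[ℝ] V) * S₀ *
      cayley (-X : V →L[ℝ] V) * S₀) + 1) ∧
      c₀ (cayley (X : V →L[ℝ] V) * S₀ * cayley (-X : V →L[ℝ] V)) = h X := by
    intro X hX
    obtain ⟨h₁, h₂, h₃⟩ := hsub X hX
    have e : (lam : ℤ) • (cayley (X : V →L[ℝ] V) * S₀ * cayley (-X : V →L[ℝ] V) * S₀)
        = cayley (X : V →L[ℝ] V) * cayley (X : V →L[ℝ] V) := by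
      rw [cayley_conj_eq X.2 h₁ h₂, key]
    refine ⟨?_, ?_⟩
    · rw [e]
      exact isUnit_cayley_sq_add_one h₂ h₃
    · change pr (cayleyInv ((lam : ℤ) • _)) = _
      rw [e, cayleyInv_cayley_sq h₂ h₃, ← hhf]
      exact hpr (h X)
  refine ⟨U₀ ∩ c₀ ⁻¹' h.target, h.source, fun S => h.symm (c₀ S),
    hc₀.continuousOn.isOpen_inter_preimage hU₀ h.open_target, ?_, h.open_source,
    hsymm.comp (hc₀.mono Set.inter_subset_left) fun S hS => hS.2, ?_, ?_⟩
  · have hX := hfor 0 h0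
    have e : cayley ((0 : 𝔪) : V →L[ℝ] V) * S₀ * cayley (-(0 : 𝔪) : V →L[ℝ] V) = S₀ := by
      simp [cayley]
    rw [e] at hX
    refine ⟨hX.1, ?_⟩
    rw [Set.mem_preimage, hX.2]
    exact h.map_source h0
  · intro X hX
    obtain ⟨h₁, h₂, h₃⟩ := hsub X hX
    obtain ⟨e₁, e₂⟩ := hfor X hX
    refine ⟨h₁, h₂, ⟨e₁, ?_⟩, ?_⟩
    · rw [Set.mem_preimage, e₂]
      exact h.map_source hX
    · change h.symm (c₀ _) = X
      rw [e₂, h.left_inv hX]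
  · rintro S hS ⟨hSU, hSt⟩
    set X := h.symm (c₀ S) with hXdef
    have hX : X ∈ h.source := h.map_target hSt
    obtain ⟨h₁, h₂, h₃⟩ := hsub X hX
    refine ⟨hX, ?_⟩
    have hmem := cayleyInv_mem_cartanPart h₀ hS hSU
    have e : h X = c₀ S := by rw [hXdef, h.right_inv hSt]
    have e' : cayleyInv ((lam : ℤ) • (S * S₀)) = cayleyDouble (X : V →L[ℝ] V) := by
      have e₁ : c₀ S = ⟨_, hmem⟩ := hpr ⟨_, hmem⟩
      rw [← hhf]
      exact congrArg Subtype.val (e₁.symm.trans e.symm)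
    rw [cayley_conj_eq X.2 h₁ h₂, cayley_sq_eq h₂ h₃ hSU e', smul_mul_assoc, key]

end Charts

/-! ### Manifold structures induced by embeddings into vector spaces -/

section Embedded

variable {Q E : Type*} [TopologicalSpace Q] [NormedAddCommGroup E] [NormedSpace ℝ E] {d : ℕ}
  {θ : Q → E}

/-- A slice chart at `y` for a map `θ : Q → E`: a smooth map `chart` on an open set of `E` and a
smooth parametrization of the part of `θ` in this open set which is inverse to it. -/
structure EmbeddedChart (θ : Q → E) (d : ℕ) (y : Q) where
  domain : Set E
  codomain : Set (EuclideanSpace ℝ (Fin d))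
  chart : E → EuclideanSpace ℝ (Fin d)
  param : EuclideanSpace ℝ (Fin d) → Q
  isOpen_domain : IsOpen domain
  isOpen_codomain : IsOpen codomain
  mem_domain : θ y ∈ domain
  contDiffOn_chart : ContDiffOn ℝ ∞ chart domain
  contDiffOn_param : ContDiffOn ℝ ∞ (θ ∘ param) codomain
  param_mem : ∀ w ∈ codomain, θ (param w) ∈ domain
  chart_param : ∀ w ∈ codomain, chart (θ (param w)) = w
  chart_mem : ∀ z, θ z ∈ domain → chart (θ z) ∈ codomain
  param_chart : ∀ z, θ z ∈ domain → param (chart (θ z)) = z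

/-- The chart of `Q` given by a slice chart for an embedding. -/
def EmbeddedChart.toOpenPartialHomeomorph {y : Q} (F : EmbeddedChart θ d y) (hθ : IsEmbedding θ) :
    OpenPartialHomeomorph Q (EuclideanSpace ℝ (Fin d)) where
  toFun z := F.chart (θ z)
  invFun := F.param
  source := θ ⁻¹' F.domain
  target := F.codomain
  map_source' z hz := F.chart_mem z hz
  map_target' w hw := F.param_mem w hw
  left_inv' z hz := F.param_chart z hz
  right_inv' w hw := F.chart_param w hw
  open_source := F.isOpen_domain.preimage hθ.continuous
  open_target := F.isOpen_codomain
  continuousOn_toFun := F.contDiffOn_chart.continuousOn.comp hθ.continuous.continuousOn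
    fun _ hz => hz
  continuousOn_invFun := hθ.continuousOn_iff.2 F.contDiffOn_param.continuousOn

/-- The charted space structure given by slice charts for an embedding. -/
abbrev embeddedChartedSpace (F : ∀ y, EmbeddedChart θ d y) (hθ : IsEmbedding θ) :
    ChartedSpace (EuclideanSpace ℝ (Fin d)) Q where
  atlas := Set.range fun y => (F y).toOpenPartialHomeomorph hθ
  chartAt y := (F y).toOpenPartialHomeomorph hθ
  mem_chart_source y := (F y).mem_domain
  chart_mem_atlas y := ⟨y, rfl⟩

variable (F : ∀ y, EmbeddedChart θ d y) (hθ : IsEmbedding θ)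

theorem isManifold_embedded :
    letI := embeddedChartedSpace F hθ
    IsManifold 𝓘(ℝ, EuclideanSpace ℝ (Fin d)) ∞ Q := by
  let _ := embeddedChartedSpace F hθ
  refine isManifold_of_contDiffOn _ _ _ ?_
  rintro _ _ ⟨y, rfl⟩ ⟨z, rfl⟩
  simp only [modelWithCornersSelf_coe, modelWithCornersSelf_coe_symm, Function.id_comp,
    Function.comp_id, Set.preimage_id, Set.range_id, Set.inter_univ]
  refine (F z).contDiffOn_chart.comp ((F y).contDiffOn_param.mono ?_) ?_
  · exact fun w hw => hw.1
  · exact fun w hw => hw.2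

theorem contMDiff_embedded :
    letI := embeddedChartedSpace F hθ
    ContMDiff 𝓘(ℝ, EuclideanSpace ℝ (Fin d)) 𝓘(ℝ, E) ∞ θ := by
  let _ := embeddedChartedSpace F hθ
  have := isManifold_embedded F hθ
  intro y
  have h₁ := (contMDiffAt_of_mem_maximalAtlas (I := 𝓘(ℝ, EuclideanSpace ℝ (Fin d))) (n := ∞)
    (IsManifold.chart_mem_maximalAtlas y) (mem_chart_source _ y))
  have h₂ : ContMDiffAt 𝓘(ℝ, EuclideanSpace ℝ (Fin d)) 𝓘(ℝ, E) ∞ (θ ∘ (F y).param)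
      (chartAt (EuclideanSpace ℝ (Fin d)) y y) :=
    ((F y).contDiffOn_param.contDiffAt
      ((F y).isOpen_codomain.mem_nhds ((F y).chart_mem y (F y).mem_domain))).contMDiffAt
  refine (h₂.comp y h₁).congr_of_eventuallyEq ?_
  filter_upwards [((F y).isOpen_domain.preimage hθ.continuous).mem_nhds (F y).mem_domain]
    with z hz
  exact congrArg θ ((F y).param_chart z hz).symm

/-- A map into a manifold embedded by `θ` is smooth as soon as its composition with `θ` is. -/
theorem contMDiffOn_of_embedded {EA HA A : Type*} [NormedAddCommGroup EA] [NormedSpace ℝ EA]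
    [TopologicalSpace HA] {I : ModelWithCorners ℝ EA HA} [TopologicalSpace A] [ChartedSpace HA A]
    {f : A → Q} {s : Set A} (hf : ContMDiffOn I 𝓘(ℝ, E) ∞ (θ ∘ f) s) :
    letI := embeddedChartedSpace F hθ
    ContMDiffOn I 𝓘(ℝ, EuclideanSpace ℝ (Fin d)) ∞ f s := by
  let _ := embeddedChartedSpace F hθ
  have := isManifold_embedded F hθ
  intro a ha
  have hcont : ContinuousWithinAt f s a :=
    hθ.isInducing.continuousWithinAt_iff.2 (hf.continuousOn a ha)
  set y := f a
  have h₁ : ContMDiffAt 𝓘(ℝ, EuclideanSpace ℝ (Fin d)) 𝓘(ℝ, EuclideanSpace ℝ (Fin d)) ∞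
      (F y).param ((F y).chart (θ y)) :=
    contMDiffAt_symm_of_mem_maximalAtlas (I := 𝓘(ℝ, EuclideanSpace ℝ (Fin d))) (n := ∞)
      (IsManifold.chart_mem_maximalAtlas y) ((F y).chart_mem y (F y).mem_domain)
  have h₂ : ContMDiffAt 𝓘(ℝ, E) 𝓘(ℝ, EuclideanSpace ℝ (Fin d)) ∞ (F y).chart (θ y) :=
    ((F y).contDiffOn_chart.contDiffAt
      ((F y).isOpen_domain.mem_nhds (F y).mem_domain)).contMDiffAt
  have h₃ := h₁.comp_contMDiffWithinAt a (h₂.comp_contMDiffWithinAt a (hf a ha))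
  refine h₃.congr_of_eventuallyEq ?_ ((F y).param_chart y (F y).mem_domain).symm
  filter_upwards [hcont.preimage_mem_nhdsWithin
    (((F y).isOpen_domain.preimage hθ.continuous).mem_nhds (F y).mem_domain)] with z hz
  exact ((F y).param_chart _ hz).symm

end Embedded

/-! ### The homogeneous space of a matrix group acting on skew roots -/

section MatrixEnd

variable {N : Type*} [Fintype N]

/-- The real-linear endomorphisms of `ℂᴺ`. -/
abbrev CEnd (N : Type*) [Fintype N] : Type _ := (N → ℂ) →L[ℝ] (N → ℂ)

/-- Multiplication by `i` on `ℂᴺ`. -/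
def mulI (N : Type*) [Fintype N] : CEnd N :=
  (LinearMap.toContinuousLinearMap
    (Complex.I • (LinearMap.id : (N → ℂ) →ₗ[ℂ] (N → ℂ)))).restrictScalars ℝ

theorem mulI_apply (v : N → ℂ) : mulI N v = Complex.I • v := rfl

/-- Real linear maps commuting with `i` are complex linear. -/
theorem map_complex_smul {T : CEnd N} (h : Commute (mulI N) T) (c : ℂ)
    (v : N → ℂ) : T (c • v) = c • T v := by
  have hI : ∀ v, T (Complex.I • v) = Complex.I • T v := fun v =>
    (congrArg (fun S : CEnd N => S v) h.eq).symm
  have e : ∀ w : N → ℂ, c • w = c.re • w + c.im • (Complex.I • w) := by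
    intro w
    ext i
    simp only [Pi.smul_apply, Pi.add_apply, smul_eq_mul, Complex.real_smul]
    conv_lhs => rw [← Complex.re_add_im c]
    ring
  rw [e, e, map_add, map_smul, map_smul, hI]

variable [DecidableEq N]

/-- A complex matrix as a real-linear endomorphism of `ℂᴺ`. -/
def matEnd : Matrix N N ℂ →ₐ[ℝ] (CEnd N) where
  toFun A := (LinearMap.toContinuousLinearMap (Matrix.toLin' A)).restrictScalars ℝ
  map_one' := by ext; simp
  map_mul' A B := by ext v; simp
  map_zero' := by ext v; simp
  map_add' A B := by ext v; simp
  commutes' r := by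
    ext v
    simp [Matrix.toLin'_apply, Algebra.algebraMap_eq_smul_one, Matrix.smul_mulVec]

theorem matEnd_apply (A : Matrix N N ℂ) (v : N → ℂ) : matEnd A v = A *ᵥ v := rfl

theorem commute_mulI_matEnd (A : Matrix N N ℂ) : Commute (mulI N) (matEnd A) := by
  ext v
  simp [mulI_apply, matEnd_apply, Matrix.mulVec_smul]

/-- The matrix entries of the images of the standard basis vectors. -/
def endEntries : CEnd N →ₗ[ℝ] (N → N → ℂ) where
  toFun T i k := T (Pi.single k 1) i
  map_add' _ _ := rfl
  map_smul' _ _ := rfl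

/-- The matrix whose columns are the images of the standard basis vectors. -/
def endMatrix (T : CEnd N) : Matrix N N ℂ := Matrix.of (endEntries T)

theorem matEnd_endMatrix {T : CEnd N} (h : Commute (mulI N) T) :
    matEnd (endMatrix T) = T := by
  let T' : (N → ℂ) →ₗ[ℂ] (N → ℂ) :=
    { toFun := T, map_add' := map_add T, map_smul' := map_complex_smul h }
  have e : LinearMap.toMatrix' T' = endMatrix T := by
    ext i k
    simp [endMatrix, endEntries, LinearMap.toMatrix'_apply, T']
  ext1 v
  rw [matEnd_apply, ← e, LinearMap.toMatrix'_mulVec]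
  rfl

theorem endMatrix_matEnd (A : Matrix N N ℂ) : endMatrix (matEnd A) = A := by
  ext i k
  simp [endMatrix, endEntries, matEnd_apply]

theorem matEnd_injective : Function.Injective (matEnd : Matrix N N ℂ → CEnd N) := fun A B h => by
  rw [← endMatrix_matEnd A, h, endMatrix_matEnd]

theorem continuous_matEnd : Continuous (matEnd : Matrix N N ℂ → CEnd N) :=
  LinearMap.continuous_of_finiteDimensional (matEnd : Matrix N N ℂ →ₐ[ℝ] CEnd N).toLinearMap

theorem contDiff_matEnd : ContDiff ℝ ∞ (fun A : N → N → ℂ => matEnd (Matrix.of A)) :=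
  (LinearMap.toContinuousLinearMap ((matEnd : Matrix N N ℂ →ₐ[ℝ] CEnd N).toLinearMap ∘ₗ
    (Matrix.ofLinearEquiv ℝ : (N → N → ℂ) ≃ₗ[ℝ] Matrix N N ℂ).toLinearMap)).contDiff

theorem contDiff_endEntries : ContDiff ℝ ∞ (endEntries : CEnd N → (N → N → ℂ)) :=
  (LinearMap.toContinuousLinearMap (endEntries : CEnd N →ₗ[ℝ] (N → N → ℂ))).contDiff

theorem continuous_endMatrix : Continuous (endMatrix : CEnd N → Matrix N N ℂ) :=
  (contDiff_endEntries (N := N)).continuous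

theorem matEnd_mul_inv (g : (Matrix N N ℂ)ˣ) :
    matEnd (g : Matrix N N ℂ) * matEnd ((g⁻¹ : (Matrix N N ℂ)ˣ) : Matrix N N ℂ) = 1 := by
  rw [← map_mul, Units.mul_inv, map_one]

theorem matEnd_inv_mul (g : (Matrix N N ℂ)ˣ) :
    matEnd ((g⁻¹ : (Matrix N N ℂ)ˣ) : Matrix N N ℂ) * matEnd (g : Matrix N N ℂ) = 1 := by
  rw [← map_mul, Units.inv_mul, map_one]

/-- Conjugation of real endomorphisms of `ℂᴺ` by an invertible complex matrix. -/
def conjEnd (g : (Matrix N N ℂ)ˣ) (S : CEnd N) : CEnd N :=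
  matEnd (g : Matrix N N ℂ) * S * matEnd ((g⁻¹ : (Matrix N N ℂ)ˣ) : Matrix N N ℂ)

theorem conjEnd_mul (g h : (Matrix N N ℂ)ˣ) (S : CEnd N) :
    conjEnd (g * h) S = conjEnd g (conjEnd h S) := by
  simp only [conjEnd, mul_inv_rev, Units.val_mul, map_mul, mul_assoc]

theorem conjEnd_one (S : CEnd N) : conjEnd 1 S = S := by
  simp [conjEnd]

theorem conjEnd_eq_iff {g : (Matrix N N ℂ)ˣ} {S T : CEnd N} :
    conjEnd g S = T ↔ matEnd (g : Matrix N N ℂ) * S = T * matEnd (g : Matrix N N ℂ) := by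
  constructor
  · rintro rfl
    rw [conjEnd, mul_assoc _ _ (matEnd (g : Matrix N N ℂ)), matEnd_inv_mul, mul_one]
  · intro h
    rw [conjEnd, h, mul_assoc, matEnd_mul_inv, mul_one]

theorem contDiff_conjEnd (g : (Matrix N N ℂ)ˣ) : ContDiff ℝ ∞ (conjEnd g) := by
  unfold conjEnd
  fun_prop

end MatrixEnd

section Homogeneous

variable {N : Type*} [Fintype N] [DecidableEq N] {G : Subgroup (Matrix N N ℂ)ˣ} {K : Subgroup G}
  {b : LinearMap.BilinForm ℝ (N → ℂ)} {S₀ : CEnd N} {lam : ℤˣ}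

/-- `K` is the isotropy subgroup of `S₀` in the group `G` of complex automorphisms of `b`. -/
structure IsIsotropyOf (G : Subgroup (Matrix N N ℂ)ˣ) (K : Subgroup G)
    (b : LinearMap.BilinForm ℝ (N → ℂ)) (lam : ℤˣ) (S₀ : CEnd N) : Prop where
  mem_group : ∀ g : (Matrix N N ℂ)ˣ, g ∈ G ↔ ∀ u v, b (matEnd (g : Matrix N N ℂ) u)
    (matEnd (g : Matrix N N ℂ) v) = b u v
  mem_skewRoots : S₀ ∈ skewRoots b (mulI N) lam
  mem_isotropy : ∀ g : G, g ∈ K ↔ conjEnd g S₀ = S₀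

/-- The orbit map `gK ↦ g S₀ g⁻¹`. -/
def orbitMap (hK : IsIsotropyOf G K b lam S₀) : G ⧸ K → (CEnd N) :=
  Quotient.lift (fun g : G => conjEnd (g : (Matrix N N ℂ)ˣ) S₀) (by
    intro g h hgh
    have : g⁻¹ * h ∈ K := QuotientGroup.leftRel_apply.1 hgh
    have h₁ := (hK.mem_isotropy _).1 this
    have h₂ : (h : (Matrix N N ℂ)ˣ) = g * ((g⁻¹ * h : G) : (Matrix N N ℂ)ˣ) := by simp
    change conjEnd (g : (Matrix N N ℂ)ˣ) S₀ = conjEnd (h : (Matrix N N ℂ)ˣ) S₀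
    rw [h₂, conjEnd_mul, h₁])

theorem orbitMap_mk (hK : IsIsotropyOf G K b lam S₀) (g : G) :
    orbitMap hK (g : G ⧸ K) = conjEnd (g : (Matrix N N ℂ)ˣ) S₀ := rfl

theorem orbitMap_injective (hK : IsIsotropyOf G K b lam S₀) :
    Function.Injective (orbitMap hK) := by
  intro y z
  obtain ⟨g, rfl⟩ := QuotientGroup.mk_surjective y
  obtain ⟨h, rfl⟩ := QuotientGroup.mk_surjective z
  intro hgh
  rw [orbitMap_mk, orbitMap_mk] at hgh
  refine QuotientGroup.eq.2 ((hK.mem_isotropy _).2 ?_)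
  rw [Subgroup.coe_mul, conjEnd_mul, ← hgh, ← conjEnd_mul]
  simp [conjEnd_one]

theorem continuous_orbitMap (hK : IsIsotropyOf G K b lam S₀) : Continuous (orbitMap hK) := by
  refine continuous_quot_lift _ ?_
  unfold conjEnd
  refine ((continuous_matEnd.comp (Units.continuous_val.comp continuous_subtype_val)).mul
    continuous_const).mul (continuous_matEnd.comp (Units.continuous_val.comp
      (continuous_inv.comp continuous_subtype_val)))

theorem conjEnd_mem_skewRoots (hK : IsIsotropyOf G K b lam S₀) {S : CEnd N}
    (hS : S ∈ skewRoots b (mulI N) lam) (g : G) :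
    conjEnd (g : (Matrix N N ℂ)ˣ) S ∈ skewRoots b (mulI N) lam :=
  conj_mem_skewRoots hS (matEnd_mul_inv _) (matEnd_inv_mul _) ((hK.mem_group g).1 g.2)
    (commute_mulI_matEnd _)

theorem orbitMap_mem (hK : IsIsotropyOf G K b lam S₀) (y : G ⧸ K) :
    orbitMap hK y ∈ skewRoots b (mulI N) lam := by
  obtain ⟨g, rfl⟩ := QuotientGroup.mk_surjective y
  exact conjEnd_mem_skewRoots hK hK.mem_skewRoots g

open Classical in
/-- The Cayley transform of `X`, as an element of `G`; the unit element if the Cayley transform is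
not in `G`. -/
def cayleyGroup (G : Subgroup (Matrix N N ℂ)ˣ) (X : CEnd N) : G :=
  if h : ∃ g : G, matEnd ((g : (Matrix N N ℂ)ˣ) : Matrix N N ℂ) = cayley X ∧
    matEnd (((g : (Matrix N N ℂ)ˣ)⁻¹ : (Matrix N N ℂ)ˣ) : Matrix N N ℂ) = cayley (-X)
  then h.choose else 1

theorem cayleyGroup_spec (hK : IsIsotropyOf G K b lam S₀) {X : CEnd N}
    (hX : X ∈ cartanPart b (mulI N) S₀) (h₁ : IsUnit (1 + X)) (h₂ : IsUnit (1 - X)) :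
    matEnd ((cayleyGroup G X : (Matrix N N ℂ)ˣ) : Matrix N N ℂ) = cayley X ∧
    matEnd (((cayleyGroup G X : (Matrix N N ℂ)ˣ)⁻¹ : (Matrix N N ℂ)ˣ) : Matrix N N ℂ)
      = cayley (-X) := by
  have h : ∃ g : G, matEnd ((g : (Matrix N N ℂ)ˣ) : Matrix N N ℂ) = cayley X ∧
      matEnd (((g : (Matrix N N ℂ)ˣ)⁻¹ : (Matrix N N ℂ)ˣ) : Matrix N N ℂ) = cayley (-X) := by
    have e₁ : matEnd (endMatrix (cayley X)) = cayley X := matEnd_endMatrix hX.2.1.cayley_right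
    have e₂ : matEnd (endMatrix (cayley (-X))) = cayley (-X) :=
      matEnd_endMatrix hX.2.1.neg_right.cayley_right
    have e₃ : cayley (-X) * cayley X = 1 := by
      have := cayley_mul_cayley_neg (X := -X) (by rwa [← sub_eq_add_neg]) (by simpa using h₁)
      rwa [neg_neg] at this
    let g : (Matrix N N ℂ)ˣ := ⟨endMatrix (cayley X), endMatrix (cayley (-X)),
      matEnd_injective (by rw [map_mul, e₁, e₂, cayley_mul_cayley_neg h₁ h₂, map_one]),
      matEnd_injective (by rw [map_mul, e₁, e₂, e₃, map_one])⟩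
    refine ⟨⟨g, (hK.mem_group g).2 fun u v => ?_⟩, e₁, e₂⟩
    change b (matEnd (endMatrix (cayley X)) u) (matEnd (endMatrix (cayley X)) v) = _
    rw [e₁, form_cayley hX h₂]
  rw [cayleyGroup, dif_pos h]
  exact h.choose_spec

theorem conjEnd_cayleyGroup (hK : IsIsotropyOf G K b lam S₀) {X : CEnd N}
    (hX : X ∈ cartanPart b (mulI N) S₀) (h₁ : IsUnit (1 + X)) (h₂ : IsUnit (1 - X)) :
    conjEnd (cayleyGroup G X : (Matrix N N ℂ)ˣ) S₀ = cayley X * S₀ * cayley (-X) := by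
  obtain ⟨e₁, e₂⟩ := cayleyGroup_spec hK hX h₁ h₂
  rw [conjEnd, e₁, e₂]

theorem continuousOn_cayleyGroup (hK : IsIsotropyOf G K b lam S₀)
    {W : Set (cartanPart b (mulI N) S₀)}
    (hW : ∀ X ∈ W, IsUnit (1 + (X : CEnd N)) ∧
      IsUnit (1 - (X : CEnd N))) :
    ContinuousOn (fun X : cartanPart b (mulI N) S₀ =>
      cayleyGroup G (X : CEnd N)) W := by
  rw [continuousOn_iff_continuous_domRestrict, continuous_induced_rng, Units.continuous_iff]
  have hc : ContinuousOn (cayley : (CEnd N) → _) {X | IsUnit (1 - X)} :=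
    contDiffOn_cayley.continuousOn
  have hval : Continuous fun X : W => ((X : cartanPart b (mulI N) S₀) : CEnd N) :=
    continuous_subtype_val.comp continuous_subtype_val
  constructor
  · have : Continuous fun X : W => endMatrix
        (cayley ((X : cartanPart b (mulI N) S₀) : CEnd N)) :=
      continuous_endMatrix.comp (hc.comp_continuous hval fun X => (hW X X.2).2)
    refine this.congr fun X => ?_
    rw [← (cayleyGroup_spec hK (X : cartanPart b (mulI N) S₀).2 (hW X X.2).1 (hW X X.2).2).1,
      endMatrix_matEnd]
    rfl
  · have : Continuous fun X : W => endMatrix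
        (cayley (-((X : cartanPart b (mulI N) S₀) : CEnd N))) :=
      continuous_endMatrix.comp (hc.comp_continuous hval.neg fun X => by
        simpa using (hW X X.2).1)
    refine this.congr fun X => ?_
    rw [← (cayleyGroup_spec hK (X : cartanPart b (mulI N) S₀).2 (hW X X.2).1 (hW X X.2).2).2,
      endMatrix_matEnd]
    rfl

/-- Around each point, the orbit map has a slice chart and `G → G/K` a local section which is a
smooth function of the value of the orbit map. -/
theorem exists_orbit_chart (hK : IsIsotropyOf G K b lam S₀) (y : G ⧸ K) :
    ∃ (F : EmbeddedChart (orbitMap hK) (Module.finrank ℝ (cartanPart b (mulI N) S₀)) y)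
      (s : (CEnd N) → G),
      ContinuousOn F.param F.codomain ∧
      (∀ z, orbitMap hK z ∈ F.domain → (s (orbitMap hK z) : G ⧸ K) = z) ∧
      ContDiffOn ℝ ∞ (fun S => entries (s S)) (F.domain ∩ skewRoots b (mulI N) lam) := by
  obtain ⟨g₁, rfl⟩ := QuotientGroup.mk_surjective y
  obtain ⟨U, W, c, hU, hSU, hW, hc, hp, hq⟩ := exists_skewRoots_chart hK.mem_skewRoots
  let ε : cartanPart b (mulI N) S₀ ≃L[ℝ]
      EuclideanSpace ℝ (Fin (Module.finrank ℝ (cartanPart b (mulI N) S₀))) :=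
    ContinuousLinearEquiv.ofFinrankEq (by simp)
  let γ : CEnd N → CEnd N := conjEnd (g₁ : (Matrix N N ℂ)ˣ)⁻¹
  have hγ : ContDiff ℝ ∞ γ := contDiff_conjEnd _
  have hγ₁ : ∀ S, γ (conjEnd (g₁ : (Matrix N N ℂ)ˣ) S) = S := fun S => by
    change conjEnd _ (conjEnd _ S) = S
    rw [← conjEnd_mul, inv_mul_cancel, conjEnd_one]
  have hγ₂ : ∀ S, conjEnd (g₁ : (Matrix N N ℂ)ˣ) (γ S) = S := fun S => by
    change conjEnd _ (conjEnd _ S) = S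
    rw [← conjEnd_mul, mul_inv_cancel, conjEnd_one]
  have hγO : ∀ S ∈ skewRoots b (mulI N) lam, γ S ∈ skewRoots b (mulI N) lam := fun S hS =>
    conjEnd_mem_skewRoots hK hS g₁⁻¹
  let k : cartanPart b (mulI N) S₀ → G := fun X => g₁ * cayleyGroup G (X : CEnd N)
  have hk : ∀ X ∈ W, orbitMap hK (k X : G ⧸ K) = conjEnd (g₁ : (Matrix N N ℂ)ˣ)
      (cayley (X : CEnd N) * S₀ * cayley (-X : CEnd N)) := by
    intro X hX
    obtain ⟨h₁, h₂, -⟩ := hp X hX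
    rw [orbitMap_mk, Subgroup.coe_mul, conjEnd_mul, conjEnd_cayleyGroup hK X.2 h₁ h₂]
  have hback : ∀ z : G ⧸ K, γ (orbitMap hK z) ∈ U → (k (c (γ (orbitMap hK z))) : G ⧸ K) = z := by
    intro z hz
    obtain ⟨h₁, h₂⟩ := hq _ (hγO _ (orbitMap_mem hK z)) hz
    refine orbitMap_injective hK ?_
    rw [hk _ h₁, h₂, hγ₂]
  have hval := contDiff_submodule_val (cartanPart b (mulI N) S₀)
  refine ⟨⟨γ ⁻¹' U, ε.symm ⁻¹' W, fun S => ε (c (γ S)), fun w => (k (ε.symm w) : G ⧸ K),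
    hU.preimage hγ.continuous, hW.preimage ε.symm.continuous, ?_, ?_, ?_, ?_, ?_, ?_, ?_⟩,
    fun S => k (c (γ S)), ?_, hback, ?_⟩
  · rw [Set.mem_preimage, orbitMap_mk, hγ₁]
    exact hSU
  · exact ε.contDiff.comp_contDiffOn (hc.comp hγ.contDiffOn fun S hS => hS)
  · have h₁ : ContDiffOn ℝ ∞ (fun w => conjEnd (g₁ : (Matrix N N ℂ)ˣ)
        (cayley (ε.symm w : CEnd N) * S₀ *
          cayley (-ε.symm w : CEnd N))) (ε.symm ⁻¹' W) := by
      refine (contDiff_conjEnd _).comp_contDiffOn ?_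
      have hv := hval.comp ε.symm.contDiff
      refine ((contDiffOn_cayley.comp hv.contDiffOn ?_).mul contDiffOn_const).mul
        (contDiffOn_cayley.comp hv.neg.contDiffOn ?_)
      · exact fun w hw => (hp _ hw).2.1
      · intro w hw
        simpa using (hp _ hw).1
    exact h₁.congr fun w hw => hk _ hw
  · intro w hw
    rw [Set.mem_preimage, hk _ hw, hγ₁]
    exact (hp _ hw).2.2.1
  · intro w hw
    rw [hk _ hw, hγ₁, (hp _ hw).2.2.2, ε.apply_symm_apply]
  · intro z hz
    rw [Set.mem_preimage, ε.symm_apply_apply]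
    exact (hq _ (hγO _ (orbitMap_mem hK z)) hz).1
  · intro z hz
    rw [ε.symm_apply_apply]
    exact hback z hz
  · refine QuotientGroup.continuous_mk.comp_continuousOn (continuousOn_const.mul ?_)
    exact (continuousOn_cayleyGroup hK fun X hX => ⟨(hp X hX).1, (hp X hX).2.1⟩).comp
      ε.symm.continuous.continuousOn fun w hw => hw
  · have h₁ : ContDiffOn ℝ ∞ (fun S => endEntries (matEnd ((g₁ : (Matrix N N ℂ)ˣ) : Matrix N N ℂ) *
        cayley (c (γ S) : CEnd N))) (γ ⁻¹' U ∩ skewRoots b (mulI N) lam) := by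
      refine contDiff_endEntries.comp_contDiffOn (contDiffOn_const.mul ?_)
      refine contDiffOn_cayley.comp (hval.comp_contDiffOn (hc.comp hγ.contDiffOn
        fun S hS => hS.1)) ?_
      exact fun S hS => (hp _ (hq _ (hγO _ hS.2) hS.1).1).2.1
    refine h₁.congr fun S hS => ?_
    obtain ⟨h₂, h₃, -⟩ := hp _ (hq _ (hγO _ hS.2) hS.1).1
    rw [← (cayleyGroup_spec hK (c (γ S)).2 h₂ h₃).1, ← map_mul]
    exact (congrArg (fun A : Matrix N N ℂ => Matrix.of.symm A) (endMatrix_matEnd _)).symm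

/-- The orbit map is an embedding because, by the slice charts, its local inverses are continuous.
-/
theorem isEmbedding_orbitMap (hK : IsIsotropyOf G K b lam S₀) : IsEmbedding (orbitMap hK) := by
  refine ⟨⟨?_⟩, orbitMap_injective hK⟩
  refine TopologicalSpace.ext_nhds fun y => ?_
  rw [nhds_induced]
  refine le_antisymm (continuous_orbitMap hK).continuousAt.le_comap ?_
  obtain ⟨F, -, hF, -⟩ := exists_orbit_chart hK y
  have hy := F.mem_domain
  have h₁ : Filter.Tendsto (fun z => F.param (F.chart (orbitMap hK z)))
      (Filter.comap (orbitMap hK) (𝓝 (orbitMap hK y))) (𝓝 (F.param (F.chart (orbitMap hK y)))) := by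
    have h₂ := hF.continuousAt (F.isOpen_codomain.mem_nhds (F.chart_mem y hy))
    have h₃ := F.contDiffOn_chart.continuousOn.continuousAt (F.isOpen_domain.mem_nhds hy)
    exact h₂.tendsto.comp (h₃.tendsto.comp Filter.tendsto_comap)
  rw [F.param_chart y hy] at h₁
  refine Filter.tendsto_id'.1 (h₁.congr' ?_)
  filter_upwards [Filter.preimage_mem_comap (F.isOpen_domain.mem_nhds hy)] with z hz
  exact F.param_chart z hz

theorem entries_injective : Function.Injective (entries : G → N → N → ℂ) := fun _ _ hgh =>
  Subtype.ext (Units.ext hgh)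

/-- The isotropy quotient is a homogeneous manifold embedded by the orbit map. -/
theorem exists_isHomogeneousManifold (hK : IsIsotropyOf G K b lam S₀) :
    ∃ (d : ℕ) (F : ∀ y, EmbeddedChart (orbitMap hK) d y),
      letI := embeddedChartedSpace F (isEmbedding_orbitMap hK)
      IsHomogeneousManifold G K d := by
  choose F s _ hs hsm using exists_orbit_chart hK
  refine ⟨_, F, ?_⟩
  let _ := embeddedChartedSpace F (isEmbedding_orbitMap hK)
  -- the projection, extended by a constant outside of `G`; it is smooth since its composition with
  -- the orbit map is `g ↦ g S₀ g⁻¹`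
  refine ⟨isManifold_embedded F _, ⟨Function.extend entries (fun g : G => (g : G ⧸ K))
    (fun _ => ((1 : G) : G ⧸ K)), fun g => entries_injective.extend_apply _ _ g, ?_⟩, fun y => ?_⟩
  · refine contMDiffOn_of_embedded F (isEmbedding_orbitMap hK) ?_
    rw [contMDiffOn_iff_contDiffOn]
    have h₁ : ContDiffOn ℝ ∞ (fun A : N → N → ℂ => matEnd (Matrix.of A) * S₀ *
        Ring.inverse (matEnd (Matrix.of A))) (Set.range (entries : G → N → N → ℂ)) := by
      have hm := contDiff_matEnd (N := N)
      refine (hm.contDiffOn.mul contDiffOn_const).mul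
        ((contDiffOn_ringInverse (A := CEnd N)).comp hm.contDiffOn ?_)
      rintro _ ⟨g, rfl⟩
      exact (g : (Matrix N N ℂ)ˣ).isUnit.map (matEnd : Matrix N N ℂ →ₐ[ℝ] CEnd N)
    refine h₁.congr ?_
    rintro _ ⟨g, rfl⟩
    rw [Function.comp_apply, entries_injective.extend_apply, orbitMap_mk, conjEnd]
    congr 1
    exact ((Ring.inverse_unit (Units.map (matEnd : Matrix N N ℂ →ₐ[ℝ] _).toMonoidHom
      (g : (Matrix N N ℂ)ˣ)))).symm
  · refine ⟨orbitMap hK ⁻¹' (F y).domain, fun z => s y (orbitMap hK z),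
      (F y).isOpen_domain.preimage (continuous_orbitMap hK), (F y).mem_domain, hs y, ?_⟩
    exact (hsm y).contMDiffOn.comp (contMDiff_embedded F _).contMDiffOn
      fun z hz => ⟨hz, orbitMap_mem hK z⟩

end Homogeneous

/-! ### Adapted local frames and local triviality -/

section Frames

variable {m : ℕ} {M : Type*} [TopologicalSpace M] [ChartedSpace (RModel m) M]
  [IsManifold 𝓘(ℝ, RModel m) ∞ M]

/-- The split pairing on the model fibre of `𝕋M`. -/
def modelPairing (X Y : ExtModel m) : ℝ := Y.2 X.1 + X.2 Y.1

/-- The endomorphism `diag (T, (T')*)` of `E ⊕ E*`. -/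
def dualDiag {E : Type*} [NormedAddCommGroup E] [NormedSpace ℝ E] (T : (E →L[ℝ] E) × (E →L[ℝ] E)) :
    (E × (E →L[ℝ] ℝ)) →L[ℝ] (E × (E →L[ℝ] ℝ)) :=
  T.1.prodMap ((ContinuousLinearMap.compL ℝ E E ℝ).flip T.2)

theorem contDiff_prodMap (E F : Type*) [NormedAddCommGroup E] [NormedSpace ℝ E]
    [NormedAddCommGroup F] [NormedSpace ℝ F] :
    ContDiff ℝ ∞ (fun p : (E →L[ℝ] E) × (F →L[ℝ] F) => p.1.prodMap p.2) :=
  (ContinuousLinearMap.prodMapL ℝ E E F F).contDiff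

theorem contDiff_precomp (E F : Type*) [NormedAddCommGroup E] [NormedSpace ℝ E]
    [NormedAddCommGroup F] [NormedSpace ℝ F] :
    ContDiff ℝ ∞ (fun T : E →L[ℝ] E => (ContinuousLinearMap.compL ℝ E E F).flip T) := by
  fun_prop

theorem contDiff_dualDiag {E : Type*} [NormedAddCommGroup E] [NormedSpace ℝ E] :
    ContDiff ℝ ∞ (dualDiag (E := E)) :=
  ContDiff.comp (contDiff_prodMap E (E →L[ℝ] ℝ))
    (contDiff_fst.prodMk ((contDiff_precomp E ℝ).comp contDiff_snd))

/-- The endomorphism `diag (T, (T')*)` of the model fibre of `𝕋M`. -/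
def modelDiag (T : (RModel m →L[ℝ] RModel m) × (RModel m →L[ℝ] RModel m)) : EndModel m :=
  dualDiag T

theorem contDiff_modelDiag : ContDiff ℝ ∞ (modelDiag : _ → EndModel m) :=
  contDiff_dualDiag (E := RModel m)

theorem modelDiag_apply (T T' : RModel m →L[ℝ] RModel m) (X : ExtModel m) :
    modelDiag (T, T') X = (T X.1, X.2.comp T') := rfl

/-- The trivialization of `𝕋M` given by the preferred chart at `p`, on the fibre over `x`. -/
def extEquiv (p : M) {x : M} (hx : x ∈ (chartAt (RModel m) p).source) :
    ExtTangent m M x ≃L[ℝ] ExtModel m :=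
  (trivializationAt (ExtModel m) (ExtTangent m M) p).continuousLinearEquivAt ℝ x
    ⟨hx, hx, Set.mem_univ _⟩

/-- The trivialization of `TM` given by the preferred chart at `p`, on the fibre over `x`. -/
def tanEquiv (p : M) {x : M} (hx : x ∈ (chartAt (RModel m) p).source) :
    TSpace m M x ≃L[ℝ] RModel m :=
  (trivializationAt (RModel m) (TSpace m M) p).continuousLinearEquivAt ℝ x hx

theorem extEquiv_fst (p : M) {x : M} (hx : x ∈ (chartAt (RModel m) p).source)
    (X : ExtTangent m M x) : (extEquiv p hx X).1 = tanEquiv p hx X.1 := rfl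

theorem extEquiv_snd (p : M) {x : M} (hx : x ∈ (chartAt (RModel m) p).source)
    (X : ExtTangent m M x) (v : RModel m) :
    (extEquiv p hx X).2 v = (show ℝ from X.2 ((tanEquiv p hx).symm v)) := by
  rw [show ((tanEquiv p hx).symm v) = (trivializationAt (RModel m) (TSpace m M) p).symmL ℝ x v from
    congrFun ((trivializationAt (RModel m) (TSpace m M) p).symm_continuousLinearEquivAt_eq hx) v]
  exact congrArg (fun T : Bundle.Trivial M ℝ x →L[ℝ] ℝ => T (X.2
      ((trivializationAt (RModel m) (TSpace m M) p).symmL ℝ x v)))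
    (Bundle.Trivial.continuousLinearMapAt_trivialization ℝ M ℝ x)

theorem modelPairing_extEquiv (p : M) {x : M} (hx : x ∈ (chartAt (RModel m) p).source)
    (X Y : ExtTangent m M x) :
    modelPairing (extEquiv p hx X) (extEquiv p hx Y) = extPairing X Y := by
  unfold modelPairing extPairing
  rw [extEquiv_snd, extEquiv_snd, extEquiv_fst, extEquiv_fst,
    ContinuousLinearEquiv.symm_apply_apply, ContinuousLinearEquiv.symm_apply_apply]

/-- The endomorphism `j x` of `TₓM` read in the preferred chart at `p`. -/
def jModel (j : ∀ x : M, TSpace m M x →L[ℝ] TSpace m M x) (p x : M) : RModel m →L[ℝ] RModel m :=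
  ContinuousLinearMap.inCoordinates (RModel m) (TSpace m M) (RModel m) (TSpace m M) p x p x (j x)

theorem jModel_eq (j : ∀ x : M, TSpace m M x →L[ℝ] TSpace m M x) (p : M) {x : M}
    (hx : x ∈ (chartAt (RModel m) p).source) (v : RModel m) :
    jModel j p x v = tanEquiv p hx (j x ((tanEquiv p hx).symm v)) := by
  unfold jModel
  rw [ContinuousLinearMap.inCoordinates_eq hx hx]
  rfl

theorem contMDiffOn_jModel {j : ∀ x : M, TSpace m M x →L[ℝ] TSpace m M x}
    (hj : IsSmoothTensorField j) (p : M) :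
    ContMDiffOn 𝓘(ℝ, RModel m) 𝓘(ℝ, RModel m →L[ℝ] RModel m) ∞ (jModel j p)
      (chartAt (RModel m) p).source := by
  have h := (Bundle.Trivialization.contMDiffOn_iff (IB := 𝓘(ℝ, RModel m)) (n := ∞)
    (e := trivializationAt (RModel m →L[ℝ] RModel m)
      (fun x : M => TSpace m M x →L[ℝ] TSpace m M x) p) (s := (chartAt (RModel m) p).source)
    (f := fun x => TotalSpace.mk' (RModel m →L[ℝ] RModel m)
      (E := fun x : M => TSpace m M x →L[ℝ] TSpace m M x) x (j x))
    (fun x hx => ⟨hx, hx⟩)).1 hj.contMDiffOn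
  exact h.2

/-- `J_ℓ` on the model fibre, for the complex structure `j₀`. -/
def modelJ (ell : ℤˣ) (j₀ : RModel m →L[ℝ] RModel m) (X : ExtModel m) : ExtModel m :=
  (j₀ X.1, (ell : ℤ) • X.2.comp j₀)

theorem extEquiv_JEll (j : ∀ x : M, TSpace m M x →L[ℝ] TSpace m M x) (ell : ℤˣ) (p : M) {x : M}
    (hx : x ∈ (chartAt (RModel m) p).source) (X : ExtTangent m M x) :
    extEquiv p hx (JEll j ell x X) = modelJ ell (jModel j p x) (extEquiv p hx X) := by
  refine Prod.ext ?_ (ContinuousLinearMap.ext fun v => ?_)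
  · rw [extEquiv_fst]
    change _ = jModel j p x (extEquiv p hx X).1
    rw [jModel_eq j p hx, extEquiv_fst, ContinuousLinearEquiv.symm_apply_apply]
    rfl
  · rw [extEquiv_snd]
    change _ = (ell : ℤ) • ((extEquiv p hx X).2 (jModel j p x v))
    rw [extEquiv_snd, jModel_eq j p hx, ContinuousLinearEquiv.symm_apply_apply]
    rfl

theorem trivializationAt_end_snd (p : M) {q : TotEnd m M}
    (hx : q.1 ∈ (chartAt (RModel m) p).source) :
    (trivializationAt (EndModel m) (ExtEnd m M) p q).2 =
      (extEquiv p hx : ExtTangent m M q.1 →L[ℝ] ExtModel m) ∘L q.2 ∘L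
        ((extEquiv p hx).symm : ExtModel m →L[ℝ] ExtTangent m M q.1) := by
  rw [hom_trivializationAt_apply]
  exact ContinuousLinearMap.inCoordinates_eq (σ := RingHom.id ℝ) _ _

omit [IsManifold 𝓘(ℝ, RModel m) ∞ M] in
theorem isAdapted_of_intertwining {j : ∀ x : M, TSpace m M x →L[ℝ] TSpace m M x} {ell : ℤˣ}
    {N : Type*} {B : (N → ℂ) → (N → ℂ) → ℂ} {p x : M} {φ : (N → ℂ) ≃L[ℝ] ExtTangent m M p}
    (hφ : IsAdapted j ell B φ) (τ : ExtTangent m M p ≃L[ℝ] ExtTangent m M x)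
    (hτ : ∀ X Y, extPairing (τ X) (τ Y) = extPairing X Y)
    (hJ : ∀ X, τ (JEll j ell p X) = JEll j ell x (τ X)) : IsAdapted j ell B (φ.trans τ) := by
  refine ⟨fun z => ?_, fun z w => ?_⟩
  · change τ (φ (Complex.I • z)) = JEll j ell x (τ (φ z))
    rw [hφ.1, hJ]
  · rw [← hφ.2 z w]
    change bEll j ell (τ (φ z)) (τ (φ w)) = _
    unfold bEll
    rw [← hJ, hτ, hτ]

theorem half_one_sub_mul {A : Type*} [Ring A] [Algebra ℝ A] {r r₀ : A} (h : r * r = -1)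
    (h₀ : r₀ * r₀ = -1) :
    ((1 / 2 : ℝ) • (1 - r * r₀)) * r₀ = r * ((1 / 2 : ℝ) • (1 - r * r₀)) := by
  rw [smul_mul_assoc, mul_smul_comm, sub_mul, mul_sub, mul_assoc, h₀, ← mul_assoc, h]
  congr 1
  noncomm_ring

/-- The vector bundle automorphism `½ (1 - j j₀)` intertwines nearby complex structures `j` with
the constant one, `j₀`. -/
theorem exists_intertwining {j : ∀ x : M, TSpace m M x →L[ℝ] TSpace m M x}
    (hj : IsSmoothTensorField j) (hsq : ∀ x (v : TSpace m M x), j x (j x v) = -v) (p : M) :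
    ∃ U : Set M, IsOpen U ∧ p ∈ U ∧ U ⊆ (chartAt (RModel m) p).source ∧
      ∃ T T' : M → RModel m →L[ℝ] RModel m,
        ContMDiffOn 𝓘(ℝ, RModel m) 𝓘(ℝ, RModel m →L[ℝ] RModel m) ∞ T U ∧
        ContMDiffOn 𝓘(ℝ, RModel m) 𝓘(ℝ, RModel m →L[ℝ] RModel m) ∞ T' U ∧
        ∀ x ∈ U, T x * T' x = 1 ∧ T' x * T x = 1 ∧ T x * jModel j p p = jModel j p x * T x := by
  have hsq' : ∀ x ∈ (chartAt (RModel m) p).source, jModel j p x * jModel j p x = -1 := by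
    intro x hx
    ext1 v
    change jModel j p x (jModel j p x v) = -v
    rw [jModel_eq j p hx, jModel_eq j p hx, ContinuousLinearEquiv.symm_apply_apply, hsq, map_neg,
      ContinuousLinearEquiv.apply_symm_apply]
  set j₀ := jModel j p p with hj₀
  have hj₀sq : j₀ * j₀ = -1 := hsq' p (mem_chart_source _ p)
  have hlin : ContDiff ℝ ∞ (fun r : RModel m →L[ℝ] RModel m => (1 / 2 : ℝ) • (1 - r * j₀)) := by
    fun_prop
  have hT : ContMDiffOn 𝓘(ℝ, RModel m) 𝓘(ℝ, RModel m →L[ℝ] RModel m) ∞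
      (fun x => (1 / 2 : ℝ) • (1 - jModel j p x * j₀)) (chartAt (RModel m) p).source :=
    hlin.contMDiff.comp_contMDiffOn (contMDiffOn_jModel hj p)
  refine ⟨_, hT.continuousOn.isOpen_inter_preimage (chartAt (RModel m) p).open_source
    (Units.isOpen (R := RModel m →L[ℝ] RModel m)), ⟨mem_chart_source _ p, ?_⟩,
    Set.inter_subset_left, fun x => (1 / 2 : ℝ) • (1 - jModel j p x * j₀),
    fun x => Ring.inverse ((1 / 2 : ℝ) • (1 - jModel j p x * j₀)),
    hT.mono Set.inter_subset_left, ?_, ?_⟩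
  · change IsUnit ((1 / 2 : ℝ) • (1 - j₀ * j₀))
    rw [hj₀sq, sub_neg_eq_add, ← two_smul ℝ (1 : RModel m →L[ℝ] RModel m), smul_smul]
    norm_num
  · exact (contDiffOn_ringInverse (A := RModel m →L[ℝ] RModel m)).contMDiffOn.comp
      (hT.mono Set.inter_subset_left) fun x hx => hx.2
  · rintro x ⟨hx, hu⟩
    refine ⟨Ring.mul_inverse_cancel _ hu, Ring.inverse_mul_cancel _ hu, ?_⟩
    exact half_one_sub_mul (hsq' x hx) hj₀sq

/-- Every adapted frame of `(𝕋ₚM, J_ℓ, b_ℓ)` extends to a smooth family of adapted frames. The maps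
`a`, `a'` are the frames and their inverses read in the preferred chart at `p`. -/
theorem exists_adapted_family {j : ∀ x : M, TSpace m M x →L[ℝ] TSpace m M x}
    (hj : IsSmoothTensorField j) (hsq : ∀ x (v : TSpace m M x), j x (j x v) = -v) (ell : ℤˣ)
    {N : Type*} [Fintype N] {B : (N → ℂ) → (N → ℂ) → ℂ} (p : M)
    {φ₀ : (N → ℂ) ≃L[ℝ] ExtTangent m M p} (hφ₀ : IsAdapted j ell B φ₀) :
    ∃ (U : Set M) (hU : U ⊆ (chartAt (RModel m) p).source) (φ : ∀ x, (N → ℂ) ≃L[ℝ] ExtTangent m M x)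
      (a : M → (N → ℂ) →L[ℝ] ExtModel m) (a' : M → ExtModel m →L[ℝ] (N → ℂ)),
      IsOpen U ∧ p ∈ U ∧ (∀ x ∈ U, IsAdapted j ell B (φ x)) ∧
      ContMDiffOn 𝓘(ℝ, RModel m) 𝓘(ℝ, (N → ℂ) →L[ℝ] ExtModel m) ∞ a U ∧
      ContMDiffOn 𝓘(ℝ, RModel m) 𝓘(ℝ, ExtModel m →L[ℝ] (N → ℂ)) ∞ a' U ∧
      ∀ x (hx : x ∈ U), (∀ z, extEquiv p (hU hx) (φ x z) = a x z) ∧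
        ∀ X, (φ x).symm ((extEquiv p (hU hx)).symm X) = a' x X := by
  obtain ⟨U, hUo, hpU, hU, T, T', hT, hT', hTT⟩ := exists_intertwining hj hsq p
  have hp := mem_chart_source (RModel m) p
  -- `diag (T, (T⁻¹)*)` preserves the pairing
  let A : ∀ x, x ∈ U → (ExtModel m ≃L[ℝ] ExtModel m) := fun x hx =>
    ContinuousLinearEquiv.equivOfInverse (modelDiag (T x, T' x)) (modelDiag (T' x, T x))
      (fun X => by
        obtain ⟨h₁, h₂, -⟩ := hTT x hx
        refine Prod.ext (congrArg (fun S : RModel m →L[ℝ] RModel m => S X.1) h₂) ?_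
        exact congrArg (fun S : RModel m →L[ℝ] RModel m => X.2.comp S) h₂)
      (fun X => by
        obtain ⟨h₁, h₂, -⟩ := hTT x hx
        refine Prod.ext (congrArg (fun S : RModel m →L[ℝ] RModel m => S X.1) h₁) ?_
        exact congrArg (fun S : RModel m →L[ℝ] RModel m => X.2.comp S) h₁)
  let τ : ∀ x, x ∈ U → (ExtTangent m M p ≃L[ℝ] ExtTangent m M x) := fun x hx =>
    ((extEquiv p hp).trans (A x hx)).trans (extEquiv p (hU hx)).symm
  classical
  let φ : ∀ x, (N → ℂ) ≃L[ℝ] ExtTangent m M x := fun x =>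
    if hx : x ∈ U then φ₀.trans (τ x hx) else
      -- an arbitrary frame outside of `U`
      (φ₀.trans (extEquiv p hp)).trans (extEquiv x (mem_chart_source _ x)).symm
  have hφ : ∀ x (hx : x ∈ U), φ x = φ₀.trans (τ x hx) := fun x hx => dif_pos hx
  let κ : (N → ℂ) ≃L[ℝ] ExtModel m := φ₀.trans (extEquiv p hp)
  refine ⟨U, hU, φ, fun x => (modelDiag (T x, T' x)).comp (κ : (N → ℂ) →L[ℝ] ExtModel m),
    fun x => (κ.symm : ExtModel m →L[ℝ] (N → ℂ)).comp (modelDiag (T' x, T x)), hUo, hpU, ?_, ?_, ?_,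
    ?_⟩
  · intro x hx
    rw [hφ x hx]
    obtain ⟨h₁, h₂, h₃⟩ := hTT x hx
    have h₂' : ∀ v, T' x (T x v) = v := fun v =>
      congrArg (fun S : RModel m →L[ℝ] RModel m => S v) h₂
    have h₄ : jModel j p p * T' x = T' x * jModel j p x := by
      calc jModel j p p * T' x = T' x * (T x * jModel j p p) * T' x := by
            rw [← mul_assoc, h₂, one_mul]
        _ = T' x * jModel j p x * (T x * T' x) := by rw [h₃]; noncomm_ring
        _ = _ := by rw [h₁, mul_one]
    have hE : ∀ X, extEquiv p (hU hx) (τ x hx X) = modelDiag (T x, T' x) (extEquiv p hp X) :=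
      fun X => (extEquiv p (hU hx)).apply_symm_apply _
    refine isAdapted_of_intertwining hφ₀ (τ x hx) (fun X Y => ?_) fun X => ?_
    · rw [← modelPairing_extEquiv p (hU hx), ← modelPairing_extEquiv p hp, hE, hE]
      simp only [modelPairing, modelDiag_apply, ContinuousLinearMap.comp_apply, h₂']
    · refine (extEquiv p (hU hx)).injective ?_
      rw [hE, extEquiv_JEll, extEquiv_JEll, hE]
      refine Prod.ext ?_ ?_
      · exact congrArg (fun S : RModel m →L[ℝ] RModel m => S (extEquiv p hp X).1) h₃
      · refine ContinuousLinearMap.ext fun v => ?_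
        exact congrArg (fun S : RModel m →L[ℝ] RModel m =>
          (ell : ℤ) • ((extEquiv p hp X).2 (S v))) h₄
  · have h₁ := (contDiff_modelDiag (m := m)).contMDiff.comp_contMDiffOn (hT.prodMk_space hT')
    have h₂ : ContDiff ℝ ∞ (fun S : EndModel m => S.comp (κ : (N → ℂ) →L[ℝ] ExtModel m)) :=
      contDiff_id.clm_comp contDiff_const
    exact h₂.contMDiff.comp_contMDiffOn h₁
  · have h₁ := (contDiff_modelDiag (m := m)).contMDiff.comp_contMDiffOn (hT'.prodMk_space hT)
    have h₂ : ContDiff ℝ ∞ (fun S : EndModel m =>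
        (κ.symm : ExtModel m →L[ℝ] (N → ℂ)).comp S) :=
      contDiff_const.clm_comp contDiff_id
    exact h₂.contMDiff.comp_contMDiffOn h₁
  · intro x hx
    rw [hφ x hx]
    refine ⟨fun z => (extEquiv p (hU hx)).apply_symm_apply _, fun X => ?_⟩
    change κ.symm ((A x hx).symm (extEquiv p (hU hx) ((extEquiv p (hU hx)).symm X))) = _
    rw [ContinuousLinearEquiv.apply_symm_apply]
    rfl

end Frames

section LocalTriviality

variable {m : ℕ} {M : Type*} [TopologicalSpace M] [ChartedSpace (RModel m) M]

/-- The endomorphism of `𝕋ₓM` corresponding to an endomorphism of `ℂᴺ` via a frame. -/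
def frameConj {N : Type*} [Fintype N] {x : M} (φ : (N → ℂ) ≃L[ℝ] ExtTangent m M x) (S : CEnd N) :
    ExtEnd m M x :=
  (φ : (N → ℂ) →L[ℝ] ExtTangent m M x).comp
    (S.comp (φ.symm : ExtTangent m M x →L[ℝ] (N → ℂ)))

theorem frameConj_injective {N : Type*} [Fintype N] {x : M} (φ : (N → ℂ) ≃L[ℝ] ExtTangent m M x) :
    Function.Injective (frameConj φ) := by
  intro S T h
  ext1 z
  have := congrArg (fun R : ExtEnd m M x => φ.symm (R (φ z))) h
  simpa [frameConj] using this

theorem conjBy_frameConj {N : Type*} [Fintype N] [DecidableEq N] {x : M}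
    (φ : (N → ℂ) ≃L[ℝ] ExtTangent m M x) (g : (Matrix N N ℂ)ˣ) (S : CEnd N) :
    conjBy φ g (frameConj φ S) = frameConj φ (conjEnd g S) := by
  refine ContinuousLinearMap.ext fun X => ?_
  change φ (matEnd (g : Matrix N N ℂ) (φ.symm (φ (S (φ.symm (φ (matEnd
    ((g⁻¹ : (Matrix N N ℂ)ˣ) : Matrix N N ℂ) (φ.symm X)))))))) = _
  rw [φ.symm_apply_apply, φ.symm_apply_apply]
  rfl

variable [IsManifold 𝓘(ℝ, RModel m) ∞ M]

set_option synthInstance.maxHeartbeats 400000 in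
set_option maxHeartbeats 1600000 in
/-- A map into the total space of `End (𝕋M)` is smooth iff its base point and its fibre coordinate
in the preferred trivialization at `p` are. -/
theorem contMDiffOn_totEnd_iff {EA HA A : Type*} [NormedAddCommGroup EA] [NormedSpace ℝ EA]
    [TopologicalSpace HA] {I : ModelWithCorners ℝ EA HA} [TopologicalSpace A] [ChartedSpace HA A]
    (p : M) {f : A → TotEnd m M} {s : Set A}
    (hf : ∀ x ∈ s, (f x).1 ∈ (chartAt (RModel m) p).source) :
    ContMDiffOn I ((𝓘(ℝ, RModel m)).prod 𝓘(ℝ, EndModel m)) ∞ f s ↔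
      ContMDiffOn I 𝓘(ℝ, RModel m) ∞ (fun x => (f x).1) s ∧
      ContMDiffOn I 𝓘(ℝ, EndModel m) ∞
        (fun x => (trivializationAt (EndModel m) (ExtEnd m M) p (f x)).2) s := by
  have hs : Set.MapsTo f s (trivializationAt (EndModel m) (ExtEnd m M) p).source := fun x hx =>
    ⟨⟨hf x hx, hf x hx, Set.mem_univ _⟩, ⟨hf x hx, hf x hx, Set.mem_univ _⟩⟩
  exact Bundle.Trivialization.contMDiffOn_iff (F := EndModel m) (E := ExtEnd m M)
    (IB := 𝓘(ℝ, RModel m)) (IM := I) (n := ∞) (e := trivializationAt (EndModel m) (ExtEnd m M) p)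
    (f := f) (s := s) hs

/-- A family of subsets of the fibres of `End (𝕋M)` that adapted frames identify with a fixed orbit
is a smooth fibre bundle. -/
theorem isSmoothFibreBundle_of_orbit {j : ∀ x : M, TSpace m M x →L[ℝ] TSpace m M x}
    (hj : IsSmoothTensorField j) (hsq : ∀ x (v : TSpace m M x), j x (j x v) = -v) {ell : ℤˣ}
    {N : Type*} [Fintype N] [DecidableEq N] {B : (N → ℂ) → (N → ℂ) → ℂ}
    {G : Subgroup (Matrix N N ℂ)ˣ} {K : Subgroup G} {b : LinearMap.BilinForm ℝ (N → ℂ)} {lam : ℤˣ}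
    {S₀ : CEnd N} (hK : IsIsotropyOf G K b lam S₀) {d : ℕ}
    (F : ∀ y, EmbeddedChart (orbitMap hK) d y) {σ : ∀ x : M, Set (ExtEnd m M x)}
    (hex : ∀ x : M, ∃ φ : (N → ℂ) ≃L[ℝ] ExtTangent m M x, IsAdapted j ell B φ)
    (hσ : ∀ (x : M) (φ : (N → ℂ) ≃L[ℝ] ExtTangent m M x), IsAdapted j ell B φ →
      ∀ S, S ∈ σ x ↔ ∃ y, frameConj φ (orbitMap hK y) = S) :
    letI := embeddedChartedSpace F (isEmbedding_orbitMap hK)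
    IsSmoothFibreBundle (totalOf σ) (d := d) (G ⧸ K) := by
  let _ := embeddedChartedSpace F (isEmbedding_orbitMap hK)
  intro p
  obtain ⟨φ₀, hφ₀⟩ := hex p
  obtain ⟨U, hU, φ, a, a', hUo, hpU, hφ, ha, ha', haa⟩ := exists_adapted_family hj hsq ell p hφ₀
  -- in the frames `φ x`, the trivialization is `(x, gK) ↦ g S₀ g⁻¹`; the values of `Ψ` outside of
  -- `totalOf σ` are irrelevant
  let Ψ : TotEnd m M → G ⧸ K := fun q =>
    Function.invFun (fun y => frameConj (φ q.1) (orbitMap hK y)) q.2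
  have hinj : ∀ x, Function.Injective fun y => frameConj (φ x) (orbitMap hK y) := fun x =>
    (frameConj_injective (φ x)).comp (orbitMap_injective hK)
  have hright : ∀ q ∈ totalOf σ, q.1 ∈ U → frameConj (φ q.1) (orbitMap hK (Ψ q)) = q.2 :=
    fun q hq hqU => Function.invFun_eq ((hσ q.1 (φ q.1) (hφ _ hqU) q.2).1 hq)
  have htriv : ∀ (q : TotEnd m M) (hq : q.1 ∈ U) (S : CEnd N), q.2 = frameConj (φ q.1) S →
      (trivializationAt (EndModel m) (ExtEnd m M) p q).2 = (a q.1).comp (S.comp (a' q.1)) := by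
    intro q hq S hS
    rw [trivializationAt_end_snd p (hU hq), hS]
    refine ContinuousLinearMap.ext fun X => ?_
    obtain ⟨h₁, h₂⟩ := haa q.1 hq
    change extEquiv p (hU hq) (φ q.1 (S ((φ q.1).symm ((extEquiv p (hU hq)).symm X)))) =
      a q.1 (S (a' q.1 X))
    rw [h₁, h₂]
  have haa' : ∀ x ∈ U, ∀ z, a' x (a x z) = z := by
    intro x hx z
    obtain ⟨h₁, h₂⟩ := haa x hx
    rw [← h₂, ← h₁, ContinuousLinearEquiv.symm_apply_apply, ContinuousLinearEquiv.symm_apply_apply]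
  refine ⟨U, hUo, hpU, fun xf => ⟨xf.1, frameConj (φ xf.1) (orbitMap hK xf.2)⟩, Ψ, ?_, ?_, ?_, ?_⟩
  · refine (contMDiffOn_totEnd_iff p ?_).2 ⟨contMDiffOn_fst, ?_⟩
    · exact fun xf hxf => hU hxf.1
    · have hfst : ContMDiffOn (𝓘(ℝ, RModel m).prod 𝓘(ℝ, EuclideanSpace ℝ (Fin d)))
          𝓘(ℝ, RModel m) ∞ (Prod.fst : M × (G ⧸ K) → M) (U ×ˢ Set.univ) := contMDiffOn_fst
      have h₁ := ha.comp hfst fun xf hxf => hxf.1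
      have h₂ := ha'.comp hfst fun xf hxf => hxf.1
      have h₃ : ContMDiffOn (𝓘(ℝ, RModel m).prod 𝓘(ℝ, EuclideanSpace ℝ (Fin d)))
          𝓘(ℝ, CEnd N) ∞ (fun xf : M × (G ⧸ K) => orbitMap hK xf.2) (U ×ˢ Set.univ) :=
        (contMDiff_embedded F (isEmbedding_orbitMap hK)).comp_contMDiffOn contMDiffOn_snd
      refine (h₁.clm_comp (h₃.clm_comp h₂)).congr fun xf hxf => ?_
      exact htriv _ hxf.1 _ rfl
  · refine contMDiffOn_of_embedded F (isEmbedding_orbitMap hK) ?_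
    have hid : ContMDiffOn (𝓘(ℝ, RModel m).prod 𝓘(ℝ, EndModel m))
        (𝓘(ℝ, RModel m).prod 𝓘(ℝ, EndModel m)) ∞ (fun q : TotEnd m M => q)
        {q | q ∈ totalOf σ ∧ q.1 ∈ U} := contMDiffOn_id
    obtain ⟨h₀, h₁⟩ := (contMDiffOn_totEnd_iff p fun q hq => hU hq.2).1 hid
    have h₂ := ha.comp h₀ fun q hq => hq.2
    have h₃ := ha'.comp h₀ fun q hq => hq.2
    refine (h₃.clm_comp (h₁.clm_comp h₂)).congr fun q hq => ?_
    rw [htriv q hq.2 _ (hright q hq.1 hq.2).symm]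
    ext1 z
    change _ = a' q.1 (a q.1 (orbitMap hK (Ψ q) (a' q.1 (a q.1 z))))
    rw [haa' _ hq.2, haa' _ hq.2]
    rfl
  · intro x hx f
    exact ⟨rfl, (hσ x (φ x) (hφ x hx) _).2 ⟨f, rfl⟩, Function.leftInverse_invFun (hinj x) f⟩
  · intro q hq hqU
    have := hright q hq hqU
    rcases q with ⟨x, S⟩
    exact congrArg (TotalSpace.mk x) this

end LocalTriviality

/-! ### Standard forms on `ℂᴺ` and block decompositions -/

section StdForm

variable {N : Type*} [Fintype N] {κ : ℂ →+* ℂ} {ε : N → ℂ}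

/-- The form `(z, w) ↦ ∑ κ(zᵢ) εᵢ wᵢ`, bilinear if `κ = id` and sesquilinear if `κ` is the complex
conjugation. -/
def stdForm (κ : ℂ →+* ℂ) (ε : N → ℂ) (z w : N → ℂ) : ℂ := ∑ i, κ (z i) * (ε i * w i)

theorem stdForm_add_left (x y z : N → ℂ) :
    stdForm κ ε (x + y) z = stdForm κ ε x z + stdForm κ ε y z := by
  simp [stdForm, add_mul, Finset.sum_add_distrib]

theorem stdForm_add_right (x y z : N → ℂ) :
    stdForm κ ε x (y + z) = stdForm κ ε x y + stdForm κ ε x z := by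
  simp [stdForm, mul_add, Finset.sum_add_distrib]

theorem stdForm_smul_left (c : ℂ) (x y : N → ℂ) :
    stdForm κ ε (c • x) y = κ c * stdForm κ ε x y := by
  simp [stdForm, Finset.mul_sum, mul_assoc]

theorem stdForm_smul_right (c : ℂ) (x y : N → ℂ) :
    stdForm κ ε x (c • y) = c * stdForm κ ε x y := by
  simp only [stdForm, Finset.mul_sum, Pi.smul_apply, smul_eq_mul]
  exact Finset.sum_congr rfl fun i _ => by ring

theorem stdForm_sum_right {I : Type*} (s : Finset I) (x : N → ℂ) (f : I → N → ℂ) :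
    stdForm κ ε x (∑ i ∈ s, f i) = ∑ i ∈ s, stdForm κ ε x (f i) := by
  classical
  induction s using Finset.induction_on with
  | empty => simp [stdForm]
  | insert a s ha ih => rw [Finset.sum_insert ha, Finset.sum_insert ha, stdForm_add_right, ih]

theorem stdForm_sum_left {I : Type*} (s : Finset I) (x : N → ℂ) (f : I → N → ℂ) :
    stdForm κ ε (∑ i ∈ s, f i) x = ∑ i ∈ s, stdForm κ ε (f i) x := by
  classical
  induction s using Finset.induction_on with
  | empty => simp [stdForm]
  | insert a s ha ih => rw [Finset.sum_insert ha, Finset.sum_insert ha, stdForm_add_left, ih]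

/-- The data of a standard symmetric or Hermitian form: `κ` is an involution of `ℂ` over `ℝ` (the
identity or the conjugation) and the coefficients of the form are signs. -/
structure IsStdData (κ : ℂ →+* ℂ) (ε : N → ℂ) : Prop where
  invol : ∀ c, κ (κ c) = c
  ofReal : ∀ r : ℝ, κ r = r
  sign : ∀ i, ε i = 1 ∨ ε i = -1

namespace IsStdData

variable (hd : IsStdData κ ε)
include hd

omit [Fintype N] in
theorem conj_comm (c : ℂ) : κ (starRingEnd ℂ c) = starRingEnd ℂ (κ c) := by
  have hI : κ Complex.I = Complex.I ∨ κ Complex.I = -Complex.I := by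
    have h : κ Complex.I * κ Complex.I = Complex.I * Complex.I := by
      rw [← map_mul, Complex.I_mul_I, map_neg, map_one]
    exact mul_self_eq_mul_self_iff.1 h
  obtain ⟨a, b⟩ := c
  have e : ∀ a b : ℝ, κ ⟨a, b⟩ = a + b * κ Complex.I := by
    intro a b
    rw [show (⟨a, b⟩ : ℂ) = a + b * Complex.I from Complex.mk_eq_add_mul_I a b, map_add, map_mul,
      hd.ofReal, hd.ofReal]
  have e' : starRingEnd ℂ ⟨a, b⟩ = ⟨a, -b⟩ := rfl
  rw [e', e a (-b), e a b]
  rcases hI with h | h <;> rw [h] <;> simp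

omit [Fintype N] in
theorem sign_sq (i : N) : ε i * ε i = 1 := by
  rcases hd.sign i with h | h <;> rw [h] <;> ring

omit [Fintype N] in
theorem sign_ne (i : N) : ε i ≠ 0 := by
  rcases hd.sign i with h | h <;> rw [h] <;> norm_num

omit [Fintype N] in
theorem map_sign (i : N) : κ (ε i) = ε i := by
  rcases hd.sign i with h | h <;> rw [h] <;> simp

omit [Fintype N] in
theorem conj_sign (i : N) : starRingEnd ℂ (ε i) = ε i := by
  rcases hd.sign i with h | h <;> rw [h] <;> simp

theorem symm (x y : N → ℂ) : stdForm κ ε y x = κ (stdForm κ ε x y) := by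
  simp only [stdForm, map_sum, map_mul, hd.invol, hd.map_sign]
  exact Finset.sum_congr rfl fun i _ => by ring

theorem nondegenerate {x : N → ℂ} (h : ∀ y, stdForm κ ε x y = 0) : x = 0 := by
  classical
  ext i
  have := h (Pi.single i 1)
  simp only [stdForm, Pi.single_apply, mul_ite, mul_one, mul_zero, Finset.sum_ite_eq',
    Finset.mem_univ, if_true] at this
  rcases mul_eq_zero.1 this with h | h
  · rw [← hd.invol (x i), h, map_zero]
    rfl
  · exact absurd h (hd.sign_ne i)

end IsStdData

/-- The real part of the standard form, as a real bilinear form. -/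
def stdRe (κ : ℂ →+* ℂ) (ε : N → ℂ) (hd : IsStdData κ ε) : LinearMap.BilinForm ℝ (N → ℂ) :=
  LinearMap.mk₂ ℝ (fun z w => (stdForm κ ε z w).re)
    (fun x y z => by rw [stdForm_add_left, Complex.add_re])
    (fun c x y => by
      rw [show c • x = (c : ℂ) • x from (Complex.coe_smul c x).symm, stdForm_smul_left, hd.ofReal,
        Complex.re_ofReal_mul, smul_eq_mul])
    (fun x y z => by rw [stdForm_add_right, Complex.add_re])
    (fun c x y => by
      rw [show c • y = (c : ℂ) • y from (Complex.coe_smul c y).symm, stdForm_smul_right,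
        Complex.re_ofReal_mul, smul_eq_mul])

theorem stdRe_apply (hd : IsStdData κ ε) (z w : N → ℂ) :
    stdRe κ ε hd z w = (stdForm κ ε z w).re := rfl

theorem stdForm_eq_stdRe (hd : IsStdData κ ε) (z w : N → ℂ) :
    stdForm κ ε z w = stdRe κ ε hd z w - Complex.I * stdRe κ ε hd z (Complex.I • w) := by
  rw [stdRe_apply, stdRe_apply, stdForm_smul_right]
  apply Complex.ext <;> simp

/-- Coefficientwise complex conjugation. -/
def starEnd (N : Type*) [Fintype N] : CEnd N :=
  LinearMap.toContinuousLinearMap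
    { toFun := star
      map_add' := star_add
      map_smul' := fun c x => by ext; simp }

section Skew

variable {hd : IsStdData κ ε} {lam : ℤˣ} {T : CEnd N}

/-- Skew roots are antilinear. -/
theorem skewRoots_smul (hT : T ∈ skewRoots (stdRe κ ε hd) (mulI N) lam) (c : ℂ) (x : N → ℂ) :
    T (c • x) = starRingEnd ℂ c • T x := by
  have hI : ∀ v : N → ℂ, T (Complex.I • v) = -(Complex.I • T v) := hT.2.2
  have e : ∀ (c : ℂ) (w : N → ℂ), c • w = c.re • w + c.im • (Complex.I • w) := by
    intro c w
    ext i
    simp only [Pi.smul_apply, Pi.add_apply, smul_eq_mul, Complex.real_smul]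
    conv_lhs => rw [← Complex.re_add_im c]
    ring
  rw [e c x, e (starRingEnd ℂ c) (T x), map_add, map_smul, map_smul, hI, Complex.conj_re,
    Complex.conj_im, smul_neg, neg_smul]

/-- A skew root multiplies the form by `-lam`, up to complex conjugation. -/
theorem stdForm_skewRoots (hT : T ∈ skewRoots (stdRe κ ε hd) (mulI N) lam) (x y : N → ℂ) :
    stdForm κ ε (T x) (T y) = -((lam : ℤ) : ℂ) * starRingEnd ℂ (stdForm κ ε x y) := by
  have h₁ : ∀ x y, stdRe κ ε hd (T x) (T y) = -((lam : ℤ) : ℝ) * stdRe κ ε hd x y := by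
    intro x y
    rw [hT.2.1, hT.1, map_zsmul, zsmul_eq_mul, neg_mul]
  have h₂ : Complex.I • T y = T (-(Complex.I • y)) := by
    rw [map_neg, skewRoots_smul hT, Complex.conj_I, neg_smul, neg_neg]
  rw [stdForm_eq_stdRe hd, stdForm_eq_stdRe hd, h₁, h₂, h₁]
  simp
  ring

end Skew

/-- Splitting off orthogonal blocks. A block is a family `u` of mutually orthogonal, non-isotropic
vectors with the property `P`, whose orthogonal complement is `T`-stable. If every nonzero
`T`-stable nondegenerate subspace contains a block, then mutually orthogonal blocks span the whole
space. -/
theorem exists_block_decomposition (hd : IsStdData κ ε) {α : Type} [Fintype α] [Nonempty α]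
    (T : CEnd N) (P : (α → N → ℂ) → Prop)
    (horth : ∀ u, P u → ∀ a b, a ≠ b → stdForm κ ε (u a) (u b) = 0)
    (hne : ∀ u, P u → ∀ a, stdForm κ ε (u a) (u a) ≠ 0)
    (hstab : ∀ u, P u → ∀ x, (∀ a, stdForm κ ε (u a) x = 0) → ∀ a, stdForm κ ε (u a) (T x) = 0)
    (hex : ∀ W : Submodule ℂ (N → ℂ), (∀ x ∈ W, T x ∈ W) →
      (∀ x ∈ W, (∀ y ∈ W, stdForm κ ε x y = 0) → x = 0) → W ≠ ⊥ → ∃ u, P u ∧ ∀ a, u a ∈ W) :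
    ∃ (ι : Type) (_ : Fintype ι) (e : ι → α → N → ℂ), (∀ i, P (e i)) ∧
      (∀ i k, i ≠ k → ∀ a b, stdForm κ ε (e i a) (e k b) = 0) ∧
      ⊤ ≤ Submodule.span ℂ (Set.range fun p : ι × α => e p.1 p.2) := by
  classical
  suffices H : ∀ (d : ℕ) (W : Submodule ℂ (N → ℂ)), Module.finrank ℂ W = d →
      (∀ x ∈ W, T x ∈ W) → (∀ x ∈ W, (∀ y ∈ W, stdForm κ ε x y = 0) → x = 0) →
      ∃ (ι : Type) (_ : Fintype ι) (e : ι → α → N → ℂ), (∀ i, P (e i)) ∧ (∀ i a, e i a ∈ W) ∧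
      (∀ i k, i ≠ k → ∀ a b, stdForm κ ε (e i a) (e k b) = 0) ∧
      W ≤ Submodule.span ℂ (Set.range fun p : ι × α => e p.1 p.2) by
    obtain ⟨ι, hι, e, h₁, -, h₂, h₃⟩ := H _ ⊤ rfl (fun _ _ => Submodule.mem_top)
      fun x _ hx => hd.nondegenerate fun y => hx y Submodule.mem_top
    exact ⟨ι, hι, e, h₁, h₂, h₃⟩
  intro d
  induction d using Nat.strong_induction_on with
  | _ d ih =>
    intro W hWd hWT hWn
    by_cases hW : W = ⊥
    · exact ⟨Empty, inferInstance, fun i => i.elim, fun i => i.elim, fun i => i.elim,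
        fun i => i.elim, by rw [hW]; exact bot_le⟩
    obtain ⟨u, hu, huW⟩ := hex W hWT hWn hW
    let W' : Submodule ℂ (N → ℂ) :=
      { carrier := {x | x ∈ W ∧ ∀ a, stdForm κ ε (u a) x = 0}
        zero_mem' := ⟨W.zero_mem, fun a => by simp [stdForm]⟩
        add_mem' := fun {x y} hx hy => ⟨W.add_mem hx.1 hy.1, fun a => by
          rw [stdForm_add_right, hx.2, hy.2, add_zero]⟩
        smul_mem' := fun c x hx => ⟨W.smul_mem c hx.1, fun a => by
          rw [stdForm_smul_right, hx.2, mul_zero]⟩ }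
    have hW' : W' ≤ W := fun x hx => hx.1
    -- the orthogonal projection to the span of the block
    let pr : (N → ℂ) → (N → ℂ) := fun x =>
      ∑ a, ((stdForm κ ε (u a) (u a))⁻¹ * stdForm κ ε (u a) x) • u a
    have hpr : ∀ x ∈ W, x - pr x ∈ W' := by
      intro x hx
      refine ⟨W.sub_mem hx (W.sum_mem fun a _ => W.smul_mem _ (huW a)), fun a => ?_⟩
      rw [sub_eq_add_neg, stdForm_add_right, ← neg_one_smul ℂ, stdForm_smul_right,
        stdForm_sum_right, Finset.sum_eq_single a]
      · rw [stdForm_smul_right]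
        field_simp [hne u hu a]
        ring
      · intro b _ hb
        rw [stdForm_smul_right, horth u hu a b hb.symm, mul_zero]
      · simp
    have hlt : Module.finrank ℂ W' < Module.finrank ℂ W := by
      refine Submodule.finrank_lt_finrank_of_lt (lt_of_le_of_ne hW' fun h => ?_)
      obtain ⟨a⟩ := ‹Nonempty α›
      have : u a ∈ W' := h ▸ huW a
      exact hne u hu a (this.2 a)
    obtain ⟨ι, hι, e, h₁, h₂, h₃, h₄⟩ := ih _ (hWd ▸ hlt) W' rfl
      (fun x hx => ⟨hWT x hx.1, hstab u hu x hx.2⟩) (by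
        intro x hx hx'
        refine hWn x hx.1 fun y hy => ?_
        have e₁ := hx' _ (hpr y hy)
        have e₂ : stdForm κ ε x (pr y) = 0 := by
          rw [stdForm_sum_right]
          refine Finset.sum_eq_zero fun a _ => ?_
          rw [stdForm_smul_right, hd.symm (u a) x, hx.2, map_zero, mul_zero]
        calc stdForm κ ε x y = stdForm κ ε x (y - pr y) + stdForm κ ε x (pr y) := by
              rw [← stdForm_add_right, sub_add_cancel]
          _ = 0 := by rw [e₁, e₂, add_zero])
    refine ⟨Option ι, inferInstance, fun o => o.elim u e, ?_, ?_, ?_, ?_⟩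
    · rintro (_ | i)
      exacts [hu, h₁ i]
    · rintro (_ | i) a
      exacts [huW a, (h₂ i a).1]
    · rintro (_ | i) (_ | k) hik a b
      · exact absurd rfl hik
      · exact (h₂ k b).2 a
      · change stdForm κ ε (e i a) (u b) = 0
        rw [hd.symm, (h₂ i a).2 b, map_zero]
      · exact h₃ i k (fun h => hik (congrArg some h)) a b
    · intro x hx
      rw [← sub_add_cancel x (pr x)]
      refine Submodule.add_mem _ ?_ (Submodule.sum_mem _ fun a _ => Submodule.smul_mem _ _
        (Submodule.subset_span ⟨(none, a), rfl⟩))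
      refine (Submodule.span_mono ?_) (h₄ (hpr x hx))
      rintro _ ⟨⟨i, a⟩, rfl⟩
      exact ⟨(some i, a), rfl⟩

/-- An orthogonal spanning family without isotropic vectors is a basis. -/
theorem card_eq_of_orthogonal {I : Type*} [Fintype I] {f : I → N → ℂ}
    (horth : ∀ i k, i ≠ k → stdForm κ ε (f i) (f k) = 0) (hne : ∀ i, stdForm κ ε (f i) (f i) ≠ 0)
    (hspan : ⊤ ≤ Submodule.span ℂ (Set.range f)) : Fintype.card I = Fintype.card N := by
  classical
  have hli : LinearIndependent ℂ f := by
    rw [Fintype.linearIndependent_iff]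
    intro g hg i
    have h := congrArg (stdForm κ ε (f i)) hg
    rw [stdForm_sum_right, Finset.sum_eq_single i, stdForm_smul_right] at h
    · have h0 : stdForm κ ε (f i) 0 = 0 := by simp [stdForm]
      rw [h0] at h
      exact (mul_eq_zero.1 h).resolve_right (hne i)
    · intro k _ hk
      rw [stdForm_smul_right, horth i k hk.symm, mul_zero]
    · simp
  have := Module.finrank_eq_card_basis (Module.Basis.mk hli hspan)
  rw [← this, Module.finrank_fintype_fun_eq_card]

end StdForm

/-! ### Normal forms of antilinear square roots -/

section NormalForm

variable {N : Type*} [Fintype N] {κ : ℂ →+* ℂ} {ε : N → ℂ}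

/-- If `h (x, y) = 1`, then `x`, `y` and `x + y` are not all isotropic; here the symmetry `h (y, x)
= κ (h (x, y))` is used. -/
theorem exists_nonisotropic (hd : IsStdData κ ε) {W : Submodule ℂ (N → ℂ)}
    (hn : ∀ x ∈ W, (∀ y ∈ W, stdForm κ ε x y = 0) → x = 0) (hW : W ≠ ⊥) :
    ∃ z ∈ W, stdForm κ ε z z ≠ 0 := by
  obtain ⟨x, hx, hx0⟩ := (Submodule.ne_bot_iff W).1 hW
  by_contra! H
  refine hx0 (hn x hx fun y hy => ?_)
  by_contra hxy
  have h₁ : stdForm κ ε x ((stdForm κ ε x y)⁻¹ • y) = 1 := by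
    rw [stdForm_smul_right, inv_mul_cancel₀ hxy]
  have hy' := W.smul_mem (stdForm κ ε x y)⁻¹ hy
  have h₂ := H _ (W.add_mem hx hy')
  rw [stdForm_add_left, stdForm_add_right, stdForm_add_right, H x hx, H _ hy', h₁,
    hd.symm x, h₁, map_one] at h₂
  norm_num at h₂

variable {hd : IsStdData κ ε} {lam : ℤˣ} {T : CEnd N}

theorem skewRoots_apply_apply (hT : T ∈ skewRoots (stdRe κ ε hd) (mulI N) lam) (x : N → ℂ) :
    T (T x) = ((lam : ℤ) : ℂ) • x := by
  rw [hT.1, Int.cast_smul_eq_zsmul]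

theorem intUnit_cast_mul_self (lam : ℤˣ) : ((lam : ℤ) : ℂ) * ((lam : ℤ) : ℂ) = 1 := by
  rcases Int.units_eq_one_or lam with rfl | rfl <;> simp

/-- An antilinear involution `T` with `h (T x, T y) = -conj h (x, y)`, for a symmetric form `h`, is
diagonal with entries `±i` in some orthonormal basis. -/
theorem exists_diagonal_frame {hd : IsStdData (RingHom.id ℂ) ε}
    (hT : T ∈ skewRoots (stdRe (RingHom.id ℂ) ε hd) (mulI N) 1) :
    ∃ (f : N → N → ℂ) (w : N → ℂ), (∀ i, w i * w i = -1) ∧ (∀ i, T (f i) = w i • f i) ∧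
      (∀ i, stdForm (RingHom.id ℂ) ε (f i) (f i) = 1) ∧
      ∀ i k, i ≠ k → stdForm (RingHom.id ℂ) ε (f i) (f k) = 0 := by
  have hTT : ∀ x y, stdForm (RingHom.id ℂ) ε (T x) (T y) =
      -starRingEnd ℂ (stdForm (RingHom.id ℂ) ε x y) := fun x y => by
    rw [stdForm_skewRoots hT]; simp
  have hsq : ∀ x, T (T x) = x := fun x => by rw [skewRoots_apply_apply hT]; simp
  obtain ⟨ι, hι, e, h₁, h₂, h₃⟩ := exists_block_decomposition hd (α := Unit) T
    (fun u => stdForm (RingHom.id ℂ) ε (u ()) (u ()) = 1 ∧ ∃ w : ℂ, w * w = -1 ∧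
      T (u ()) = w • u ()) (fun u _ a b h => absurd rfl h) (fun u hu a => by rw [hu.1]; simp)
    (by
      rintro u ⟨-, w, hw, hu⟩ x hx a
      have h := hTT (u ()) x
      rw [hx, map_zero, neg_zero, hu, stdForm_smul_left] at h
      refine (mul_eq_zero.1 h).resolve_left fun h0 => ?_
      rw [RingHom.id_apply] at h0
      simp [h0] at hw)
    (by
      intro W hWT hWn hW
      obtain ⟨z, hz, hzz⟩ := exists_nonisotropic hd hWn hW
      -- a non-isotropic vector fixed by `T`: one of `a`, `b`, `a + b`, where `z = a + i b`
      obtain ⟨v, hv, hTv, hvv⟩ : ∃ v ∈ W, T v = v ∧ stdForm (RingHom.id ℂ) ε v v ≠ 0 := by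
        let a : N → ℂ := (1 / 2 : ℂ) • (z + T z)
        let b : N → ℂ := (-Complex.I / 2 : ℂ) • (z + (-1 : ℂ) • T z)
        have ha : a ∈ W := W.smul_mem _ (W.add_mem hz (hWT z hz))
        have hb : b ∈ W := W.smul_mem _ (W.add_mem hz (W.smul_mem _ (hWT z hz)))
        have hTa : T a = a := by
          simp only [a]
          rw [skewRoots_smul hT, map_add, hsq, add_comm, map_div₀, map_one, map_ofNat]
        have hTb : T b = b := by
          simp only [b]
          rw [skewRoots_smul hT, map_add, skewRoots_smul hT, hsq]
          rw [map_div₀, map_neg, map_ofNat, Complex.conj_I, map_neg, map_one]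
          ext i
          simp only [Pi.add_apply, Pi.smul_apply, smul_eq_mul]
          ring
        have hzab : z = a + Complex.I • b := by
          ext i
          simp only [a, b, Pi.add_apply, Pi.smul_apply, smul_eq_mul]
          linear_combination ((z i - T z i) / 2) * Complex.I_mul_I
        clear_value a b
        by_contra! H
        refine hzz ?_
        have hab : stdForm (RingHom.id ℂ) ε a b = 0 := by
          have h := H _ (W.add_mem ha hb) (by rw [map_add, hTa, hTb])
          rw [stdForm_add_left, stdForm_add_right, stdForm_add_right, H a ha hTa, H b hb hTb,
            hd.symm a b, RingHom.id_apply] at h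
          linear_combination h / 2
        rw [hzab, stdForm_add_left, stdForm_add_right, stdForm_add_right, stdForm_smul_left,
          stdForm_smul_left, stdForm_smul_right, stdForm_smul_right, H a ha hTa, H b hb hTb,
          hd.symm a b, hab]
        simp
      -- for `p² = h (v, v)`, an imaginary number, `p⁻¹ v` is a unit vector, multiplied by
      -- `p / conj p` under `T`
      obtain ⟨p, hp⟩ := IsAlgClosed.exists_eq_mul_self (stdForm (RingHom.id ℂ) ε v v)
      have hp0 : p ≠ 0 := fun h => hvv (by rw [hp, h, mul_zero])
      have hp0' : starRingEnd ℂ p ≠ 0 := (map_ne_zero _).2 hp0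
      have hpp : p * p = -(starRingEnd ℂ p * starRingEnd ℂ p) := by
        have h := hTT v v
        rw [hTv, hp, map_mul] at h
        exact h
      refine ⟨fun _ => p⁻¹ • v, ⟨?_, starRingEnd ℂ p⁻¹ * p, ?_, ?_⟩, fun _ => W.smul_mem _ hv⟩
      · rw [stdForm_smul_left, stdForm_smul_right, hp, RingHom.id_apply]
        field_simp
      · rw [map_inv₀]
        field_simp
        linear_combination hpp
      · rw [skewRoots_smul hT, hTv, smul_smul, mul_assoc, mul_inv_cancel₀ hp0, mul_one])
  choose w hw using fun i => (h₁ i).2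
  have hcard : Fintype.card ι = Fintype.card N := by
    have := card_eq_of_orthogonal (I := ι × Unit) (κ := RingHom.id ℂ) (ε := ε)
      (f := fun p => e p.1 p.2)
      (fun i k h => h₂ _ _ (fun h' => h (Prod.ext h' rfl)) _ _)
      (fun i => by rw [(h₁ i.1).1]; simp) h₃
    simpa using this
  let σ : N ≃ ι := Fintype.equivOfCardEq hcard.symm
  exact ⟨fun i => e (σ i) (), fun i => w (σ i), fun i => (hw _).1, fun i => (hw _).2,
    fun i => (h₁ _).1, fun i k h => h₂ _ _ (fun h' => h (σ.injective h')) _ _⟩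

/-- If every nonzero stable nondegenerate subspace contains a vector `v` orthogonal to `T v` whose
square satisfies `Q`, then the whole space has an orthogonal basis made of such pairs `v`, `T v`. -/
theorem exists_pair_frame (hT : T ∈ skewRoots (stdRe κ ε hd) (mulI N) lam) (Q : ℂ → Prop)
    (hQ : ∀ c, Q c → c ≠ 0)
    (hex : ∀ W : Submodule ℂ (N → ℂ), (∀ x ∈ W, T x ∈ W) →
      (∀ x ∈ W, (∀ y ∈ W, stdForm κ ε x y = 0) → x = 0) → W ≠ ⊥ →
      ∃ v ∈ W, stdForm κ ε v (T v) = 0 ∧ Q (stdForm κ ε v v)) :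
    ∃ (ι : Type) (_ : Fintype ι) (e : ι → N → ℂ), (∀ i, Q (stdForm κ ε (e i) (e i))) ∧
      (∀ i k, stdForm κ ε (e i) (T (e k)) = 0) ∧
      (∀ i k, i ≠ k → stdForm κ ε (e i) (e k) = 0) ∧ 2 * Fintype.card ι = Fintype.card N := by
  obtain ⟨ι, hι, e, h₁, h₂, h₃⟩ := exists_block_decomposition hd (α := Bool) T
    (fun u => u true = T (u false) ∧ stdForm κ ε (u false) (u true) = 0 ∧
      Q (stdForm κ ε (u false) (u false)))
    (by
      rintro u ⟨-, hu, -⟩ (_ | _) (_ | _) h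
      · exact absurd rfl h
      · exact hu
      · rw [hd.symm, hu, map_zero]
      · exact absurd rfl h)
    (by
      rintro u ⟨hu, -, hQu⟩ (_ | _)
      · exact hQ _ hQu
      · rw [hu, stdForm_skewRoots hT]
        refine mul_ne_zero (neg_ne_zero.2 ?_) ((map_ne_zero _).2 (hQ _ hQu))
        exact left_ne_zero_of_mul_eq_one (intUnit_cast_mul_self lam))
    (by
      rintro u ⟨hu, -, -⟩ x hx (_ | _)
      · have h := stdForm_skewRoots hT (u true) x
        rw [hx, map_zero, mul_zero, hu, skewRoots_apply_apply hT, stdForm_smul_left] at h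
        refine (mul_eq_zero.1 h).resolve_left ((map_ne_zero _).2 ?_)
        exact left_ne_zero_of_mul_eq_one (intUnit_cast_mul_self lam)
      · rw [hu, stdForm_skewRoots hT, hx, map_zero, mul_zero])
    (by
      intro W hWT hWn hW
      obtain ⟨v, hv, h₁, h₂⟩ := hex W hWT hWn hW
      refine ⟨fun b => if b then T v else v, ⟨rfl, h₁, h₂⟩, ?_⟩
      rintro (_ | _)
      exacts [hv, hWT v hv])
  refine ⟨ι, hι, fun i => e i false, fun i => (h₁ i).2.2, fun i k => ?_,
    fun i k h => h₂ i k h _ _, ?_⟩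
  · rw [← (h₁ k).1]
    by_cases h : i = k
    · rw [h, (h₁ k).2.1]
    · exact h₂ i k h _ _
  · have := card_eq_of_orthogonal (I := ι × Bool) (κ := κ) (ε := ε) (f := fun p => e p.1 p.2)
      (by
        rintro ⟨i, a⟩ ⟨k, b⟩ h
        by_cases hik : i = k
        · subst hik
          rcases a with _ | _ <;> rcases b with _ | _
          · exact absurd rfl h
          · exact (h₁ i).2.1
          · change stdForm κ ε (e i true) (e i false) = 0
            rw [hd.symm (e i false), (h₁ i).2.1, map_zero]
          · exact absurd rfl h
        · exact h₂ i k hik a b)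
      (by
        rintro ⟨i, _ | _⟩
        · exact hQ _ (h₁ i).2.2
        · change stdForm κ ε (e i true) (e i true) ≠ 0
          rw [(h₁ i).1, stdForm_skewRoots hT]
          refine mul_ne_zero (neg_ne_zero.2 ?_) ((map_ne_zero _).2 (hQ _ (h₁ i).2.2))
          exact left_ne_zero_of_mul_eq_one (intUnit_cast_mul_self lam)) h₃
    rw [Fintype.card_prod, Fintype.card_bool] at this
    omega

/-- For a Hermitian form, `v` and `T v` are always orthogonal. -/
theorem stdForm_self_skewRoots {hd : IsStdData (starRingEnd ℂ) ε}
    (hT : T ∈ skewRoots (stdRe (starRingEnd ℂ) ε hd) (mulI N) lam) (v : N → ℂ) :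
    stdForm (starRingEnd ℂ) ε v (T v) = 0 := by
  have h := stdForm_skewRoots hT v (T v)
  rw [skewRoots_apply_apply hT, stdForm_smul_right, hd.symm v (T v)] at h
  have h0 := left_ne_zero_of_mul_eq_one (intUnit_cast_mul_self lam)
  have h' : ((lam : ℤ) : ℂ) * (2 * starRingEnd ℂ (stdForm (starRingEnd ℂ) ε v (T v))) = 0 := by
    linear_combination h
  have h'' := (mul_eq_zero.1 h').resolve_left h0
  simpa using h''

/-- The square of a vector is real in a Hermitian space, so it can be normalized only up to its
sign. -/
theorem exists_unit_hermitian (hd : IsStdData (starRingEnd ℂ) ε) {W : Submodule ℂ (N → ℂ)}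
    (hn : ∀ x ∈ W, (∀ y ∈ W, stdForm (starRingEnd ℂ) ε x y = 0) → x = 0) (hW : W ≠ ⊥) :
    ∃ z ∈ W, stdForm (starRingEnd ℂ) ε z z = 1 ∨ stdForm (starRingEnd ℂ) ε z z = -1 := by
  obtain ⟨z, hz, hzz⟩ := exists_nonisotropic hd hn hW
  obtain ⟨r, hr⟩ := Complex.conj_eq_iff_real.1 (hd.symm z z).symm
  have hr0 : r ≠ 0 := fun h => hzz (by rw [hr, h, Complex.ofReal_zero])
  have hs : ((√|r|)⁻¹ : ℝ) * (√|r|)⁻¹ = |r|⁻¹ := by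
    rw [← mul_inv, Real.mul_self_sqrt (abs_nonneg r)]
  refine ⟨(((√|r|)⁻¹ : ℝ) : ℂ) • z, W.smul_mem _ hz, ?_⟩
  rw [stdForm_smul_left, stdForm_smul_right, hr, hd.ofReal, ← mul_assoc, ← Complex.ofReal_mul,
    ← Complex.ofReal_mul, hs]
  rcases lt_or_gt_of_ne hr0 with h | h
  · right
    rw [abs_of_neg h]
    rw [inv_neg, neg_mul, inv_mul_cancel₀ hr0, Complex.ofReal_neg, Complex.ofReal_one]
  · left
    rw [abs_of_pos h, inv_mul_cancel₀ hr0, Complex.ofReal_one]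

/-- The pairs for `(1, -1)`: as `v` and `T v` have opposite squares, one of them is positive. -/
theorem exists_pair_frame_hermitian_one {hd : IsStdData (starRingEnd ℂ) ε}
    (hT : T ∈ skewRoots (stdRe (starRingEnd ℂ) ε hd) (mulI N) 1) :
    ∃ (ι : Type) (_ : Fintype ι) (e : ι → N → ℂ), (∀ i, stdForm (starRingEnd ℂ) ε (e i) (e i) = 1) ∧
      (∀ i k, stdForm (starRingEnd ℂ) ε (e i) (T (e k)) = 0) ∧
      (∀ i k, i ≠ k → stdForm (starRingEnd ℂ) ε (e i) (e k) = 0) ∧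
      2 * Fintype.card ι = Fintype.card N := by
  refine exists_pair_frame hT (fun c => c = 1) (by rintro c rfl; simp) fun W hWT hWn hW => ?_
  obtain ⟨v, hv, h | h⟩ := exists_unit_hermitian hd hWn hW
  · exact ⟨v, hv, stdForm_self_skewRoots hT v, h⟩
  · refine ⟨T v, hWT v hv, stdForm_self_skewRoots hT _, ?_⟩
    rw [stdForm_skewRoots hT, h]
    simp

/-- The pairs for `(-1, -1)`, where `v` and `T v` have the same sign. -/
theorem exists_pair_frame_hermitian_neg {hd : IsStdData (starRingEnd ℂ) ε}
    (hT : T ∈ skewRoots (stdRe (starRingEnd ℂ) ε hd) (mulI N) (-1)) :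
    ∃ (ι : Type) (_ : Fintype ι) (e : ι → N → ℂ),
      (∀ i, stdForm (starRingEnd ℂ) ε (e i) (e i) = 1 ∨
        stdForm (starRingEnd ℂ) ε (e i) (e i) = -1) ∧
      (∀ i k, stdForm (starRingEnd ℂ) ε (e i) (T (e k)) = 0) ∧
      (∀ i k, i ≠ k → stdForm (starRingEnd ℂ) ε (e i) (e k) = 0) ∧
      2 * Fintype.card ι = Fintype.card N := by
  refine exists_pair_frame hT (fun c => c = 1 ∨ c = -1) (by rintro c (rfl | rfl) <;> simp)
    fun W hWT hWn hW => ?_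
  obtain ⟨v, hv, h⟩ := exists_unit_hermitian hd hWn hW
  exact ⟨v, hv, stdForm_self_skewRoots hT v, h⟩

/-- The pairs for `(-1, 1)`: for a unit vector `x`, the vector `x + T x` is orthogonal to its image.
-/
theorem exists_pair_frame_symmetric_neg {hd : IsStdData (RingHom.id ℂ) ε}
    (hT : T ∈ skewRoots (stdRe (RingHom.id ℂ) ε hd) (mulI N) (-1)) :
    ∃ (ι : Type) (_ : Fintype ι) (e : ι → N → ℂ), (∀ i, stdForm (RingHom.id ℂ) ε (e i) (e i) = 1) ∧
      (∀ i k, stdForm (RingHom.id ℂ) ε (e i) (T (e k)) = 0) ∧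
      (∀ i k, i ≠ k → stdForm (RingHom.id ℂ) ε (e i) (e k) = 0) ∧
      2 * Fintype.card ι = Fintype.card N := by
  refine exists_pair_frame hT (fun c => c = 1) (by rintro c rfl; simp) fun W hWT hWn hW => ?_
  have hTT : ∀ x y, stdForm (RingHom.id ℂ) ε (T x) (T y) =
      starRingEnd ℂ (stdForm (RingHom.id ℂ) ε x y) := fun x y => by
    rw [stdForm_skewRoots hT]; simp
  have hsq : ∀ x, T (T x) = (-1 : ℂ) • x := fun x => by rw [skewRoots_apply_apply hT]; simp
  have hsymm : ∀ x y, stdForm (RingHom.id ℂ) ε y x = stdForm (RingHom.id ℂ) ε x y :=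
    fun x y => hd.symm x y
  have hscale : ∀ z ∈ W, stdForm (RingHom.id ℂ) ε z z ≠ 0 → ∃ p : ℂ, p ≠ 0 ∧ p • z ∈ W ∧
      stdForm (RingHom.id ℂ) ε (p • z) (p • z) = 1 := by
    intro z hz hzz
    obtain ⟨p, hp⟩ := IsAlgClosed.exists_eq_mul_self (stdForm (RingHom.id ℂ) ε z z)
    have hp0 : p ≠ 0 := fun h => hzz (by rw [hp, h, mul_zero])
    refine ⟨p⁻¹, inv_ne_zero hp0, W.smul_mem _ hz, ?_⟩
    rw [stdForm_smul_left, stdForm_smul_right, hp, RingHom.id_apply]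
    field_simp
  obtain ⟨z, hz, hzz⟩ := exists_nonisotropic hd hWn hW
  obtain ⟨p, -, hx, hxx⟩ := hscale z hz hzz
  generalize p • z = x at hx hxx
  -- `v = x + T x` is orthogonal to `T v`, and not isotropic since `h (x, T x)` is imaginary
  have him : starRingEnd ℂ (stdForm (RingHom.id ℂ) ε x (T x)) =
      -stdForm (RingHom.id ℂ) ε x (T x) := by
    have h := hTT x (T x)
    rw [hsq, stdForm_smul_right, hsymm] at h
    rw [← h]
    ring
  have hvT : stdForm (RingHom.id ℂ) ε (x + T x) (T (x + T x)) = 0 := by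
    rw [map_add, hsq, stdForm_add_left, stdForm_add_right, stdForm_add_right, stdForm_smul_right,
      stdForm_smul_right, hTT, hxx, hsymm x (T x), map_one]
    ring
  have hvv : stdForm (RingHom.id ℂ) ε (x + T x) (x + T x) ≠ 0 := by
    rw [stdForm_add_left, stdForm_add_right, stdForm_add_right, hTT, hxx, hsymm x (T x), map_one]
    intro h
    have h' := congrArg (starRingEnd ℂ) h
    simp only [map_add, map_one, map_zero, him] at h'
    have h4 : (4 : ℂ) = 0 := by linear_combination h + h'
    norm_num at h4
  obtain ⟨q, -, hq, hqq⟩ := hscale _ (W.add_mem hx (hWT x hx)) hvv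
  refine ⟨q • (x + T x), hq, ?_, hqq⟩
  rw [skewRoots_smul hT, stdForm_smul_left, stdForm_smul_right, hvT, mul_zero, mul_zero]

end NormalForm

section FrameMatrix

variable {N : Type*} [Fintype N] [DecidableEq N] {κ : ℂ →+* ℂ} {ε : N → ℂ} {hd : IsStdData κ ε}
  {lam : ℤˣ} {T : CEnd N}

/-- An orthonormal frame in which `T` has the matrix `D` gives an automorphism of the form
conjugating the antilinear map with matrix `D` to `T`. -/
theorem exists_conjEnd_eq (hT : T ∈ skewRoots (stdRe κ ε hd) (mulI N) lam) {f : N → N → ℂ}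
    (hf : ∀ i k, stdForm κ ε (f i) (f k) = if i = k then ε i else 0) {D : Matrix N N ℂ}
    (hD : ∀ i, T (f i) = ∑ k, D k i • f k) :
    ∃ g : (Matrix N N ℂ)ˣ, (∀ u v, stdForm κ ε (matEnd (g : Matrix N N ℂ) u)
      (matEnd (g : Matrix N N ℂ) v) = stdForm κ ε u v) ∧ conjEnd g (matEnd D * starEnd N) = T := by
  let A : Matrix N N ℂ := Matrix.of fun k i => f i k
  -- the inverse of `A` is its adjoint for the form, as the columns of `A` are orthonormal
  let A' : Matrix N N ℂ := Matrix.of fun i k => ε i * (κ (f i k) * ε k)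
  have hA : ∀ u, matEnd A u = ∑ i, u i • f i := by
    intro u
    ext k
    rw [matEnd_apply]
    simp [A, Matrix.mulVec, dotProduct, mul_comm]
  have hA'A : A' * A = 1 := by
    ext i k
    have h := hf i k
    simp only [Matrix.mul_apply, A, A', Matrix.of_apply, mul_assoc]
    rw [← Finset.mul_sum]
    change ε i * stdForm κ ε (f i) (f k) = _
    rw [h, Matrix.one_apply]
    split_ifs
    · exact hd.sign_sq i
    · exact mul_zero _
  refine ⟨⟨A, A', mul_eq_one_comm.1 hA'A, hA'A⟩, fun u v => ?_, ?_⟩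
  · change stdForm κ ε (matEnd A u) (matEnd A v) = _
    rw [hA, hA, stdForm_sum_left]
    refine Finset.sum_congr rfl fun i _ => ?_
    rw [stdForm_smul_left, stdForm_sum_right, Finset.sum_eq_single i]
    · rw [stdForm_smul_right, hf, if_pos rfl]
      ring
    · intro k _ hk
      rw [stdForm_smul_right, hf, if_neg hk.symm, mul_zero]
    · simp
  · rw [conjEnd_eq_iff]
    refine ContinuousLinearMap.ext fun u => ?_
    change matEnd A (matEnd D (star u)) = T (matEnd A u)
    rw [hA, hA, map_sum]
    have : ∀ i, T (u i • f i) = ∑ k, (D k i * star (u i)) • f k := by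
      intro i
      rw [skewRoots_smul hT, hD, Finset.smul_sum]
      exact Finset.sum_congr rfl fun k _ => by rw [smul_smul, mul_comm]; rfl
    rw [Finset.sum_congr rfl fun i _ => this i, Finset.sum_comm]
    refine Finset.sum_congr rfl fun k _ => ?_
    rw [matEnd_apply, ← Finset.sum_smul]
    rfl

/-- The matrix of a map that exchanges, up to the sign `lam`, the two halves of `N ≃ n ⊕ n`. -/
def pairMatrix {n : Type*} [Fintype n] [DecidableEq n] (e : N ≃ n ⊕ n) (lam : ℤˣ) :
    Matrix N N ℂ :=
  (Matrix.fromBlocks 0 (((lam : ℤ) : ℂ) • (1 : Matrix n n ℂ)) 1 0).submatrix e e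

/-- A frame of pairs `v`, `T v` conjugates `T` to the antilinear map with matrix `pairMatrix`. -/
theorem exists_conjEnd_pairMatrix (hT : T ∈ skewRoots (stdRe κ ε hd) (mulI N) lam)
    {n : Type*} [Fintype n] [DecidableEq n] (e : N ≃ n ⊕ n) {v : n → N → ℂ}
    (hv : ∀ i, stdForm κ ε (v i) (v i) = ε (e.symm (Sum.inl i)))
    (hε : ∀ i, ε (e.symm (Sum.inr i)) = -((lam : ℤ) : ℂ) * ε (e.symm (Sum.inl i)))
    (hvT : ∀ i k, stdForm κ ε (v i) (T (v k)) = 0)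
    (hvv : ∀ i k, i ≠ k → stdForm κ ε (v i) (v k) = 0) :
    ∃ g : (Matrix N N ℂ)ˣ, (∀ u v, stdForm κ ε (matEnd (g : Matrix N N ℂ) u)
      (matEnd (g : Matrix N N ℂ) v) = stdForm κ ε u v) ∧
      conjEnd g (matEnd (pairMatrix e lam) * starEnd N) = T := by
  let f : n ⊕ n → N → ℂ := Sum.elim v fun i => T (v i)
  refine exists_conjEnd_eq hT (f := fun i => f (e i)) (fun i k => ?_) fun i => ?_
  · obtain ⟨i, rfl⟩ := e.symm.surjective i
    obtain ⟨k, rfl⟩ := e.symm.surjective k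
    rw [e.apply_symm_apply, e.apply_symm_apply]
    simp only [e.symm.injective.eq_iff]
    rcases i with i | i <;> rcases k with k | k
    · simp only [Sum.inl.injEq]
      split_ifs with h
      · rw [h]
        exact hv k
      · exact hvv i k h
    · rw [if_neg (by simp)]
      exact hvT i k
    · rw [if_neg (by simp)]
      change stdForm κ ε (T (v i)) (v k) = 0
      rw [hd.symm (v k), hvT, map_zero]
    · simp only [Sum.inr.injEq]
      change stdForm κ ε (T (v i)) (T (v k)) = _
      rw [stdForm_skewRoots hT]
      split_ifs with h
      · rw [h, hv, hd.conj_sign, hε]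
      · rw [hvv i k h, map_zero, mul_zero]
  · rw [← e.symm.sum_comp]
    simp only [pairMatrix, Matrix.submatrix_apply, Equiv.apply_symm_apply, Fintype.sum_sum_type]
    rcases e i with i | i
    · simp [f, Matrix.one_apply]
    · simp [f, Matrix.one_apply, skewRoots_apply_apply hT, Matrix.smul_apply, ite_smul]

/-- In a Hermitian space, the number of orthogonal vectors of a given square `δ` is at most the
number of coordinates that do not have the sign opposite to `δ`. -/
theorem card_le_of_orthonormal {I : Type*} [Fintype I] [DecidableEq I] {δ : ℂ} (hδ : δ ≠ 0)
    {f : I → N → ℂ}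
    (hf : ∀ i k, stdForm (starRingEnd ℂ) ε (f i) (f k) = if i = k then δ else 0) (s : Finset N)
    (hs : ∀ i ∉ s, ε i = -δ) : Fintype.card I ≤ s.card := by
  have hli : LinearIndependent ℂ fun (i : I) (k : s) => f i k := by
    rw [Fintype.linearIndependent_iff]
    intro c hc
    let x : N → ℂ := ∑ i, c i • f i
    have hx : ∀ k ∈ s, x k = 0 := by
      intro k hk
      have := congrFun hc ⟨k, hk⟩
      simpa [x] using this
    have h₁ : stdForm (starRingEnd ℂ) ε x x = δ * ∑ i, (Complex.normSq (c i) : ℂ) := by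
      simp only [x]
      rw [stdForm_sum_left, Finset.mul_sum]
      refine Finset.sum_congr rfl fun i _ => ?_
      rw [stdForm_smul_left, stdForm_sum_right, Finset.sum_eq_single i]
      · rw [stdForm_smul_right, hf, if_pos rfl, Complex.normSq_eq_conj_mul_self]
        ring
      · intro k _ hk
        rw [stdForm_smul_right, hf, if_neg hk.symm, mul_zero]
      · simp
    have h₂ : stdForm (starRingEnd ℂ) ε x x = -δ * ∑ i, (Complex.normSq (x i) : ℂ) := by
      rw [stdForm, Finset.mul_sum]
      refine Finset.sum_congr rfl fun i _ => ?_
      rw [Complex.normSq_eq_conj_mul_self]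
      by_cases hi : i ∈ s
      · rw [hx i hi]
        simp
      · rw [hs i hi]
        ring
    -- `x` has square `δ |c|²`, and `-δ |x|²` since it vanishes on `s`
    have h₃ : ∑ i, Complex.normSq (c i) + ∑ i, Complex.normSq (x i) = 0 := by
      have : δ * ((∑ i, (Complex.normSq (c i) : ℂ)) + ∑ i, (Complex.normSq (x i) : ℂ)) = 0 := by
        linear_combination h₂ - h₁
      exact_mod_cast (mul_eq_zero.1 this).resolve_left hδ
    have h₄ : ∑ i, Complex.normSq (c i) = 0 := by
      have a := Finset.sum_nonneg fun i (_ : i ∈ Finset.univ) => Complex.normSq_nonneg (c i)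
      have b := Finset.sum_nonneg fun i (_ : i ∈ Finset.univ) => Complex.normSq_nonneg (x i)
      linarith
    intro i
    exact Complex.normSq_eq_zero.1 ((Finset.sum_eq_zero_iff_of_nonneg
      fun i _ => Complex.normSq_nonneg (c i)).1 h₄ i (Finset.mem_univ i))
  simpa using hli.fintype_card_le_finrank

end FrameMatrix

/-! ### Isotropy groups -/

section FormMatrix

variable {N : Type*} [Fintype N] [DecidableEq N] {κ : ℂ →+* ℂ} {ε : N → ℂ}

theorem stdForm_eq_dotProduct (u v : N → ℂ) :
    stdForm κ ε u v = (κ ∘ u) ⬝ᵥ (Matrix.diagonal ε *ᵥ v) := by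
  simp [stdForm, dotProduct, Matrix.mulVec_diagonal]

theorem stdForm_matEnd_iff (A : Matrix N N ℂ) (c : ℂ) :
    (∀ u v, stdForm κ ε (matEnd A u) (matEnd A v) = c * stdForm κ ε u v) ↔
      (A.map κ)ᵀ * Matrix.diagonal ε * A = c • Matrix.diagonal ε := by
  have h : ∀ u v, stdForm κ ε (matEnd A u) (matEnd A v) =
      (κ ∘ u) ⬝ᵥ (((A.map κ)ᵀ * Matrix.diagonal ε * A) *ᵥ v) := by
    intro u v
    have e : κ ∘ (A *ᵥ u) = A.map κ *ᵥ (κ ∘ u) := funext fun i => RingHom.map_mulVec κ A u i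
    rw [stdForm_eq_dotProduct, matEnd_apply, matEnd_apply, e, ← Matrix.mulVec_mulVec,
      ← Matrix.mulVec_mulVec, Matrix.dotProduct_mulVec _ (A.map κ)ᵀ, Matrix.vecMul_transpose]
  constructor
  · intro H
    ext i k
    have e := H (Pi.single i 1) (Pi.single k 1)
    have e' : κ ∘ (Pi.single i 1 : N → ℂ) = Pi.single i 1 := by
      ext l
      by_cases hl : l = i
      · subst hl; simp
      · simp [Pi.single_eq_of_ne hl]
    have e'' : Matrix.diagonal ε i k = (Pi.single i 1 : N → ℂ) k * ε k := by
      by_cases hk : k = i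
      · subst hk; simp
      · simp [Pi.single_eq_of_ne hk, Matrix.diagonal_apply_ne' _ hk]
    rw [h, stdForm_eq_dotProduct, e'] at e
    simpa [e''] using e
  · intro H u v
    rw [h, H, stdForm_eq_dotProduct, Matrix.smul_mulVec, dotProduct_smul, smul_eq_mul]

theorem stdRe_matEnd_iff (hd : IsStdData κ ε) (A : Matrix N N ℂ) :
    (∀ u v, stdRe κ ε hd (matEnd A u) (matEnd A v) = stdRe κ ε hd u v) ↔
      ∀ u v, stdForm κ ε (matEnd A u) (matEnd A v) = stdForm κ ε u v := by
  constructor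
  · intro h u v
    have e : Complex.I • matEnd A v = matEnd A (Complex.I • v) :=
      congrArg (fun S : CEnd N => S v) (commute_mulI_matEnd A).eq
    rw [stdForm_eq_stdRe hd, stdForm_eq_stdRe hd, h, e, h]
  · intro h u v
    rw [stdRe_apply, stdRe_apply, h]

theorem starEnd_mul_matEnd (A : Matrix N N ℂ) :
    starEnd N * matEnd A = matEnd (A.map (starRingEnd ℂ)) * starEnd N := by
  refine ContinuousLinearMap.ext fun v => funext fun i => ?_
  exact RingHom.map_mulVec (starRingEnd ℂ) A v i

omit [DecidableEq N] in
theorem starEnd_mul_starEnd : starEnd N * starEnd N = 1 :=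
  ContinuousLinearMap.ext fun v => star_star v

/-- The isotropy condition, for an antilinear map with matrix `D`. -/
theorem conjEnd_matEnd_starEnd_iff (g : (Matrix N N ℂ)ˣ) (D : Matrix N N ℂ) :
    conjEnd g (matEnd D * starEnd N) = matEnd D * starEnd N ↔
      (g : Matrix N N ℂ) * D = D * (g : Matrix N N ℂ).map (starRingEnd ℂ) := by
  rw [conjEnd_eq_iff, mul_assoc (matEnd D), starEnd_mul_matEnd, ← mul_assoc, ← mul_assoc,
    ← map_mul, ← map_mul]
  constructor
  · intro h
    have h' := congrArg (· * starEnd N) h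
    simp only [mul_assoc, starEnd_mul_starEnd, mul_one] at h'
    exact matEnd_injective h'
  · intro h
    rw [h]

/-- The antilinear map with matrix `D` is a skew root under the matrix form of the conditions `T² =
lam` and `h (T x, T y) = -lam conj h (x, y)`. -/
theorem matEnd_mul_starEnd_mem (hd : IsStdData κ ε) {lam : ℤˣ} {D : Matrix N N ℂ}
    (hD : D * D.map (starRingEnd ℂ) = ((lam : ℤ) : ℂ) • (1 : Matrix N N ℂ))
    (hDε : (D.map κ)ᵀ * Matrix.diagonal ε * D = (-((lam : ℤ) : ℂ)) • Matrix.diagonal ε) :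
    matEnd D * starEnd N ∈ skewRoots (stdRe κ ε hd) (mulI N) lam := by
  have hS : ∀ X, (matEnd D * starEnd N) ((matEnd D * starEnd N) X) = (lam : ℤ) • X := by
    intro X
    have h : (matEnd D * starEnd N) * (matEnd D * starEnd N) =
        matEnd (((lam : ℤ) : ℂ) • (1 : Matrix N N ℂ)) := by
      rw [mul_assoc, ← mul_assoc (starEnd N), starEnd_mul_matEnd, mul_assoc, starEnd_mul_starEnd,
        mul_one, ← map_mul, hD]
    have h' := congrArg (fun S : CEnd N => S X) h
    refine h'.trans ?_
    change (((lam : ℤ) : ℂ) • (1 : Matrix N N ℂ)) *ᵥ X = _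
    rw [Matrix.smul_mulVec, Matrix.one_mulVec, Int.cast_smul_eq_zsmul]
  have hh := (stdForm_matEnd_iff D (-((lam : ℤ) : ℂ))).2 hDε
  have hstar : ∀ x y, stdForm κ ε (star x) (star y) = starRingEnd ℂ (stdForm κ ε x y) := by
    intro x y
    simp only [stdForm, map_sum, map_mul, hd.conj_sign, ← hd.conj_comm]
    rfl
  have hSS : ∀ x y, stdForm κ ε ((matEnd D * starEnd N) x) ((matEnd D * starEnd N) y) =
      -((lam : ℤ) : ℂ) * starRingEnd ℂ (stdForm κ ε x y) := by
    intro x y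
    rw [← hstar]
    exact hh _ _
  refine ⟨hS, fun X Y => ?_, fun X => ?_⟩
  · have h := congrArg Complex.re (hSS X ((matEnd D * starEnd N) Y))
    rw [hS, ← Int.cast_smul_eq_zsmul ℂ, stdForm_smul_right] at h
    rw [stdRe_apply, stdRe_apply]
    rcases Int.units_eq_one_or lam with rfl | rfl
    · simpa using h
    · simp only [Units.val_neg, Units.val_one, Int.cast_neg, Int.cast_one, neg_mul, one_mul,
        Complex.neg_re, neg_neg, Complex.conj_re] at h
      linarith
  · change matEnd D (star (Complex.I • X)) = -(Complex.I • matEnd D (star X))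
    rw [star_smul, matEnd_apply, matEnd_apply, Matrix.mulVec_smul]
    simp

/-- A group of matrices over `R` is realized as the isotropy subgroup of the antilinear map with
matrix `D` by a multiplicative map `χ` of matrix algebras with image `{A | A D = D conj A}` that is
compatible with the forms. -/
theorem exists_isotropy_realization {G : Subgroup (Matrix N N ℂ)ˣ}
    (hG : ∀ g : (Matrix N N ℂ)ˣ, g ∈ G ↔
      ((g : Matrix N N ℂ).map κ)ᵀ * Matrix.diagonal ε * (g : Matrix N N ℂ) = Matrix.diagonal ε)
    {n R : Type*} [Fintype n] [DecidableEq n] [Ring R] [StarRing R] [TopologicalSpace R]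
    (F : Matrix n n R) (χ : Matrix n n R →* Matrix N N ℂ) (ρ : Matrix N N ℂ → Matrix n n R)
    (D : Matrix N N ℂ) (hχ : Continuous χ) (hρ : Continuous ρ) (hρχ : ∀ h, ρ (χ h) = h)
    (hχD : ∀ h, χ h * D = D * (χ h).map (starRingEnd ℂ))
    (hχρ : ∀ A, A * D = D * A.map (starRingEnd ℂ) → χ (ρ A) = A)
    (hF : ∀ h, hᴴ * F * h = F ↔
      ((χ h).map κ)ᵀ * Matrix.diagonal ε * χ h = Matrix.diagonal ε) :
    ∃ ι : formGroup F →* G, IsClosedEmbedding ι ∧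
      ∀ g : G, g ∈ ι.range ↔ conjEnd (g : (Matrix N N ℂ)ˣ) (matEnd D * starEnd N) =
        matEnd D * starEnd N := by
  let ι : formGroup F →* G := ((Units.map χ).comp (formGroup F).subtype).codRestrict G
    fun h => (hG _).2 ((hF _).1 h.2)
  have hι : ∀ h : formGroup F, (((ι h : (Matrix N N ℂ)ˣ)) : Matrix N N ℂ) =
    χ ((h : (Matrix n n R)ˣ) : Matrix n n R) := fun h => rfl
  have hinj : Function.Injective χ := Function.LeftInverse.injective hρχ
  have hrange : ∀ g : G, g ∈ ι.range ↔
      conjEnd (g : (Matrix N N ℂ)ˣ) (matEnd D * starEnd N) = matEnd D * starEnd N := by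
    intro g
    rw [conjEnd_matEnd_starEnd_iff]
    constructor
    · rintro ⟨h, rfl⟩
      exact hχD _
    · intro hg
      have hg' : ((g⁻¹ : (Matrix N N ℂ)ˣ) : Matrix N N ℂ) * D =
          D * ((g⁻¹ : (Matrix N N ℂ)ˣ) : Matrix N N ℂ).map (starRingEnd ℂ) := by
        have := (conjEnd_matEnd_starEnd_iff (g : (Matrix N N ℂ)ˣ) D).2 hg
        refine (conjEnd_matEnd_starEnd_iff (g⁻¹ : (Matrix N N ℂ)ˣ) D).1 ?_
        conv_lhs => rw [← this]
        rw [← conjEnd_mul, inv_mul_cancel, conjEnd_one]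
      have e₁ := hχρ _ hg
      have e₂ := hχρ _ hg'
      let h : (Matrix n n R)ˣ := ⟨ρ (g : (Matrix N N ℂ)ˣ),
        ρ ((g⁻¹ : (Matrix N N ℂ)ˣ) : Matrix N N ℂ),
        hinj (by rw [map_mul, e₁, e₂, Units.mul_inv, map_one]),
        hinj (by rw [map_mul, e₁, e₂, Units.inv_mul, map_one])⟩
      have hh : h ∈ formGroup F := by
        refine (hF _).2 ?_
        change ((χ (ρ _)).map κ)ᵀ * _ * χ (ρ _) = _
        rw [e₁]
        exact (hG _).1 g.2
      exact ⟨⟨h, hh⟩, Subtype.ext (Units.ext e₁)⟩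
  have hcont : Continuous ι :=
    Continuous.subtype_mk ((Continuous.units_map χ hχ).comp continuous_subtype_val) _
  refine ⟨ι, ⟨?_, ?_⟩, hrange⟩
  · -- a continuous left inverse of `ι`, up to the embedding of the units
    let q : G → Matrix n n R × (Matrix n n R)ᵐᵒᵖ := fun g =>
      (ρ ((g : (Matrix N N ℂ)ˣ) : Matrix N N ℂ),
        MulOpposite.op (ρ ((g⁻¹ : (Matrix N N ℂ)ˣ) : Matrix N N ℂ)))
    have hq : Continuous q :=
      (hρ.comp (Units.continuous_val.comp continuous_subtype_val)).prodMk
        (MulOpposite.continuous_op.comp (hρ.comp (Units.continuous_val.comp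
          (continuous_inv.comp continuous_subtype_val))))
    refine IsEmbedding.of_comp hcont hq ?_
    have : q ∘ ι = Units.embedProduct _ ∘ Subtype.val := by
      funext h
      refine Prod.ext (hρχ _) ?_
      exact congrArg MulOpposite.op (hρχ _)
    rw [this]
    exact Units.isEmbedding_embedProduct.comp IsEmbedding.subtypeVal
  · have : Set.range ι = {g : G | conjEnd (g : (Matrix N N ℂ)ˣ) (matEnd D * starEnd N) =
        matEnd D * starEnd N} := Set.ext hrange
    rw [this]
    refine isClosed_eq ?_ continuous_const
    unfold conjEnd
    exact ((continuous_matEnd.comp (Units.continuous_val.comp continuous_subtype_val)).mul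
      continuous_const).mul (continuous_matEnd.comp (Units.continuous_val.comp
        (continuous_inv.comp continuous_subtype_val)))

/-- The real matrices, in a complex basis `C` of `ℂᴺ` fixed by the antilinear involution with matrix
`D`, realize its isotropy subgroup. -/
theorem exists_real_isotropy (hd : IsStdData κ ε) {G : Subgroup (Matrix N N ℂ)ˣ}
    (hG : ∀ g : (Matrix N N ℂ)ˣ, g ∈ G ↔
      ((g : Matrix N N ℂ).map κ)ᵀ * Matrix.diagonal ε * (g : Matrix N N ℂ) = Matrix.diagonal ε)
    {n : Type*} [Fintype n] [DecidableEq n] (F : Matrix n n ℝ) {C : Matrix N n ℂ}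
    {C' : Matrix n N ℂ} {D : Matrix N N ℂ} {c : ℂ} (hc : c ≠ 0) (hCC : C * C' = 1)
    (hCC' : C' * C = 1) (hDC : D * C.map (starRingEnd ℂ) = C)
    (hCF : (C.map κ)ᵀ * Matrix.diagonal ε * C = c • F.map Complex.ofRealHom) :
    ∃ ι : formGroup F →* G, IsClosedEmbedding ι ∧
      ∀ g : G, g ∈ ι.range ↔ conjEnd (g : (Matrix N N ℂ)ˣ) (matEnd D * starEnd N) =
        matEnd D * starEnd N := by
  have hreal : ∀ (τ : ℂ →+* ℂ) (_ : ∀ r : ℝ, τ r = r) (h : Matrix n n ℝ),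
      (h.map Complex.ofRealHom).map τ = h.map Complex.ofRealHom := by
    intro τ hτ h
    ext i k
    exact hτ _
  have hconj : ∀ h : Matrix n n ℝ,
      (h.map Complex.ofRealHom).map (starRingEnd ℂ) = h.map Complex.ofRealHom :=
    hreal _ Complex.conj_ofReal
  have hCD : C'.map (starRingEnd ℂ) = C' * D := by
    have h₁ : C.map (starRingEnd ℂ) * C'.map (starRingEnd ℂ) = 1 := by
      rw [← Matrix.map_mul, hCC, Matrix.map_one _ (map_zero _) (map_one _)]
    calc C'.map (starRingEnd ℂ) = C' * (D * C.map (starRingEnd ℂ)) * C'.map (starRingEnd ℂ) := by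
          rw [hDC, hCC', Matrix.one_mul]
      _ = C' * D * (C.map (starRingEnd ℂ) * C'.map (starRingEnd ℂ)) := by
          simp only [Matrix.mul_assoc]
      _ = C' * D := by rw [h₁, Matrix.mul_one]
  let χ : Matrix n n ℝ →* Matrix N N ℂ :=
    { toFun := fun h => C * h.map Complex.ofRealHom * C'
      map_one' := by
        rw [Matrix.map_one _ (map_zero _) (map_one _), Matrix.mul_one, hCC]
      map_mul' := fun h h' => by
        rw [Matrix.map_mul]
        calc C * (h.map Complex.ofRealHom * h'.map Complex.ofRealHom) * C'
            = C * h.map Complex.ofRealHom * (1 : Matrix n n ℂ) * h'.map Complex.ofRealHom * C' := by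
              simp only [Matrix.mul_assoc, Matrix.one_mul]
          _ = _ := by
              rw [← hCC']
              simp only [Matrix.mul_assoc] }
  have hχ : ∀ h, χ h = C * h.map Complex.ofRealHom * C' := fun h => rfl
  have hχC : ∀ h, C' * χ h * C = h.map Complex.ofRealHom := by
    intro h
    calc C' * (C * h.map Complex.ofRealHom * C') * C
        = (C' * C) * h.map Complex.ofRealHom * (C' * C) := by simp only [Matrix.mul_assoc]
      _ = _ := by rw [hCC', Matrix.one_mul, Matrix.mul_one]
  refine exists_isotropy_realization hG F χ (fun A => (C' * A * C).map Complex.re) D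
    ?_ ?_ ?_ ?_ ?_ ?_
  · refine Continuous.matrix_mul (Continuous.matrix_mul continuous_const ?_) continuous_const
    exact continuous_id.matrix_map Complex.continuous_ofReal
  · exact ((continuous_const.matrix_mul continuous_id).matrix_mul continuous_const).matrix_map
      Complex.continuous_re
  · intro h
    simp only [hχC]
    ext i k
    exact Complex.ofReal_re _
  · intro h
    rw [hχ, Matrix.map_mul, Matrix.map_mul, hconj, hCD]
    simp only [← Matrix.mul_assoc]
    rw [hDC]
  · intro A hA
    have hB : (C' * A * C).map (starRingEnd ℂ) = C' * A * C := by
      rw [Matrix.map_mul, Matrix.map_mul, hCD, Matrix.mul_assoc C' D, ← hA]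
      calc C' * (A * D) * C.map (starRingEnd ℂ) = C' * A * (D * C.map (starRingEnd ℂ)) := by
            simp only [Matrix.mul_assoc]
        _ = _ := by rw [hDC]
    have hB' : ((C' * A * C).map Complex.re).map Complex.ofRealHom = C' * A * C := by
      ext i k
      exact Complex.conj_eq_iff_re.1 (congrFun (congrFun hB i) k)
    rw [hχ, hB']
    calc C * (C' * A * C) * C' = (C * C') * A * (C * C') := by simp only [Matrix.mul_assoc]
      _ = A := by rw [hCC, Matrix.one_mul, Matrix.mul_one]
  · intro h
    -- the form `diag ε` restricted to the real span of the basis `C` is `c F`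
    have key : (C.map κ)ᵀ * (((χ h).map κ)ᵀ * Matrix.diagonal ε * χ h) * C =
        c • (hᴴ * F * h).map Complex.ofRealHom := by
      have e₁ : χ h * C = C * h.map Complex.ofRealHom := by
        rw [hχ, Matrix.mul_assoc _ C' C, hCC', Matrix.mul_one]
      have e₂ : (C.map κ)ᵀ * ((χ h).map κ)ᵀ = (h.map Complex.ofRealHom)ᵀ * (C.map κ)ᵀ := by
        rw [← Matrix.transpose_mul, ← Matrix.map_mul, e₁, Matrix.map_mul, hreal κ hd.ofReal,
          Matrix.transpose_mul]
      calc (C.map κ)ᵀ * (((χ h).map κ)ᵀ * Matrix.diagonal ε * χ h) * C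
          = ((C.map κ)ᵀ * ((χ h).map κ)ᵀ) * Matrix.diagonal ε * (χ h * C) := by
            simp only [Matrix.mul_assoc]
        _ = (h.map Complex.ofRealHom)ᵀ * ((C.map κ)ᵀ * Matrix.diagonal ε * C) *
              h.map Complex.ofRealHom := by
            rw [e₁, e₂]
            simp only [Matrix.mul_assoc]
        _ = _ := by
            rw [hCF, Matrix.conjTranspose_eq_transpose_of_trivial, Matrix.map_mul, Matrix.map_mul,
              Matrix.transpose_map, Matrix.mul_smul, Matrix.smul_mul]
    have hinj : Function.Injective fun B : Matrix n n ℝ => c • B.map Complex.ofRealHom := by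
      intro B B' hBB
      have := smul_right_injective _ hc hBB
      ext i k
      exact Complex.ofReal_injective (congrFun (congrFun this i) k)
    constructor
    · intro H
      rw [H, ← hCF] at key
      have e : C.map κ * C'.map κ = 1 := by
        rw [← Matrix.map_mul, hCC, Matrix.map_one _ (map_zero _) (map_one _)]
      have e' : (C'.map κ)ᵀ * (C.map κ)ᵀ = 1 := by
        rw [← Matrix.transpose_mul, e, Matrix.transpose_one]
      have key' := congrArg (fun Z => (C'.map κ)ᵀ * Z * C') key
      have simp_mul : ∀ Z : Matrix N N ℂ, (C'.map κ)ᵀ * ((C.map κ)ᵀ * Z * C) * C' = Z := by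
        intro Z
        calc (C'.map κ)ᵀ * ((C.map κ)ᵀ * Z * C) * C'
            = ((C'.map κ)ᵀ * (C.map κ)ᵀ) * Z * (C * C') := by simp only [Matrix.mul_assoc]
          _ = Z := by rw [e', hCC, Matrix.one_mul, Matrix.mul_one]
      simp only [simp_mul] at key'
      exact key'
    · intro H
      rw [H, hCF] at key
      exact (hinj key).symm

end FormMatrix

/-! ### Quaternionic matrices as complex matrices -/

section Quaternionic

/-- The first complex coordinate `α` of the quaternion `α + 𝐣 β`. -/
def quatFst (q : ℍ[ℝ]) : ℂ := ⟨q.re, q.imI⟩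

/-- The second complex coordinate `β` of the quaternion `α + 𝐣 β`. -/
def quatSnd (q : ℍ[ℝ]) : ℂ := ⟨q.imJ, -q.imK⟩

/-- The quaternion `α + 𝐣 β`. -/
def quatMk : ℂ × ℂ →ₗ[ℝ] ℍ[ℝ] where
  toFun p := ⟨p.1.re, p.1.im, p.2.re, -p.2.im⟩
  map_add' _ _ := Quaternion.ext _ _ rfl rfl rfl (neg_add _ _)
  map_smul' c p := Quaternion.ext _ _ (Complex.smul_re c p.1) (Complex.smul_im c p.1)
    (Complex.smul_re c p.2) ((congrArg Neg.neg (Complex.smul_im c p.2)).trans (mul_neg _ _).symm)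

theorem quatMk_fst_snd (q : ℍ[ℝ]) : quatMk (quatFst q, quatSnd q) = q :=
  Quaternion.ext _ _ rfl rfl rfl (neg_neg _)

theorem quatFst_mk (p : ℂ × ℂ) : quatFst (quatMk p) = p.1 := rfl

theorem quatSnd_mk (p : ℂ × ℂ) : quatSnd (quatMk p) = p.2 :=
  Complex.ext rfl (neg_neg _)

/-- The quaternion `𝐣`. -/
def quatJ : ℍ[ℝ] := ⟨0, 0, 1, 0⟩

theorem quatFst_J : quatFst quatJ = 0 := rfl

theorem quatSnd_J : quatSnd quatJ = 1 := Complex.ext rfl neg_zero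

theorem continuous_quatFst : Continuous quatFst := by
  have : quatFst = fun q => (q.re : ℂ) + q.imI * Complex.I :=
    funext fun q => Complex.mk_eq_add_mul_I _ _
  rw [this]
  exact (Complex.continuous_ofReal.comp Quaternion.continuous_re).add
    ((Complex.continuous_ofReal.comp Quaternion.continuous_imI).mul continuous_const)

theorem continuous_quatSnd : Continuous quatSnd := by
  have : quatSnd = fun q => (q.imJ : ℂ) + ((-q.imK : ℝ) : ℂ) * Complex.I :=
    funext fun q => Complex.mk_eq_add_mul_I _ _
  rw [this]
  exact (Complex.continuous_ofReal.comp Quaternion.continuous_imJ).add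
    ((Complex.continuous_ofReal.comp Quaternion.continuous_imK.neg).mul continuous_const)

theorem continuous_quatMk : Continuous quatMk := quatMk.continuous_of_finiteDimensional

theorem quatFst_mul (x y : ℍ[ℝ]) :
    quatFst (x * y) = quatFst x * quatFst y - starRingEnd ℂ (quatSnd x) * quatSnd y := by
  apply Complex.ext <;> simp [quatFst, quatSnd] <;> ring

theorem quatSnd_mul (x y : ℍ[ℝ]) :
    quatSnd (x * y) = quatSnd x * quatFst y + starRingEnd ℂ (quatFst x) * quatSnd y := by
  apply Complex.ext <;> simp [quatFst, quatSnd] <;> ring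

theorem quatFst_add (x y : ℍ[ℝ]) : quatFst (x + y) = quatFst x + quatFst y := by
  apply Complex.ext <;> simp [quatFst]

theorem quatSnd_add (x y : ℍ[ℝ]) : quatSnd (x + y) = quatSnd x + quatSnd y := by
  apply Complex.ext <;> simp [quatSnd]; ring

theorem quatFst_zero : quatFst 0 = 0 := rfl

theorem quatSnd_zero : quatSnd 0 = 0 := by apply Complex.ext <;> simp [quatSnd]

theorem quatFst_one : quatFst 1 = 1 := rfl

theorem quatSnd_one : quatSnd 1 = 0 := by apply Complex.ext <;> simp [quatSnd]

theorem quatFst_star (x : ℍ[ℝ]) : quatFst (star x) = starRingEnd ℂ (quatFst x) := by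
  apply Complex.ext <;> simp [quatFst]

theorem quatSnd_star (x : ℍ[ℝ]) : quatSnd (star x) = -quatSnd x := by
  apply Complex.ext <;> simp [quatSnd]

theorem quatFst_sum {I : Type*} (s : Finset I) (f : I → ℍ[ℝ]) :
    quatFst (∑ i ∈ s, f i) = ∑ i ∈ s, quatFst (f i) :=
  map_sum (AddMonoidHom.mk' quatFst quatFst_add) f s

theorem quatSnd_sum {I : Type*} (s : Finset I) (f : I → ℍ[ℝ]) :
    quatSnd (∑ i ∈ s, f i) = ∑ i ∈ s, quatSnd (f i) :=
  map_sum (AddMonoidHom.mk' quatSnd quatSnd_add) f s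

variable {N n : Type*} [Fintype N] [DecidableEq N] [Fintype n] [DecidableEq n]

/-- The complex matrix, in block form, of left multiplication by a quaternionic matrix `α + 𝐣 β` on
`ℍⁿ = ℂⁿ ⊕ 𝐣 ℂⁿ`, as a right complex vector space. -/
def quatBlocks (A : Matrix n n ℍ[ℝ]) : Matrix (n ⊕ n) (n ⊕ n) ℂ :=
  Matrix.fromBlocks (A.map quatFst) (-(A.map quatSnd).map (starRingEnd ℂ)) (A.map quatSnd)
    ((A.map quatFst).map (starRingEnd ℂ))

omit [DecidableEq n] in
theorem map_quatFst_mul (A B : Matrix n n ℍ[ℝ]) : (A * B).map quatFst =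
    A.map quatFst * B.map quatFst - (A.map quatSnd).map (starRingEnd ℂ) * B.map quatSnd := by
  ext i k
  simp [Matrix.mul_apply, quatFst_sum, quatFst_mul]

omit [DecidableEq n] in
theorem map_quatSnd_mul (A B : Matrix n n ℍ[ℝ]) : (A * B).map quatSnd =
    A.map quatSnd * B.map quatFst + (A.map quatFst).map (starRingEnd ℂ) * B.map quatSnd := by
  ext i k
  simp [Matrix.mul_apply, quatSnd_sum, quatSnd_mul, Finset.sum_add_distrib]

omit [DecidableEq n] [Fintype n] in
theorem map_conj_conj (A : Matrix n n ℂ) :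
    (A.map (starRingEnd ℂ)).map (starRingEnd ℂ) = A := by
  ext i k
  simp

omit [DecidableEq n] in
theorem quatBlocks_mul (A B : Matrix n n ℍ[ℝ]) :
    quatBlocks (A * B) = quatBlocks A * quatBlocks B := by
  have hs : ∀ X Y : Matrix n n ℂ, (X - Y).map (starRingEnd ℂ) =
      X.map (starRingEnd ℂ) - Y.map (starRingEnd ℂ) := fun X Y => by ext; simp
  have ha : ∀ X Y : Matrix n n ℂ, (X + Y).map (starRingEnd ℂ) =
      X.map (starRingEnd ℂ) + Y.map (starRingEnd ℂ) := fun X Y => by ext; simp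
  rw [quatBlocks, quatBlocks, quatBlocks, Matrix.fromBlocks_multiply, map_quatFst_mul,
    map_quatSnd_mul, hs, ha, Matrix.map_mul, Matrix.map_mul, Matrix.map_mul, Matrix.map_mul,
    map_conj_conj, map_conj_conj]
  congr 1
  · rw [neg_mul, sub_eq_add_neg]
  · rw [neg_mul, mul_neg, neg_add, add_comm]
  · rw [mul_neg]
    abel

omit [Fintype n] in
theorem quatBlocks_one : quatBlocks (1 : Matrix n n ℍ[ℝ]) = 1 := by
  have h₁ : (1 : Matrix n n ℍ[ℝ]).map quatFst = 1 := Matrix.map_one _ quatFst_zero quatFst_one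
  have h₂ : (1 : Matrix n n ℍ[ℝ]).map quatSnd = 0 := by
    ext i k
    by_cases h : i = k <;> simp [h, quatSnd_one, quatSnd_zero]
  rw [quatBlocks, h₁, h₂, Matrix.map_one _ (map_zero _) (map_one _),
    Matrix.map_zero _ (map_zero _), neg_zero, Matrix.fromBlocks_one]

omit [DecidableEq n] [Fintype n] in
theorem quatBlocks_conjTranspose (A : Matrix n n ℍ[ℝ]) : quatBlocks Aᴴ = (quatBlocks A)ᴴ := by
  rw [quatBlocks, quatBlocks, Matrix.fromBlocks_conjTranspose]
  congr 1 <;> ext i k <;> simp [quatFst_star, quatSnd_star]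

/-- Quaternionic matrices as complex matrices indexed by `N ≃ n ⊕ n`. -/
def quatMatrix (e : N ≃ n ⊕ n) : Matrix n n ℍ[ℝ] →* Matrix N N ℂ where
  toFun A := (quatBlocks A).submatrix e e
  map_one' := by rw [quatBlocks_one, Matrix.submatrix_one_equiv]
  map_mul' A B := by rw [quatBlocks_mul, Matrix.submatrix_mul_equiv]

theorem quatMatrix_apply (e : N ≃ n ⊕ n) (A : Matrix n n ℍ[ℝ]) :
    quatMatrix e A = (quatBlocks A).submatrix e e := rfl

theorem quatMatrix_conjTranspose (e : N ≃ n ⊕ n) (A : Matrix n n ℍ[ℝ]) :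
    quatMatrix e Aᴴ = (quatMatrix e A)ᴴ := by
  rw [quatMatrix_apply, quatBlocks_conjTranspose, quatMatrix_apply, Matrix.conjTranspose_submatrix]

/-- The quaternionic matrix read off the first block column of a complex matrix. -/
def quatOfMatrix (e : N ≃ n ⊕ n) (A : Matrix N N ℂ) : Matrix n n ℍ[ℝ] :=
  Matrix.of fun i k => quatMk (A (e.symm (Sum.inl i)) (e.symm (Sum.inl k)),
    A (e.symm (Sum.inr i)) (e.symm (Sum.inl k)))

theorem quatOfMatrix_quatMatrix (e : N ≃ n ⊕ n) (A : Matrix n n ℍ[ℝ]) :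
    quatOfMatrix e (quatMatrix e A) = A := by
  ext1 i k
  simp only [quatOfMatrix, quatMatrix_apply, Matrix.of_apply, Matrix.submatrix_apply,
    Equiv.apply_symm_apply]
  exact quatMk_fst_snd _

theorem quatMatrix_injective (e : N ≃ n ⊕ n) : Function.Injective (quatMatrix e) :=
  Function.LeftInverse.injective (quatOfMatrix_quatMatrix e)

/-- Quaternionic matrices commute with right multiplication by `𝐣`, the antilinear map with matrix
`pairMatrix e (-1)`. -/
theorem quatMatrix_mul_pairMatrix (e : N ≃ n ⊕ n) (A : Matrix n n ℍ[ℝ]) :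
    quatMatrix e A * pairMatrix e (-1) =
      pairMatrix e (-1) * (quatMatrix e A).map (starRingEnd ℂ) := by
  rw [quatMatrix_apply, pairMatrix, Matrix.submatrix_mul_equiv, ← Matrix.submatrix_map,
    Matrix.submatrix_mul_equiv, quatBlocks, Matrix.fromBlocks_map, Matrix.fromBlocks_multiply,
    Matrix.fromBlocks_multiply]
  congr 2 <;> ext i k <;> simp

/-- A complex matrix commuting with right multiplication by `𝐣` is quaternionic. -/
theorem quatMatrix_quatOfMatrix (e : N ≃ n ⊕ n) {A : Matrix N N ℂ}
    (hA : A * pairMatrix e (-1) = pairMatrix e (-1) * A.map (starRingEnd ℂ)) :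
    quatMatrix e (quatOfMatrix e A) = A := by
  obtain ⟨A, rfl⟩ : ∃ B : Matrix (n ⊕ n) (n ⊕ n) ℂ, B.submatrix e e = A :=
    ⟨A.submatrix e.symm e.symm, by ext; simp⟩
  have hinj : Function.Injective fun B : Matrix (n ⊕ n) (n ⊕ n) ℂ => B.submatrix e e :=
    (Matrix.reindex e.symm e.symm).injective
  rw [pairMatrix, Matrix.submatrix_mul_equiv, ← Matrix.submatrix_map,
    Matrix.submatrix_mul_equiv] at hA
  have h := hinj hA
  rw [← Matrix.fromBlocks_toBlocks A, Matrix.fromBlocks_map, Matrix.fromBlocks_multiply,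
    Matrix.fromBlocks_multiply] at h
  have h₁ := (Matrix.fromBlocks_inj.1 h).1
  have h₂ := (Matrix.fromBlocks_inj.1 h).2.2.1
  simp only [Matrix.mul_zero, Matrix.mul_one, zero_add, Matrix.zero_mul, Matrix.one_mul, add_zero,
    Units.val_neg, Units.val_one, Int.cast_neg, Int.cast_one, neg_smul, one_smul, neg_mul] at h₁ h₂
  rw [quatMatrix_apply]
  congr 1
  rw [quatBlocks]
  conv_rhs => rw [← Matrix.fromBlocks_toBlocks A, h₁, h₂]
  congr 1 <;> ext i k <;>
    simp [quatOfMatrix, quatFst_mk, quatSnd_mk, Matrix.toBlocks₁₁, Matrix.toBlocks₂₁]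

theorem continuous_quatMatrix (e : N ≃ n ⊕ n) : Continuous (quatMatrix e) := by
  refine Continuous.matrix_submatrix (Continuous.matrix_fromBlocks ?_ ?_ ?_ ?_) _ _
  · exact continuous_id.matrix_map continuous_quatFst
  · exact ((continuous_id.matrix_map continuous_quatSnd).matrix_map Complex.continuous_conj).neg
  · exact continuous_id.matrix_map continuous_quatSnd
  · exact (continuous_id.matrix_map continuous_quatFst).matrix_map Complex.continuous_conj

omit [Fintype N] [DecidableEq N] [Fintype n] [DecidableEq n] in
theorem continuous_quatOfMatrix (e : N ≃ n ⊕ n) : Continuous (quatOfMatrix e) :=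
  continuous_matrix fun _ _ => continuous_quatMk.comp
    ((continuous_id.matrix_elem _ _).prodMk (continuous_id.matrix_elem _ _))

/-- The automorphisms of a quaternionic form, as complex matrices. -/
theorem quatMatrix_form_iff (e : N ≃ n ⊕ n) (F A : Matrix n n ℍ[ℝ]) :
    Aᴴ * F * A = F ↔ (quatMatrix e A)ᴴ * quatMatrix e F * quatMatrix e A = quatMatrix e F := by
  rw [← (quatMatrix_injective e).eq_iff, map_mul, map_mul, quatMatrix_conjTranspose]

theorem quatMatrix_diagonal_j (e : N ≃ n ⊕ n) :
    quatMatrix e (Matrix.diagonal fun _ => quatJ) = pairMatrix e (-1) := by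
  rw [quatMatrix_apply, pairMatrix]
  congr 1
  rw [quatBlocks]
  congr 1 <;> ext i k <;> rcases eq_or_ne i k with rfl | h
  all_goals first
    | (simp [quatFst_J, quatSnd_J]; done)
    | simp [h, quatFst_zero, quatSnd_zero]

/-- The quaternionic matrices preserving an anti-Hermitian form realize the isotropy subgroup, in a
complex orthogonal group, of a quaternionic structure. -/
theorem exists_quaternionic_isotropy_symmetric (e : N ≃ n ⊕ n) {G : Subgroup (Matrix N N ℂ)ˣ}
    (hG : ∀ g : (Matrix N N ℂ)ˣ, g ∈ G ↔ ((g : Matrix N N ℂ).map (RingHom.id ℂ))ᵀ *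
      Matrix.diagonal (fun _ => 1) * (g : Matrix N N ℂ) = Matrix.diagonal fun _ => 1) :
    ∃ ι : formGroup (Matrix.diagonal fun _ : n => quatJ) →* G,
      IsClosedEmbedding ι ∧
      ∀ g : G, g ∈ ι.range ↔ conjEnd (g : (Matrix N N ℂ)ˣ)
        (matEnd (pairMatrix e (-1)) * starEnd N) = matEnd (pairMatrix e (-1)) * starEnd N := by
  refine exists_isotropy_realization hG _ (quatMatrix e) (quatOfMatrix e) _
    (continuous_quatMatrix e) (continuous_quatOfMatrix e) (quatOfMatrix_quatMatrix e)
    (quatMatrix_mul_pairMatrix e) (fun A => quatMatrix_quatOfMatrix e) fun h => ?_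
  rw [quatMatrix_form_iff e, quatMatrix_diagonal_j]
  have hJJ : pairMatrix e (-1) * pairMatrix e (-1) = -1 := by
    rw [pairMatrix, Matrix.submatrix_mul_equiv, Matrix.fromBlocks_multiply]
    have : (-1 : Matrix N N ℂ) = (-(1 : Matrix (n ⊕ n) (n ⊕ n) ℂ)).submatrix e e := by
      ext i k
      simp [Matrix.one_apply]
    rw [this, ← Matrix.fromBlocks_one, Matrix.fromBlocks_neg]
    congr 2 <;> simp
  have hJt : (pairMatrix e (-1))ᴴ = -pairMatrix e (-1) := by
    rw [← quatMatrix_diagonal_j, ← quatMatrix_conjTranspose, quatMatrix_apply, quatMatrix_apply]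
    ext i k
    simp only [quatBlocks, Matrix.submatrix_apply, Matrix.neg_apply]
    rcases e i with i | i <;> rcases e k with k | k <;> rcases eq_or_ne i k with rfl | h
    all_goals first
      | (simp [quatFst_star, quatSnd_star, quatFst_J, quatSnd_J]; done)
      | simp [h, quatFst_zero, quatSnd_zero]
  have hc := congrArg Matrix.conjTranspose (quatMatrix_mul_pairMatrix e h)
  set J := pairMatrix e (-1)
  set A := quatMatrix e h
  have hAc : (A.map (starRingEnd ℂ))ᴴ = Aᵀ := by
    ext i k
    simp
  rw [Matrix.conjTranspose_mul, Matrix.conjTranspose_mul, hJt, hAc, neg_mul, mul_neg, neg_inj] at hc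
  -- this turns the invariance of the anti-Hermitian form into that of the symmetric form
  have hA : Aᴴ * J = J * Aᵀ := by
    have h' : J * (J * Aᴴ) * J = J * (Aᵀ * J) * J := by rw [hc]
    calc Aᴴ * J = -(J * J) * Aᴴ * J := by rw [hJJ, neg_neg, Matrix.one_mul]
      _ = -(J * (J * Aᴴ) * J) := by simp only [Matrix.mul_assoc, neg_mul]
      _ = -(J * Aᵀ * (J * J)) := by rw [h']; simp only [Matrix.mul_assoc]
      _ = J * Aᵀ := by rw [hJJ, mul_neg, neg_neg, Matrix.mul_one]
  have hmap : A.map (RingHom.id ℂ) = A := by ext; rfl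
  rw [hA, hmap, Matrix.diagonal_one, Matrix.mul_one, Matrix.mul_assoc]
  constructor
  · intro H
    have h' : J * (J * (Aᵀ * A)) = J * J := by rw [H]
    rw [← Matrix.mul_assoc, hJJ, neg_mul, Matrix.one_mul, neg_inj] at h'
    exact h'
  · intro H
    rw [H, Matrix.mul_one]

/-- The quaternionic matrices preserving a Hermitian form realize the isotropy subgroup, in a
complex unitary group, of a quaternionic structure. -/
theorem exists_quaternionic_isotropy_hermitian (e : N ≃ n ⊕ n) {ε : N → ℂ} {F : Matrix n n ℍ[ℝ]}
    (hF : quatMatrix e F = Matrix.diagonal ε) {G : Subgroup (Matrix N N ℂ)ˣ}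
    (hG : ∀ g : (Matrix N N ℂ)ˣ, g ∈ G ↔ ((g : Matrix N N ℂ).map (starRingEnd ℂ))ᵀ *
      Matrix.diagonal ε * (g : Matrix N N ℂ) = Matrix.diagonal ε) :
    ∃ ι : formGroup F →* G, IsClosedEmbedding ι ∧
      ∀ g : G, g ∈ ι.range ↔ conjEnd (g : (Matrix N N ℂ)ˣ)
        (matEnd (pairMatrix e (-1)) * starEnd N) = matEnd (pairMatrix e (-1)) * starEnd N := by
  refine exists_isotropy_realization hG _ (quatMatrix e) (quatOfMatrix e) _
    (continuous_quatMatrix e) (continuous_quatOfMatrix e) (quatOfMatrix_quatMatrix e)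
    (quatMatrix_mul_pairMatrix e) (fun A => quatMatrix_quatOfMatrix e) fun h => ?_
  rw [quatMatrix_form_iff e, hF]
  rfl

end Quaternionic

/-! ### Existence of adapted frames -/

/-- A complex structure on a real vector space of dimension `2m` has a complex basis. -/
theorem exists_complex_frame {E : Type*} [NormedAddCommGroup E] [NormedSpace ℝ E]
    [FiniteDimensional ℝ E] {m : ℕ} (hm : Module.finrank ℝ E = 2 * m) (j₀ : E →L[ℝ] E)
    (h : ∀ v, j₀ (j₀ v) = -v) : ∃ ρ : (Fin m → ℂ) ≃ₗ[ℝ] E, ∀ z, ρ (Complex.I • z) = j₀ (ρ z) := by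
  have hj : (j₀ : E →ₗ[ℝ] E) * (j₀ : E →ₗ[ℝ] E) = -1 := LinearMap.ext h
  let F : ℂ →ₐ[ℝ] Module.End ℝ E := Complex.liftAux (j₀ : E →ₗ[ℝ] E) hj
  let _ : Module ℂ E := Module.compHom E (F : ℂ →+* Module.End ℝ E)
  have hsmul : ∀ (c : ℂ) (v : E), c • v = F c v := fun _ _ => rfl
  have : IsScalarTower ℝ ℂ E := ⟨fun r c v => by
    rw [hsmul, hsmul, map_smul]
    rfl⟩
  have : FiniteDimensional ℂ E := Module.Finite.of_restrictScalars_finite ℝ ℂ E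
  have hdim : Module.finrank ℂ E = m := by
    have := Module.finrank_mul_finrank ℝ ℂ E
    rw [Complex.finrank_real_complex] at this
    omega
  let e : (Fin m → ℂ) ≃ₗ[ℂ] E := (LinearEquiv.ofFinrankEq _ _ (by simp [hdim]))
  refine ⟨e.restrictScalars ℝ, fun z => ?_⟩
  change e (Complex.I • z) = j₀ (e z)
  rw [map_smul, hsmul]
  exact congrArg (fun T : Module.End ℝ E => T (e z)) (Complex.liftAux_apply_I _ hj)

section Adapted

variable {m : ℕ} {M : Type*} [TopologicalSpace M] [ChartedSpace (RModel m) M]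
  {N : Type*} [Fintype N] {κ : ℂ →+* ℂ} {ε : N → ℂ}

/-- A real linear map into `E ⊕ E*` that intertwines the complex structures and takes the real part
of the standard form to the pairing gives an adapted frame. -/
theorem exists_isAdapted_of_linear [IsManifold 𝓘(ℝ, RModel m) ∞ M] (hd : IsStdData κ ε)
    (hN : Fintype.card N = 2 * m)
    {j : ∀ x : M, TSpace m M x →L[ℝ] TSpace m M x} {ell : ℤˣ} {x : M}
    (ψ : (N → ℂ) →ₗ[ℝ] ExtModel m)
    (hψ : ∀ z w, modelPairing (ψ z) (ψ w) = (stdForm κ ε z w).re)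
    (hψJ : ∀ z, ψ (Complex.I • z) = modelJ ell (jModel j x x) (ψ z)) :
    ∃ φ : (N → ℂ) ≃L[ℝ] ExtTangent m M x, IsAdapted j ell (stdForm κ ε) φ := by
  have hx := mem_chart_source (RModel m) x
  have hinj : Function.Injective ψ := by
    refine (injective_iff_map_eq_zero ψ).2 fun z hz => hd.nondegenerate fun w => ?_
    rw [stdForm_eq_stdRe hd, stdRe_apply, stdRe_apply, ← hψ, ← hψ, hz]
    simp [modelPairing]
  have hdim : Module.finrank ℝ (N → ℂ) = Module.finrank ℝ (ExtModel m) := by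
    rw [Module.finrank_prod, ← (LinearMap.toContinuousLinearMap (𝕜 := ℝ) (E := RModel m)
      (F' := ℝ)).finrank_eq, Module.finrank_linearMap, Module.finrank_self,
      Module.finrank_pi_fintype]
    simp [hN]
    ring
  let φ : (N → ℂ) ≃L[ℝ] ExtTangent m M x :=
    (LinearEquiv.ofInjectiveOfFinrankEq ψ hinj hdim).toContinuousLinearEquiv.trans
      (extEquiv x hx).symm
  have hφ : ∀ z, extEquiv x hx (φ z) = ψ z := fun z => (extEquiv x hx).apply_symm_apply _
  have hφJ : ∀ z, φ (Complex.I • z) = JEll j ell x (φ z) := by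
    intro z
    refine (extEquiv x hx).injective ?_
    rw [extEquiv_JEll, hφ, hφ, hψJ]
  refine ⟨φ, hφJ, fun z w => Eq.trans ?_ (stdForm_eq_stdRe hd z w).symm⟩
  rw [bEll, ← hφJ, ← modelPairing_extEquiv x hx, ← modelPairing_extEquiv x hx, hφ, hφ, hφ, hψ, hψ]
  rfl

/-- The real covector `v ↦ ½ Re (a ⬝ ρ⁻¹ v)`, for the complex bilinear dot product. -/
def complexCovector (ρ : (Fin m → ℂ) ≃ₗ[ℝ] RModel m) : (Fin m → ℂ) →ₗ[ℝ] (RModel m →L[ℝ] ℝ) :=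
  (LinearMap.toContinuousLinearMap (𝕜 := ℝ) (E := RModel m) (F' := ℝ)).toLinearMap ∘ₗ
    LinearMap.mk₂ ℝ (fun a v => (1 / 2 : ℝ) * (a ⬝ᵥ ρ.symm v).re)
      (fun a a' v => by rw [add_dotProduct, Complex.add_re, mul_add])
      (fun c a v => by
        rw [smul_dotProduct, Complex.smul_re, smul_eq_mul, smul_eq_mul, mul_left_comm])
      (fun a v v' => by rw [map_add, dotProduct_add, Complex.add_re, mul_add])
      (fun c a v => by
        rw [map_smul, dotProduct_smul, Complex.smul_re, smul_eq_mul, smul_eq_mul, mul_left_comm])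

theorem complexCovector_apply (ρ : (Fin m → ℂ) ≃ₗ[ℝ] RModel m) (a : Fin m → ℂ) (v : RModel m) :
    complexCovector ρ a v = (1 / 2 : ℝ) * (a ⬝ᵥ ρ.symm v).re := rfl

/-- The frames of the form `z ↦ (ρ (P z), ½ Re (Q z ⬝ ρ⁻¹ ·))`, where `ρ` is a complex basis of
`TₓM`, `P` is complex linear and `Q` is linear or antilinear according to `ℓ`. -/
theorem exists_isAdapted [IsManifold 𝓘(ℝ, RModel m) ∞ M] (hd : IsStdData κ ε)
    (e : N ≃ Fin m ⊕ Fin m)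
    {j : ∀ x : M, TSpace m M x →L[ℝ] TSpace m M x} (hsq : ∀ x (v : TSpace m M x), j x (j x v) = -v)
    {ell : ℤˣ} (x : M) (P Q : (N → ℂ) →ₗ[ℝ] (Fin m → ℂ))
    (hP : ∀ z, P (Complex.I • z) = Complex.I • P z)
    (hQ : ∀ z, Q (Complex.I • z) = (ell : ℤ) • (Complex.I • Q z))
    (hPQ : ∀ z w, (Q w ⬝ᵥ P z).re + (Q z ⬝ᵥ P w).re = 2 * (stdForm κ ε z w).re) :
    ∃ φ : (N → ℂ) ≃L[ℝ] ExtTangent m M x, IsAdapted j ell (stdForm κ ε) φ := by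
  have hx := mem_chart_source (RModel m) x
  have hj : ∀ v, jModel j x x (jModel j x x v) = -v := by
    intro v
    rw [jModel_eq j x hx, jModel_eq j x hx, ContinuousLinearEquiv.symm_apply_apply, hsq, map_neg,
      ContinuousLinearEquiv.apply_symm_apply]
  obtain ⟨ρ, hρ⟩ := exists_complex_frame (finrank_euclideanSpace_fin (𝕜 := ℝ) (n := 2 * m))
    (jModel j x x) hj
  have hρ' : ∀ v, ρ.symm (jModel j x x v) = Complex.I • ρ.symm v := by
    intro v
    rw [LinearEquiv.symm_apply_eq, hρ, LinearEquiv.apply_symm_apply]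
  refine exists_isAdapted_of_linear hd (by rw [Fintype.card_congr e]; simp; ring)
    ((ρ.toLinearMap ∘ₗ P).prod (complexCovector ρ ∘ₗ Q)) (fun z w => ?_) fun z => ?_
  · change complexCovector ρ (Q w) (ρ (P z)) + complexCovector ρ (Q z) (ρ (P w)) = _
    rw [complexCovector_apply, complexCovector_apply, LinearEquiv.symm_apply_apply,
      LinearEquiv.symm_apply_apply]
    linear_combination (1 / 2 : ℝ) * hPQ z w
  · refine Prod.ext ?_ (ContinuousLinearMap.ext fun v => ?_)
    · change ρ (P _) = jModel j x x (ρ (P z))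
      rw [hP, hρ]
    · change complexCovector ρ (Q _) v = (ell : ℤ) • complexCovector ρ (Q z) (jModel j x x v)
      rw [hQ, map_zsmul, smul_apply, complexCovector_apply,
        complexCovector_apply, hρ', dotProduct_smul, smul_dotProduct]

/-- The frame `(z, w) ↦ (ρ (z + i w), ½ Re ((z - i w) ⬝ ρ⁻¹ ·))` is adapted for `ℓ = 1`. -/
theorem exists_isAdapted_symmetric [IsManifold 𝓘(ℝ, RModel m) ∞ M]
    (hd : IsStdData (RingHom.id ℂ) (fun _ : N => 1)) (e : N ≃ Fin m ⊕ Fin m)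
    {j : ∀ x : M, TSpace m M x →L[ℝ] TSpace m M x} (hsq : ∀ x (v : TSpace m M x), j x (j x v) = -v)
    (x : M) : ∃ φ : (N → ℂ) ≃L[ℝ] ExtTangent m M x,
      IsAdapted j 1 (stdForm (RingHom.id ℂ) fun _ : N => 1) φ := by
  let L (c : ℂ) : (N → ℂ) →ₗ[ℝ] (Fin m → ℂ) :=
    { toFun := fun z i => z (e.symm (Sum.inl i)) + c * z (e.symm (Sum.inr i))
      map_add' := fun z w => by ext i; simp; ring
      map_smul' := fun r z => by ext i; simp; ring }
  have hL : ∀ c z, L c (Complex.I • z) = Complex.I • L c z := fun c z => by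
    ext i; simp [L]; ring
  refine exists_isAdapted hd e hsq x (L Complex.I) (L (-Complex.I)) (hL _) (fun z => ?_)
    fun z w => ?_
  · rw [hL]; simp
  · have h : L (-Complex.I) w ⬝ᵥ L Complex.I z + L (-Complex.I) z ⬝ᵥ L Complex.I w =
        2 * stdForm (RingHom.id ℂ) (fun _ : N => 1) z w := by
      rw [stdForm, ← e.symm.sum_comp, Fintype.sum_sum_type, ← Finset.sum_add_distrib,
        Finset.mul_sum, dotProduct, dotProduct, ← Finset.sum_add_distrib]
      refine Finset.sum_congr rfl fun i _ => ?_
      simp only [L, LinearMap.coe_mk, AddHom.coe_mk, RingHom.id_apply]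
      linear_combination (-2 * z (e.symm (Sum.inr i)) * w (e.symm (Sum.inr i))) * Complex.I_mul_I
    rw [← Complex.add_re, h, show (2 : ℂ) = ((2 : ℝ) : ℂ) by norm_num, Complex.re_ofReal_mul]

/-- The frame `(z, w) ↦ (ρ (z + w), ½ Re (conj (z - w) ⬝ ρ⁻¹ ·))` is adapted for `ℓ = -1`. -/
theorem exists_isAdapted_hermitian [IsManifold 𝓘(ℝ, RModel m) ∞ M]
    {δ : Fin m ⊕ Fin m → ℂ} (hδ : δ = Sum.elim (fun _ => 1) fun _ => -1)
    (hd : IsStdData (starRingEnd ℂ) δ)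
    {j : ∀ x : M, TSpace m M x →L[ℝ] TSpace m M x} (hsq : ∀ x (v : TSpace m M x), j x (j x v) = -v)
    (x : M) : ∃ φ : (Fin m ⊕ Fin m → ℂ) ≃L[ℝ] ExtTangent m M x,
      IsAdapted j (-1) (stdForm (starRingEnd ℂ) δ) φ := by
  let P : (Fin m ⊕ Fin m → ℂ) →ₗ[ℝ] (Fin m → ℂ) :=
    { toFun := fun z i => z (Sum.inl i) + z (Sum.inr i)
      map_add' := fun z w => by ext i; simp; ring
      map_smul' := fun r z => by ext i; simp }
  let Q : (Fin m ⊕ Fin m → ℂ) →ₗ[ℝ] (Fin m → ℂ) :=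
    { toFun := fun z i => starRingEnd ℂ (z (Sum.inl i) - z (Sum.inr i))
      map_add' := fun z w => by ext i; simp; ring
      map_smul' := fun r z => by ext i; simp; ring }
  refine exists_isAdapted hd (Equiv.refl _) hsq x P Q (fun z => ?_) (fun z => ?_) fun z w => ?_
  · ext i; simp [P]; ring
  · ext i; simp [Q]; ring
  · rw [← Complex.add_re, stdForm, Fintype.sum_sum_type, ← Finset.sum_add_distrib, dotProduct,
      dotProduct, ← Finset.sum_add_distrib, Complex.re_sum, Complex.re_sum, Finset.mul_sum]
    refine Finset.sum_congr rfl fun i _ => ?_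
    simp only [P, Q, hδ, LinearMap.coe_mk, AddHom.coe_mk, Sum.elim_inl, Sum.elim_inr]
    simp only [Complex.add_re, Complex.mul_re, Complex.conj_re, Complex.conj_im, Complex.sub_re,
      Complex.sub_im, Complex.add_im, Complex.mul_im, Complex.one_re, Complex.one_im,
      Complex.neg_re, Complex.neg_im]
    ring

/-! ### The pointwise structures in an adapted frame -/

/-- An endomorphism that anticommutes with a complex structure has opposite eigenspaces of the same
dimension. -/
theorem finrank_eigenspace_neg {K V : Type*} [Field K] [AddCommGroup V] [Module K V]
    {S J : Module.End K V} (hJ : ∀ v, J (J v) = -v) (h : ∀ v, S (J v) = -J (S v)) (μ : K) :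
    Module.finrank K (Module.End.eigenspace S μ) =
      Module.finrank K (Module.End.eigenspace S (-μ)) := by
  have hmap : ∀ (μ : K) (v : V), v ∈ Module.End.eigenspace S μ →
      J v ∈ Module.End.eigenspace S (-μ) := by
    intro μ v hv
    rw [Module.End.mem_eigenspace_iff] at hv ⊢
    rw [h, hv, map_smul, neg_smul]
  have hJ' : ∀ v, -J (J v) = v := fun v => by rw [hJ, neg_neg]
  refine LinearEquiv.finrank_eq (LinearEquiv.ofLinearMap
    (J.restrict (hmap μ))
    ((-J).restrict fun v hv => Submodule.neg_mem _ (by simpa using hmap (-μ) v hv))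
    (LinearMap.ext fun v => Subtype.ext ?_) (LinearMap.ext fun v => Subtype.ext ?_))
  · simp [hJ]
  · simp [hJ]

/-- An endomorphism that anticommutes with a complex structure is split. -/
theorem isSplitMap_of_anticommute {V : Type*} [AddCommGroup V] [Module ℝ V] (lam : ℤˣ)
    {S J : V →ₗ[ℝ] V} (hJ : ∀ v, J (J v) = -v) (h : ∀ v, S (J v) = -J (S v)) :
    IsSplitMap lam S := by
  have hJ₂ : J ∘ₗ J = -LinearMap.id := LinearMap.ext hJ
  have h₂ : S ∘ₗ J = -(J ∘ₗ S) := LinearMap.ext h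
  refine ⟨fun _ => finrank_eigenspace_neg hJ h 1, fun _ =>
    finrank_eigenspace_neg (J := J.baseChange ℂ) (fun v => ?_) (fun v => ?_) Complex.I⟩
  · rw [← LinearMap.comp_apply, ← LinearMap.baseChange_comp, hJ₂, LinearMap.baseChange_neg,
      LinearMap.baseChange_id]
    rfl
  · rw [← LinearMap.comp_apply, ← LinearMap.baseChange_comp, h₂, LinearMap.baseChange_neg,
      LinearMap.baseChange_comp]
    rfl

variable {j : ∀ x : M, TSpace m M x →L[ℝ] TSpace m M x} {ell : ℤˣ} {x : M}
  {φ : (N → ℂ) ≃L[ℝ] ExtTangent m M x}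

theorem extPairing_of_isAdapted (hd : IsStdData κ ε) (hφ : IsAdapted j ell (stdForm κ ε) φ)
    (z w : N → ℂ) : extPairing (φ z) (φ w) = stdRe κ ε hd z w := by
  rw [stdRe_apply, ← hφ.2, bEll]
  simp

theorem frameConj_apply (T : CEnd N) (z : N → ℂ) : frameConj φ T (φ z) = φ (T z) :=
  congrArg (fun w => φ (T w)) (φ.symm_apply_apply z)

/-- In an adapted frame, the pointwise structures are the antilinear square roots of `lam` that are
skew-symmetric for the real part of the standard form; they are automatically split. -/
theorem mem_slashFibre_iff (hd : IsStdData κ ε) (hφ : IsAdapted j ell (stdForm κ ε) φ) (lam : ℤˣ)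
    (S : ExtEnd m M x) : S ∈ slashFibre j lam ell x ↔
      ∃ T ∈ skewRoots (stdRe κ ε hd) (mulI N) lam, frameConj φ T = S := by
  constructor
  · rintro ⟨h₁, -, h₂, h₃⟩
    let T : CEnd N := (φ.symm : ExtTangent m M x →L[ℝ] (N → ℂ)).comp
      (S.comp (φ : (N → ℂ) →L[ℝ] ExtTangent m M x))
    have hT : ∀ z, φ (T z) = S (φ z) := fun z => φ.apply_symm_apply _
    refine ⟨T, ⟨fun z => φ.injective ?_, fun z w => ?_, fun z => φ.injective ?_⟩,
      ContinuousLinearMap.ext fun X => ?_⟩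
    · rw [hT, hT, h₁, map_zsmul]
    · rw [← extPairing_of_isAdapted hd hφ, ← extPairing_of_isAdapted hd hφ, hT, hT, h₂]
    · rw [hT, mulI_apply, hφ.1, h₃, map_neg, mulI_apply, hφ.1, hT]
    · obtain ⟨z, rfl⟩ := φ.surjective X
      rw [frameConj_apply, hT]
  · rintro ⟨T, ⟨h₁, h₂, h₃⟩, rfl⟩
    have hsplit : IsSplitMap lam (frameConj φ T : ExtTangent m M x →ₗ[ℝ] ExtTangent m M x) := by
      refine isSplitMap_of_anticommute lam
        (J := (frameConj φ (mulI N) : ExtTangent m M x →ₗ[ℝ] ExtTangent m M x)) ?_ ?_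
      · intro X
        obtain ⟨z, rfl⟩ := φ.surjective X
        change frameConj φ (mulI N) (frameConj φ (mulI N) (φ z)) = -φ z
        rw [frameConj_apply, frameConj_apply, mulI_apply, mulI_apply, smul_smul, Complex.I_mul_I,
          neg_one_smul, map_neg]
      · intro X
        obtain ⟨z, rfl⟩ := φ.surjective X
        change frameConj φ T (frameConj φ (mulI N) (φ z)) =
          -frameConj φ (mulI N) (frameConj φ T (φ z))
        rw [frameConj_apply, frameConj_apply, frameConj_apply, frameConj_apply, h₃, map_neg]
    refine ⟨fun X => ?_, hsplit, fun X Y => ?_, fun X => ?_⟩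
    · obtain ⟨z, rfl⟩ := φ.surjective X
      rw [frameConj_apply, frameConj_apply, h₁, map_zsmul]
    · obtain ⟨z, rfl⟩ := φ.surjective X
      obtain ⟨w, rfl⟩ := φ.surjective Y
      rw [frameConj_apply, frameConj_apply, extPairing_of_isAdapted hd hφ,
        extPairing_of_isAdapted hd hφ, h₂]
    · obtain ⟨z, rfl⟩ := φ.surjective X
      rw [← hφ.1, frameConj_apply, frameConj_apply, ← hφ.1, ← mulI_apply, h₃, map_neg, mulI_apply]

/-- The signature of `β_S` for a structure `S` that is diagonal, with entries `±i`, in an adapted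
frame: every entry `i` contributes two positive squares, every entry `-i` two negative ones. -/
theorem hasBetaSignature_iff [DecidableEq N] {hd : IsStdData (RingHom.id ℂ) ε}
    (hN : Fintype.card N = 2 * m)
    (hφ : IsAdapted j 1 (stdForm (RingHom.id ℂ) ε) φ) {g : (Matrix N N ℂ)ˣ}
    (hε : ∀ i, ε i = 1)
    (hg : ∀ u v, stdForm (RingHom.id ℂ) ε (matEnd (g : Matrix N N ℂ) u)
      (matEnd (g : Matrix N N ℂ) v) = stdForm (RingHom.id ℂ) ε u v) {s : N → ℝ}
    (hs : ∀ i, s i = 1 ∨ s i = -1) (n : ℕ) :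
    HasBetaSignature j n (frameConj φ (conjEnd g
      (matEnd (Matrix.diagonal fun i => (s i : ℂ) * Complex.I) * starEnd N))) ↔
      {i | s i = 1}.ncard = n := by
  set S₀ : CEnd N := matEnd (Matrix.diagonal fun i => (s i : ℂ) * Complex.I) * starEnd N with hS₀
  set S := frameConj φ (conjEnd g S₀) with hS
  let γ : (N → ℂ) ≃ₗ[ℝ] (N → ℂ) := LinearEquiv.ofLinearMap
    (matEnd (g : Matrix N N ℂ) : (N → ℂ) →ₗ[ℝ] (N → ℂ))
    (matEnd ((g⁻¹ : (Matrix N N ℂ)ˣ) : Matrix N N ℂ) : (N → ℂ) →ₗ[ℝ] (N → ℂ))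
    (LinearMap.ext fun v => congrArg (fun T : CEnd N => T v) (matEnd_mul_inv g))
    (LinearMap.ext fun v => congrArg (fun T : CEnd N => T v) (matEnd_inv_mul g))
  have hγ : ∀ v, γ v = matEnd (g : Matrix N N ℂ) v := fun v => rfl
  let c : (N × Fin 2 → ℝ) ≃ₗ[ℝ] (N → ℂ) :=
    (LinearEquiv.curry ℝ ℝ N (Fin 2)).trans
      (LinearEquiv.piCongrRight fun _ => Complex.basisOneI.equivFun.symm)
  have hc : ∀ a i, c a i = (a (i, 0) : ℂ) + a (i, 1) * Complex.I := by
    intro a i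
    change Complex.basisOneI.equivFun.symm (fun k => a (i, k)) = _
    rw [Complex.basisOneI.equivFun_symm_apply]
    simp
  -- in the frame, `β_S` is the diagonal form with entries `s i` on `ℂᴺ`
  have hβ : ∀ z : N → ℂ, betaForm j S (φ (γ z)) (φ (γ z)) = ∑ i, s i * Complex.normSq (z i) := by
    intro z
    have h₁ : conjEnd g S₀ (Complex.I • matEnd (g : Matrix N N ℂ) z) =
        matEnd (g : Matrix N N ℂ) (S₀ (Complex.I • z)) := by
      have e := (conjEnd_eq_iff (g := g) (S := S₀) (T := conjEnd g S₀)).1 rfl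
      have e' : Complex.I • matEnd (g : Matrix N N ℂ) z =
          matEnd (g : Matrix N N ℂ) (Complex.I • z) :=
        congrArg (fun S : CEnd N => S z) (commute_mulI_matEnd (g : Matrix N N ℂ)).eq
      rw [e']
      exact (congrArg (fun S : CEnd N => S (Complex.I • z)) e).symm
    change extPairing (S (JEll j 1 x (φ (γ z)))) (φ (γ z)) = _
    rw [hγ, ← hφ.1, hS, frameConj_apply, h₁, extPairing_of_isAdapted hd hφ, stdRe_apply, hg,
      stdForm, Complex.re_sum]
    refine Finset.sum_congr rfl fun i _ => ?_
    have h₂ : S₀ (Complex.I • z) i = s i * starRingEnd ℂ (z i) := by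
      change ((Matrix.diagonal fun i => (s i : ℂ) * Complex.I) *ᵥ star (Complex.I • z)) i = _
      rw [Matrix.mulVec_diagonal]
      simp only [Pi.star_apply, Pi.smul_apply, smul_eq_mul, star_mul', RCLike.star_def,
        Complex.conj_I]
      linear_combination (-(s i : ℂ) * starRingEnd ℂ (z i)) * Complex.I_mul_I
    rw [RingHom.id_apply, h₂, hε, one_mul, mul_assoc, ← Complex.normSq_eq_conj_mul_self,
      ← Complex.ofReal_mul, Complex.ofReal_re]
  let w : N × Fin 2 → ℝ := fun p => s p.1
  have hequiv : QuadraticMap.Equivalent (LinearMap.BilinMap.toQuadraticMap (betaForm j S))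
      (QuadraticMap.weightedSumSquares ℝ w) := by
    refine QuadraticMap.Equivalent.symm ⟨⟨(c.trans γ).trans φ.toLinearEquiv, fun a => ?_⟩⟩
    change betaForm j S (φ (γ (c a))) (φ (γ (c a))) = _
    rw [hβ, QuadraticMap.weightedSumSquares_apply, Fintype.sum_prod_type]
    refine Finset.sum_congr rfl fun i _ => ?_
    rw [hc, Complex.normSq_add_mul_I, Fin.sum_univ_two]
    simp only [w, smul_eq_mul]
    ring
  have hcard : ∀ p : ℝ → Prop, {i : N × Fin 2 | p (w i)}.ncard = 2 * {i | p (s i)}.ncard := by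
    intro p
    have : {i : N × Fin 2 | p (w i)} = {i | p (s i)} ×ˢ (Set.univ : Set (Fin 2)) := by
      ext i
      simp [w]
    rw [this, Set.ncard_prod, Set.ncard_univ, Nat.card_fin, mul_comm]
  have hpos : {i : N | 0 < s i} = {i | s i = 1} := by
    ext i
    rcases hs i with h | h <;> simp [h]
    norm_num
  have hneg : {i : N | s i < 0} = {i | s i = 1}ᶜ := by
    ext i
    rcases hs i with h | h <;> simp [h]
    norm_num
  have hcompl := Set.ncard_add_ncard_compl {i : N | s i = 1}
  rw [Nat.card_eq_fintype_card, hN] at hcompl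
  rw [HasBetaSignature, QuadraticForm.sigPos_of_equiv_weightedSumSquares hequiv,
    QuadraticForm.sigNeg_of_equiv_weightedSumSquares hequiv, hcard (fun t => 0 < t),
    hcard (fun t => t < 0), hpos, hneg]
  omega

end Adapted

/-! ### The four bundles -/

section Bundles

theorem isStdData_symmetric (N : Type*) : IsStdData (RingHom.id ℂ) (fun _ : N => 1) :=
  ⟨fun _ => rfl, fun _ => rfl, fun _ => Or.inl rfl⟩

/-- The signs of the standard Hermitian form of signature `(m, m)`. -/
def splitSign (m : ℕ) : Fin m ⊕ Fin m → ℂ := Sum.elim (fun _ => 1) fun _ => -1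

theorem isStdData_hermitian (m : ℕ) : IsStdData (starRingEnd ℂ) (splitSign m) :=
  ⟨Complex.conj_conj, Complex.conj_ofReal, by rintro (i | i) <;> simp [splitSign]⟩

theorem dotProduct_eq_stdForm {N : Type*} [Fintype N] :
    (fun z w : N → ℂ => z ⬝ᵥ w) = stdForm (RingHom.id ℂ) fun _ => 1 := by
  funext z w
  simp [stdForm, dotProduct]

theorem hermitian_eq_stdForm (m : ℕ) :
    (fun z w : Fin m ⊕ Fin m → ℂ => star z ⬝ᵥ (signMatrix ℂ m m *ᵥ w)) =
      stdForm (starRingEnd ℂ) (splitSign m) := by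
  funext z w
  rw [stdForm_eq_dotProduct]
  rfl

theorem mem_complexO_iff {n : ℕ} (g : (Matrix (Fin n) (Fin n) ℂ)ˣ) : g ∈ complexO n ↔
    ((g : Matrix (Fin n) (Fin n) ℂ).map (RingHom.id ℂ))ᵀ * Matrix.diagonal (fun _ => 1) *
      (g : Matrix (Fin n) (Fin n) ℂ) = Matrix.diagonal fun _ => 1 := by
  have : (g : Matrix (Fin n) (Fin n) ℂ).map (RingHom.id ℂ) = g := by ext; rfl
  rw [this, Matrix.diagonal_one, Matrix.mul_one]
  rfl

theorem mem_complexU_iff {m : ℕ} (g : (Matrix (Fin m ⊕ Fin m) (Fin m ⊕ Fin m) ℂ)ˣ) :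
    g ∈ complexU m m ↔ ((g : Matrix (Fin m ⊕ Fin m) (Fin m ⊕ Fin m) ℂ).map (starRingEnd ℂ))ᵀ *
      Matrix.diagonal (splitSign m) * (g : Matrix (Fin m ⊕ Fin m) (Fin m ⊕ Fin m) ℂ) =
        Matrix.diagonal (splitSign m) := Iff.rfl

section Orbit

variable {N : Type*} [Fintype N] [DecidableEq N] {κ : ℂ →+* ℂ} {ε : N → ℂ}

theorem conjEnd_mem_skewRoots_of_preserves {hd : IsStdData κ ε} {lam : ℤˣ} {S : CEnd N}
    (hS : S ∈ skewRoots (stdRe κ ε hd) (mulI N) lam) {g : (Matrix N N ℂ)ˣ}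
    (hg : ∀ u v, stdForm κ ε (matEnd (g : Matrix N N ℂ) u) (matEnd (g : Matrix N N ℂ) v) =
      stdForm κ ε u v) : conjEnd g S ∈ skewRoots (stdRe κ ε hd) (mulI N) lam :=
  conj_mem_skewRoots hS (matEnd_mul_inv g) (matEnd_inv_mul g)
    ((stdRe_matEnd_iff hd _).2 hg) (commute_mulI_matEnd _)

theorem stdForm_preserves_iff (A : Matrix N N ℂ) :
    (∀ u v, stdForm κ ε (matEnd A u) (matEnd A v) = stdForm κ ε u v) ↔
      (A.map κ)ᵀ * Matrix.diagonal ε * A = Matrix.diagonal ε := by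
  simpa using stdForm_matEnd_iff (κ := κ) (ε := ε) A 1

variable {m : ℕ} {M : Type*} [TopologicalSpace M] [ChartedSpace (RModel m) M]
  [IsManifold 𝓘(ℝ, RModel m) ∞ M] {j : ∀ x : M, TSpace m M x →L[ℝ] TSpace m M x} {ell : ℤˣ}

/-- A family of subsets of the fibres of `End (𝕋M)` that every adapted frame identifies with the
orbit of one antilinear map is a bundle with the expected fibre. -/
theorem isBundleWithFibre_of_orbit (hj : IsComplexStructure j) (hd : IsStdData κ ε)
    {G : Subgroup (Matrix N N ℂ)ˣ} (hG : ∀ g : (Matrix N N ℂ)ˣ, g ∈ G ↔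
      ((g : Matrix N N ℂ).map κ)ᵀ * Matrix.diagonal ε * (g : Matrix N N ℂ) = Matrix.diagonal ε)
    {lam : ℤˣ} {S₀ : CEnd N} (hS₀ : S₀ ∈ skewRoots (stdRe κ ε hd) (mulI N) lam)
    {H : Type*} [Group H] [TopologicalSpace H]
    (hι : ∃ ι : H →* G, IsClosedEmbedding ι ∧
      ∀ g : G, g ∈ ι.range ↔ conjEnd (g : (Matrix N N ℂ)ˣ) S₀ = S₀)
    {σ : ∀ x : M, Set (ExtEnd m M x)}
    (hex : ∀ x : M, ∃ φ : (N → ℂ) ≃L[ℝ] ExtTangent m M x, IsAdapted j ell (stdForm κ ε) φ)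
    (hσ : ∀ (x : M) (φ : (N → ℂ) ≃L[ℝ] ExtTangent m M x), IsAdapted j ell (stdForm κ ε) φ →
      ∀ S, S ∈ σ x ↔ ∃ g : (Matrix N N ℂ)ˣ,
        (∀ u v, stdForm κ ε (matEnd (g : Matrix N N ℂ) u) (matEnd (g : Matrix N N ℂ) v) =
          stdForm κ ε u v) ∧ frameConj φ (conjEnd g S₀) = S) :
    IsBundleWithFibre j ell (stdForm κ ε) G H σ := by
  obtain ⟨ι, hιe, hιr⟩ := hι
  have hG' : ∀ g : (Matrix N N ℂ)ˣ, g ∈ G ↔ ∀ u v, stdForm κ ε (matEnd (g : Matrix N N ℂ) u)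
      (matEnd (g : Matrix N N ℂ) v) = stdForm κ ε u v := fun g =>
    (hG g).trans (stdForm_preserves_iff _).symm
  have hK : IsIsotropyOf G ι.range (stdRe κ ε hd) lam S₀ :=
    ⟨fun g => (hG' g).trans (stdRe_matEnd_iff hd _).symm, hS₀, hιr⟩
  obtain ⟨d, F, hF⟩ := exists_isHomogeneousManifold hK
  refine ⟨ι, hιe, ⟨d, embeddedChartedSpace F (isEmbedding_orbitMap hK), hF,
    isSmoothFibreBundle_of_orbit hj.smooth hj.sq hK F hex fun x φ hφ S => ?_⟩, fun x => ?_⟩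
  · rw [hσ x φ hφ]
    constructor
    · rintro ⟨g, hg, rfl⟩
      exact ⟨((⟨g, (hG' g).2 hg⟩ : G) : G ⧸ ι.range), rfl⟩
    · rintro ⟨y, rfl⟩
      obtain ⟨g, rfl⟩ := QuotientGroup.mk_surjective y
      exact ⟨g, (hG' g).1 g.2, rfl⟩
  · obtain ⟨φ, hφ⟩ := hex x
    refine ⟨φ, hφ, frameConj φ S₀, (hσ x φ hφ _).2 ⟨1, fun u v => ?_, by rw [conjEnd_one]⟩,
      fun S => ?_, fun g => ?_⟩
    · rw [Units.val_one, map_one]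
      rfl
    · rw [hσ x φ hφ]
      constructor
      · rintro ⟨g, hg, rfl⟩
        exact ⟨⟨g, (hG' g).2 hg⟩, (conjBy_frameConj φ g S₀).symm⟩
      · rintro ⟨g, rfl⟩
        exact ⟨g, (hG' g).1 g.2, (conjBy_frameConj φ g S₀).symm⟩
    · rw [conjBy_frameConj, (frameConj_injective φ).eq_iff, hιr]

omit [IsManifold 𝓘(ℝ, RModel m) ∞ M] in
/-- If the automorphisms of the form act transitively on the skew roots, adapted frames identify the
fibres of the bundle with one orbit. -/
theorem mem_slashFibre_iff_orbit {hd : IsStdData κ ε} {lam : ℤˣ} {S₀ : CEnd N}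
    (hS₀ : S₀ ∈ skewRoots (stdRe κ ε hd) (mulI N) lam)
    (htr : ∀ T ∈ skewRoots (stdRe κ ε hd) (mulI N) lam, ∃ g : (Matrix N N ℂ)ˣ,
      (∀ u v, stdForm κ ε (matEnd (g : Matrix N N ℂ) u) (matEnd (g : Matrix N N ℂ) v) =
        stdForm κ ε u v) ∧ conjEnd g S₀ = T) (x : M) (φ : (N → ℂ) ≃L[ℝ] ExtTangent m M x)
    (hφ : IsAdapted j ell (stdForm κ ε) φ) (S : ExtEnd m M x) :
    S ∈ slashFibre j lam ell x ↔ ∃ g : (Matrix N N ℂ)ˣ,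
        (∀ u v, stdForm κ ε (matEnd (g : Matrix N N ℂ) u) (matEnd (g : Matrix N N ℂ) v) =
          stdForm κ ε u v) ∧ frameConj φ (conjEnd g S₀) = S := by
  rw [mem_slashFibre_iff hd hφ]
  constructor
  · rintro ⟨T, hT, rfl⟩
    obtain ⟨g, hg, rfl⟩ := htr T hT
    exact ⟨g, hg, rfl⟩
  · rintro ⟨g, hg, rfl⟩
    exact ⟨_, conjEnd_mem_skewRoots_of_preserves hS₀ hg, rfl⟩

theorem pairMatrix_mem_skewRoots (hd : IsStdData κ ε) {n : Type*} [Fintype n] [DecidableEq n]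
    (e : N ≃ n ⊕ n) {lam : ℤˣ}
    (hε : ∀ i, ε (e.symm (Sum.inr i)) = -((lam : ℤ) : ℂ) * ε (e.symm (Sum.inl i))) :
    matEnd (pairMatrix e lam) * starEnd N ∈ skewRoots (stdRe κ ε hd) (mulI N) lam := by
  have hmap : ∀ τ : ℂ →+* ℂ, (pairMatrix e lam).map τ = pairMatrix e lam := by
    intro τ
    rw [pairMatrix, ← Matrix.submatrix_map, Matrix.fromBlocks_map]
    congr 2 <;> ext i k <;> simp [Matrix.one_apply, apply_ite τ]
  have hdiag : Matrix.diagonal ε = (Matrix.fromBlocks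
      (Matrix.diagonal fun i => ε (e.symm (Sum.inl i))) 0 0
      (Matrix.diagonal fun i => ε (e.symm (Sum.inr i)))).submatrix e e := by
    rw [Matrix.fromBlocks_diagonal, Matrix.submatrix_diagonal_equiv]
    congr 1
    funext i
    obtain ⟨i, rfl⟩ := e.symm.surjective i
    rcases i with i | i <;> simp
  have hone : (1 : Matrix N N ℂ) = (Matrix.fromBlocks (1 : Matrix n n ℂ) 0 0 1).submatrix e e := by
    rw [Matrix.fromBlocks_one, Matrix.submatrix_one_equiv]
  have hsmul : ∀ (c : ℂ) (X : Matrix (n ⊕ n) (n ⊕ n) ℂ),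
      c • X.submatrix e e = (c • X).submatrix e e := fun _ _ => rfl
  refine matEnd_mul_starEnd_mem hd ?_ ?_
  · rw [hmap, pairMatrix, Matrix.submatrix_mul_equiv, Matrix.fromBlocks_multiply, hone,
      hsmul, Matrix.fromBlocks_smul]
    congr 2 <;> simp
  · rw [hmap, hdiag, pairMatrix, Matrix.transpose_submatrix, Matrix.submatrix_mul_equiv,
      Matrix.submatrix_mul_equiv, Matrix.fromBlocks_transpose, Matrix.fromBlocks_multiply,
      Matrix.fromBlocks_multiply, hsmul, Matrix.fromBlocks_smul]
    congr 2
    · ext i k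
      by_cases h : i = k
      · subst h; simp [hε]
      · simp [h]
    · simp
    · simp
    · ext i k
      by_cases h : i = k
      · subst h
        simp only [hε, Matrix.transpose_zero, Matrix.zero_mul, Matrix.mul_zero, add_zero,
          Matrix.transpose_smul, Matrix.transpose_one, Matrix.smul_mul, Matrix.one_mul,
          Matrix.mul_smul, Matrix.mul_one, Matrix.smul_apply, Matrix.diagonal_apply_eq,
          smul_eq_mul, Matrix.add_apply, Matrix.zero_apply]
        ring
      · simp [h]

end Orbit

/-- Two families of signs with the same number of entries `1` differ by a permutation. -/
theorem exists_perm_signs {N : Type*} [Finite N] {s s' : N → ℝ} (hs : ∀ i, s i = 1 ∨ s i = -1)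
    (hs' : ∀ i, s' i = 1 ∨ s' i = -1) (h : {i | s i = 1}.ncard = {i | s' i = 1}.ncard) :
    ∃ τ : Equiv.Perm N, ∀ i, s' (τ i) = s i := by
  classical
  have := Fintype.ofFinite N
  obtain ⟨e⟩ : Nonempty ({i // s i = 1} ≃ {i // s' i = 1}) := Finite.card_eq.1 h
  refine ⟨e.extendSubtype, fun i => ?_⟩
  by_cases hi : s i = 1
  · rw [hi]
    exact e.extendSubtype_mem i hi
  · rw [(hs i).resolve_left hi]
    exact (hs' _).resolve_left (e.extendSubtype_not_mem i hi)

variable {m : ℕ} {M : Type*} [TopologicalSpace M] [ChartedSpace (RModel m) M]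
  [IsManifold 𝓘(ℝ, RModel m) ∞ M] {j : ∀ x : M, TSpace m M x →L[ℝ] TSpace m M x}

section Signature

/-- The signs on `N ≃ A ⊕ B` that are `1` on `A` and `-1` on `B`. -/
def prefixSign {N A B : Type*} (e : N ≃ A ⊕ B) (i : N) : ℝ :=
  Sum.elim (fun _ => 1) (fun _ => -1) (e i)

theorem prefixSign_eq {N A B : Type*} (e : N ≃ A ⊕ B) (i : N) :
    prefixSign e i = 1 ∨ prefixSign e i = -1 := by
  unfold prefixSign
  rcases e i with k | k <;> simp

theorem ncard_prefixSign {N A B : Type*} [Finite A] (e : N ≃ A ⊕ B) :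
    {i | prefixSign e i = 1}.ncard = Nat.card A := by
  have : {i | prefixSign e i = 1} = (e.symm ∘ Sum.inl) '' Set.univ := by
    ext i
    obtain ⟨i, rfl⟩ := e.symm.surjective i
    rcases i with i | i
    · simp [prefixSign]
    · simp [prefixSign]
      norm_num
  rw [this, Set.ncard_image_of_injective _ (e.symm.injective.comp Sum.inl_injective),
    Set.ncard_univ]

variable {N A B : Type*} [Fintype N] [DecidableEq N]

theorem diagonal_mem_skewRoots {s : N → ℝ} (hs : ∀ i, s i = 1 ∨ s i = -1) :
    matEnd (Matrix.diagonal fun i => (s i : ℂ) * Complex.I) * starEnd N ∈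
      skewRoots (stdRe (RingHom.id ℂ) (fun _ => 1) (isStdData_symmetric N)) (mulI N) 1 := by
  have hs2 : ∀ i, (s i : ℂ) * s i = 1 := fun i => by rcases hs i with h | h <;> simp [h]
  refine matEnd_mul_starEnd_mem _ ?_ ?_
  · rw [Matrix.diagonal_map (map_zero _), Matrix.diagonal_mul_diagonal, Units.val_one,
      Int.cast_one, one_smul, ← Matrix.diagonal_one]
    congr 1
    funext i
    rw [map_mul, Complex.conj_ofReal, Complex.conj_I]
    linear_combination -(s i : ℂ) * s i * Complex.I_mul_I + hs2 i
  · rw [Matrix.diagonal_map (map_zero _), Matrix.diagonal_transpose, Matrix.diagonal_mul_diagonal,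
      Matrix.diagonal_mul_diagonal, Units.val_one, Int.cast_one, ← Matrix.diagonal_smul]
    congr 1
    funext i
    simp only [RingHom.id_apply, Pi.smul_apply, smul_eq_mul]
    linear_combination (s i : ℂ) * s i * Complex.I_mul_I - hs2 i

variable [Fintype A] [DecidableEq A] [Fintype B] [DecidableEq B]

/-- The isotropy subgroup of a diagonal antilinear map with entries `±i`: conjugation by `diag (1 ±
i)` identifies it with a real pseudo-orthogonal group. -/
theorem exists_isotropy_diagonal (e : N ≃ A ⊕ B) {G : Subgroup (Matrix N N ℂ)ˣ}
    (hG : ∀ g : (Matrix N N ℂ)ˣ, g ∈ G ↔ ((g : Matrix N N ℂ).map (RingHom.id ℂ))ᵀ *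
      Matrix.diagonal (fun _ => 1) * (g : Matrix N N ℂ) = Matrix.diagonal fun _ => 1) :
    ∃ ι : formGroup (Matrix.diagonal (Sum.elim (fun _ => 1) fun _ => -1) :
        Matrix (A ⊕ B) (A ⊕ B) ℝ) →* G, IsClosedEmbedding ι ∧
      ∀ g : G, g ∈ ι.range ↔ conjEnd (g : (Matrix N N ℂ)ˣ)
        (matEnd (Matrix.diagonal fun i => (prefixSign e i : ℂ) * Complex.I) * starEnd N) =
        matEnd (Matrix.diagonal fun i => (prefixSign e i : ℂ) * Complex.I) * starEnd N := by
  let t : A ⊕ B → ℝ := Sum.elim (fun _ => 1) fun _ => -1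
  have ht : ∀ k, (t k : ℂ) * t k = 1 := by rintro (k | k) <;> simp [t]
  have hD : (Matrix.diagonal fun i => (prefixSign e i : ℂ) * Complex.I) =
      (Matrix.diagonal fun k => (t k : ℂ) * Complex.I).submatrix e e := by
    rw [Matrix.submatrix_diagonal_equiv]
    rfl
  -- `1 ± i` is fixed by `z ↦ ±i conj z`, and `(1 ± i)² = ±2i`
  refine exists_real_isotropy (isStdData_symmetric N) hG _
    (C := (Matrix.diagonal fun k => 1 + t k * Complex.I).submatrix e (Equiv.refl _))
    (C' := (Matrix.diagonal fun k => (1 - t k * Complex.I) / 2).submatrix (Equiv.refl _) e)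
    (c := 2 * Complex.I) (by simp) ?_ ?_ ?_ ?_
  · rw [Matrix.submatrix_mul_equiv, Matrix.diagonal_mul_diagonal, Matrix.submatrix_diagonal_equiv,
      ← Matrix.diagonal_one]
    congr 1
    funext i
    simp only [Function.comp_apply]
    linear_combination (1 / 2) * ht (e i) - (t (e i) : ℂ) * t (e i) / 2 * Complex.I_mul_I
  · rw [Matrix.submatrix_mul_equiv, Matrix.diagonal_mul_diagonal, Matrix.submatrix_diagonal_equiv,
      ← Matrix.diagonal_one]
    congr 1
    funext i
    simp only [Function.comp_apply, Equiv.refl_apply]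
    linear_combination (1 / 2) * ht i - (t i : ℂ) * t i / 2 * Complex.I_mul_I
  · rw [hD, ← Matrix.submatrix_map, Matrix.submatrix_mul_equiv, Matrix.diagonal_map (map_zero _),
      Matrix.diagonal_mul_diagonal]
    congr 2
    funext i
    simp only [map_add, map_one, map_mul, Complex.conj_ofReal, Complex.conj_I]
    linear_combination ht i - (t i : ℂ) * t i * Complex.I_mul_I
  · rw [Matrix.diagonal_one, Matrix.mul_one, ← Matrix.submatrix_map, Matrix.transpose_submatrix,
      Matrix.submatrix_mul_equiv, Matrix.diagonal_map (map_zero _), Matrix.diagonal_transpose,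
      Matrix.diagonal_mul_diagonal, Matrix.diagonal_map (map_zero _), ← Matrix.diagonal_smul,
      Matrix.submatrix_diagonal_equiv]
    congr 1
    funext i
    simp only [Function.comp_apply, Equiv.refl_apply, RingHom.id_apply, Pi.smul_apply, smul_eq_mul]
    change _ = 2 * Complex.I * (t i : ℂ)
    linear_combination (t i : ℂ) * t i * Complex.I_mul_I - ht i

theorem isBundleWithFibre_signature (hj : IsComplexStructure j) {n : ℕ} (hn : n ≤ 2 * m) :
    IsBundleWithFibre j 1 (fun z w : Fin (2 * m) → ℂ => z ⬝ᵥ w)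
      (complexO (2 * m)) (realO n (2 * m - n)) (slashFibreSig j n) := by
  let e : Fin (2 * m) ≃ Fin n ⊕ Fin (2 * m - n) :=
    (finCongr (by omega)).trans finSumFinEquiv.symm
  let e' : Fin (2 * m) ≃ Fin m ⊕ Fin m := (finCongr (by omega)).trans finSumFinEquiv.symm
  have hd := isStdData_symmetric (Fin (2 * m))
  have hncard : {i | prefixSign e i = 1}.ncard = n := by rw [ncard_prefixSign, Nat.card_fin]
  rw [dotProduct_eq_stdForm]
  refine isBundleWithFibre_of_orbit hj hd mem_complexO_iff
    (diagonal_mem_skewRoots (prefixSign_eq e)) (exists_isotropy_diagonal e mem_complexO_iff)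
    (exists_isAdapted_symmetric hd e' hj.sq) fun x φ hφ S => ?_
  constructor
  · rintro ⟨hS, hsig⟩
    obtain ⟨T, hT, rfl⟩ := (mem_slashFibre_iff hd hφ 1 S).1 hS
    obtain ⟨f, w, hw, hTf, h₁, h₂⟩ := exists_diagonal_frame hT
    have hw' : ∀ i, ∃ s : ℝ, (s = 1 ∨ s = -1) ∧ w i = s * Complex.I := by
      intro i
      have : w i * w i = Complex.I * Complex.I := by rw [hw, Complex.I_mul_I]
      rcases mul_self_eq_mul_self_iff.1 this with h | h
      · exact ⟨1, Or.inl rfl, by simp [h]⟩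
      · exact ⟨-1, Or.inr rfl, by simp [h]⟩
    choose s hs hws using hw'
    -- the signature fixes the number of entries `i`, and permuting the frame changes their order
    have key : ∀ τ : Equiv.Perm (Fin (2 * m)), ∃ g : (Matrix (Fin (2 * m)) (Fin (2 * m)) ℂ)ˣ,
        (∀ u v, stdForm (RingHom.id ℂ) (fun _ => 1)
          (matEnd (g : Matrix (Fin (2 * m)) (Fin (2 * m)) ℂ) u)
          (matEnd (g : Matrix (Fin (2 * m)) (Fin (2 * m)) ℂ) v) =
            stdForm (RingHom.id ℂ) (fun _ => 1) u v) ∧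
        conjEnd g (matEnd (Matrix.diagonal fun i => (s (τ i) : ℂ) * Complex.I) * starEnd _) =
          T := by
      intro τ
      refine exists_conjEnd_eq hT (f := fun i => f (τ i)) (fun i k => ?_) fun i => ?_
      · split_ifs with h
        · rw [h, h₁]
        · exact h₂ _ _ fun h' => h (τ.injective h')
      · rw [Finset.sum_eq_single i, Matrix.diagonal_apply_eq, hTf, hws]
        · intro k _ hk
          rw [Matrix.diagonal_apply_ne _ hk, zero_smul]
        · simp
    obtain ⟨g, hg, hgT⟩ := key 1
    rw [← hgT] at hsig
    have hcard := (hasBetaSignature_iff (hd := hd) (by simp) hφ (fun _ => rfl) hg hs n).1 hsig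
    obtain ⟨τ, hτ⟩ := exists_perm_signs (prefixSign_eq e) hs (hncard.trans hcard.symm)
    obtain ⟨g', hg', hgT'⟩ := key τ
    simp only [hτ] at hgT'
    exact ⟨g', hg', by rw [hgT']⟩
  · rintro ⟨g, hg, rfl⟩
    exact ⟨(mem_slashFibre_iff hd hφ 1 _).2 ⟨_, conjEnd_mem_skewRoots_of_preserves
      (diagonal_mem_skewRoots (prefixSign_eq e)) hg, rfl⟩,
      (hasBetaSignature_iff (hd := hd) (by simp) hφ (fun _ => rfl) hg (prefixSign_eq e) n).2 hncard⟩

end Signature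

/-- The isotropy subgroup of the antilinear map with matrix the exchange of the two halves, in the
split unitary group: the real symplectic group, via the basis `(x, x)`, `(i x, -i x)` of the fixed
points. -/
theorem exists_isotropy_exchange (m : ℕ) :
    ∃ ι : realSp m →* complexU m m, IsClosedEmbedding ι ∧
      ∀ g : complexU m m, g ∈ ι.range ↔
        conjEnd (g : (Matrix (Fin m ⊕ Fin m) (Fin m ⊕ Fin m) ℂ)ˣ)
          (matEnd (pairMatrix (Equiv.refl (Fin m ⊕ Fin m)) 1) * starEnd _) =
        matEnd (pairMatrix (Equiv.refl (Fin m ⊕ Fin m)) 1) * starEnd _ := by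
  have hdiag : Matrix.diagonal (splitSign m) =
      Matrix.fromBlocks (1 : Matrix (Fin m) (Fin m) ℂ) 0 0 (-1) := by
    rw [← Matrix.diagonal_one, Matrix.diagonal_neg, Matrix.fromBlocks_diagonal]
    rfl
  have hconj : ∀ c : ℂ, (c • (1 : Matrix (Fin m) (Fin m) ℂ)).map (starRingEnd ℂ) =
      starRingEnd ℂ c • 1 := by
    intro c
    ext i k
    simp [Matrix.one_apply, apply_ite (starRingEnd ℂ)]
  -- the Hermitian form is imaginary on the fixed points `(z, conj z)`, and is `-2i` times the
  -- symplectic form in the real basis given by the columns of `C`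
  refine exists_real_isotropy (isStdData_hermitian m) mem_complexU_iff _
    (C := Matrix.fromBlocks ((1 : ℂ) • 1) (Complex.I • 1) ((1 : ℂ) • 1) ((-Complex.I) • 1))
    (C' := Matrix.fromBlocks ((1 / 2 : ℂ) • 1) ((1 / 2 : ℂ) • 1) ((-Complex.I / 2) • 1)
      ((Complex.I / 2) • 1)) (c := -2 * Complex.I) (by simp) ?_ ?_ ?_ ?_
  · rw [Matrix.fromBlocks_multiply, ← Matrix.fromBlocks_one]
    simp only [Matrix.smul_mul, Matrix.mul_smul, Matrix.one_mul, smul_smul, ← add_smul]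
    congr 1
    · rw [← one_smul ℂ (1 : Matrix (Fin m) (Fin m) ℂ), smul_smul]
      congr 1
      linear_combination (-1 / 2) * Complex.I_mul_I
    · rw [← zero_smul ℂ (1 : Matrix (Fin m) (Fin m) ℂ)]
      congr 1
      linear_combination (1 / 2) * Complex.I_mul_I
    · rw [← zero_smul ℂ (1 : Matrix (Fin m) (Fin m) ℂ)]
      congr 1
      linear_combination (1 / 2) * Complex.I_mul_I
    · rw [← one_smul ℂ (1 : Matrix (Fin m) (Fin m) ℂ), smul_smul]
      congr 1
      linear_combination (-1 / 2) * Complex.I_mul_I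
  · rw [Matrix.fromBlocks_multiply, ← Matrix.fromBlocks_one]
    simp only [Matrix.smul_mul, Matrix.mul_smul, Matrix.one_mul, smul_smul, ← add_smul]
    congr 1
    · rw [← one_smul ℂ (1 : Matrix (Fin m) (Fin m) ℂ), smul_smul]
      congr 1
      ring
    · rw [← zero_smul ℂ (1 : Matrix (Fin m) (Fin m) ℂ)]
      congr 1
      ring
    · rw [← zero_smul ℂ (1 : Matrix (Fin m) (Fin m) ℂ)]
      congr 1
      ring
    · rw [← one_smul ℂ (1 : Matrix (Fin m) (Fin m) ℂ), smul_smul]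
      congr 1
      linear_combination -Complex.I_mul_I
  · rw [pairMatrix, Equiv.coe_refl, Matrix.submatrix_id_id, Matrix.fromBlocks_map, hconj, hconj,
      hconj, Matrix.fromBlocks_multiply]
    simp
  · rw [hdiag, Matrix.fromBlocks_map, hconj, hconj, hconj, Matrix.fromBlocks_transpose,
      Matrix.fromBlocks_multiply, Matrix.fromBlocks_multiply, Matrix.J, Matrix.fromBlocks_map,
      Matrix.fromBlocks_smul]
    congr 1 <;> ext i k <;> by_cases h : i = k <;> simp [h, two_mul]

theorem isBundleWithFibre_one_neg (hj : IsComplexStructure j) : IsBundleWithFibre j (-1)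
    (fun z w : Fin m ⊕ Fin m → ℂ => star z ⬝ᵥ (signMatrix ℂ m m *ᵥ w))
    (complexU m m) (realSp m) (slashFibre j 1 (-1)) := by
  have hd := isStdData_hermitian m
  have hε : ∀ i, splitSign m ((Equiv.refl _).symm (Sum.inr i)) =
      -(((1 : ℤˣ) : ℤ) : ℂ) * splitSign m ((Equiv.refl _).symm (Sum.inl i)) := by
    intro i
    simp [splitSign]
  have hS₀ := pairMatrix_mem_skewRoots hd (Equiv.refl (Fin m ⊕ Fin m)) hε
  rw [hermitian_eq_stdForm]
  refine isBundleWithFibre_of_orbit hj hd mem_complexU_iff hS₀ (exists_isotropy_exchange m)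
    (exists_isAdapted_hermitian rfl hd hj.sq) (mem_slashFibre_iff_orbit hS₀ fun T hT => ?_)
  obtain ⟨ι, hι, v, h₁, h₂, h₃, h₄⟩ := exists_pair_frame_hermitian_one hT
  have hcard : Fintype.card (Fin m) = Fintype.card ι := by
    rw [Fintype.card_sum] at h₄
    omega
  let τ := Fintype.equivOfCardEq hcard
  exact exists_conjEnd_pairMatrix hT _ (v := fun i => v (τ i)) (fun i => (h₁ _).trans rfl) hε
    (fun i k => h₂ _ _) fun i k h => h₃ _ _ fun h' => h (τ.injective h')

theorem isBundleWithFibre_neg_one (hj : IsComplexStructure j) :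
    IsBundleWithFibre j 1 (fun z w : Fin (2 * m) → ℂ => z ⬝ᵥ w)
      (complexO (2 * m)) (quaternionSOStar m) (slashFibre j (-1) 1) := by
  let e : Fin (2 * m) ≃ Fin m ⊕ Fin m := (finCongr (by omega)).trans finSumFinEquiv.symm
  have hd := isStdData_symmetric (Fin (2 * m))
  have hε : ∀ i : Fin m, (fun _ : Fin (2 * m) => (1 : ℂ)) (e.symm (Sum.inr i)) =
      -(((-1 : ℤˣ) : ℤ) : ℂ) * (fun _ : Fin (2 * m) => (1 : ℂ)) (e.symm (Sum.inl i)) := by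
    intro i
    simp
  have hS₀ := pairMatrix_mem_skewRoots hd e hε
  rw [dotProduct_eq_stdForm]
  refine isBundleWithFibre_of_orbit hj hd mem_complexO_iff hS₀
    (exists_quaternionic_isotropy_symmetric e mem_complexO_iff)
    (exists_isAdapted_symmetric hd e hj.sq) (mem_slashFibre_iff_orbit hS₀ fun T hT => ?_)
  obtain ⟨ι, hι, v, h₁, h₂, h₃, h₄⟩ := exists_pair_frame_symmetric_neg hT
  have hcard : Fintype.card (Fin m) = Fintype.card ι := by
    rw [Fintype.card_fin] at h₄ ⊢
    omega
  let τ := Fintype.equivOfCardEq hcard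
  exact exists_conjEnd_pairMatrix hT e (v := fun i => v (τ i)) (fun i => h₁ _) hε
    (fun i k => h₂ _ _) fun i k h => h₃ _ _ fun h' => h (τ.injective h')

/-- A quaternionic structure `T` compatible with a Hermitian form of signature `(m, m)` maps a
positive vector to a positive one, a negative vector to a negative one, so that the blocks
`(v, T v)` of each sign fill half of the space. -/
theorem exists_signed_pair_frame {T : CEnd (Fin m ⊕ Fin m)}
    (hd : IsStdData (starRingEnd ℂ) (splitSign m))
    (hT : T ∈ skewRoots (stdRe (starRingEnd ℂ) (splitSign m) hd) (mulI _) (-1)) :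
    ∃ (k : ℕ) (v : Fin k ⊕ Fin k → Fin m ⊕ Fin m → ℂ), m = 2 * k ∧
      (∀ i, stdForm (starRingEnd ℂ) (splitSign m) (v i) (v i) =
        Sum.elim (fun _ => 1) (fun _ => -1) i) ∧
      (∀ i l, stdForm (starRingEnd ℂ) (splitSign m) (v i) (T (v l)) = 0) ∧
      ∀ i l, i ≠ l → stdForm (starRingEnd ℂ) (splitSign m) (v i) (v l) = 0 := by
  classical
  obtain ⟨ι, hι, v, h₁, h₂, h₃, h₄⟩ := exists_pair_frame_hermitian_neg hT
  rw [Fintype.card_sum, Fintype.card_fin] at h₄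
  have hcard : ∀ (δ : ℂ) (s : Finset (Fin m ⊕ Fin m)), δ ≠ 0 → (∀ i ∉ s, splitSign m i = -δ) →
      2 * Fintype.card {i // stdForm (starRingEnd ℂ) (splitSign m) (v i) (v i) = δ} ≤ s.card := by
    intro δ s hδ hs
    have h := card_le_of_orthonormal hδ (ε := splitSign m)
      (f := fun p : {i // stdForm (starRingEnd ℂ) (splitSign m) (v i) (v i) = δ} × Bool =>
        if p.2 then T (v p.1) else v p.1) ?_ s hs
    · rw [Fintype.card_prod, Fintype.card_bool] at h
      omega
    · rintro ⟨⟨i, hi⟩, a⟩ ⟨⟨l, hl⟩, b⟩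
      have hTT : stdForm (starRingEnd ℂ) (splitSign m) (T (v i)) (T (v l)) =
          starRingEnd ℂ (stdForm (starRingEnd ℂ) (splitSign m) (v i) (v l)) := by
        rw [stdForm_skewRoots hT]
        simp
      have hδ' : starRingEnd ℂ δ = δ := by
        rw [← hi]
        exact (hd.symm _ _).symm
      have hTv : stdForm (starRingEnd ℂ) (splitSign m) (T (v i)) (v l) = 0 := by
        rw [hd.symm (v l), h₂, map_zero]
      by_cases hil : i = l
      · subst hil
        rcases a with _ | _ <;> rcases b with _ | _ <;> simp [h₂, hTv, hTT, hi, hδ']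
      · rcases a with _ | _ <;> rcases b with _ | _ <;> simp [h₂, hTv, hTT, hil, h₃ i l hil]
  -- the pairs of each sign have at most `m` vectors, and together they have `2m`
  have hp := hcard 1 (Finset.univ.image Sum.inl) one_ne_zero (by
    rintro (i | i) hi
    · simp at hi
    · rfl)
  have hq := hcard (-1) (Finset.univ.image Sum.inr) (by simp) (by
    rintro (i | i) hi
    · simp [splitSign]
    · simp at hi)
  rw [Finset.card_image_of_injective _ Sum.inl_injective, Finset.card_univ, Fintype.card_fin] at hp
  rw [Finset.card_image_of_injective _ Sum.inr_injective, Finset.card_univ, Fintype.card_fin] at hq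
  have hpq : Fintype.card {i // stdForm (starRingEnd ℂ) (splitSign m) (v i) (v i) = 1} +
      Fintype.card {i // stdForm (starRingEnd ℂ) (splitSign m) (v i) (v i) = -1} =
      Fintype.card ι := by
    rw [← Fintype.card_subtype_or_disjoint]
    · exact Fintype.card_of_subtype Finset.univ (by simpa using h₁) |>.trans (by simp)
    · rw [Pi.disjoint_iff]
      intro i
      rw [Prop.disjoint_iff]
      rintro ⟨h, h'⟩
      have : (1 : ℂ) = -1 := h.symm.trans h'
      norm_num at this
  set k := Fintype.card {i // stdForm (starRingEnd ℂ) (splitSign m) (v i) (v i) = 1} with hk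
  have hk' : Fintype.card {i // stdForm (starRingEnd ℂ) (splitSign m) (v i) (v i) = -1} = k := by
    omega
  let a := Fintype.equivFinOfCardEq hk.symm
  let b := Fintype.equivFinOfCardEq hk'
  let τ : Fin k ⊕ Fin k → ι := Sum.elim (fun i => (a.symm i).1) fun i => (b.symm i).1
  have hτ : ∀ i, stdForm (starRingEnd ℂ) (splitSign m) (v (τ i)) (v (τ i)) =
      Sum.elim (fun _ => 1) (fun _ => -1) i := by
    rintro (i | i)
    · exact (a.symm i).2
    · exact (b.symm i).2
  have hτi : Function.Injective τ := by
    let q : ι → ℂ := fun i => stdForm (starRingEnd ℂ) (splitSign m) (v i) (v i)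
    rintro (i | i) (l | l) h
    · exact congrArg Sum.inl (a.symm.injective (Subtype.ext h))
    · have h' : (1 : ℂ) = -1 := (hτ (Sum.inl i)).symm.trans ((congrArg q h).trans (hτ (Sum.inr l)))
      norm_num at h'
    · have h' : (-1 : ℂ) = 1 := (hτ (Sum.inr i)).symm.trans ((congrArg q h).trans (hτ (Sum.inl l)))
      norm_num at h'
    · exact congrArg Sum.inr (b.symm.injective (Subtype.ext h))
  exact ⟨k, fun i => v (τ i), by omega, hτ, fun i l => h₂ _ _,
    fun i l h => h₃ _ _ fun h' => h (hτi h')⟩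

theorem even_of_slashFibre_nonempty (hj : IsComplexStructure j) {x : M}
    (h : (slashFibre j (-1) (-1) x).Nonempty) : Even m := by
  obtain ⟨S, hS⟩ := h
  have hd := isStdData_hermitian m
  obtain ⟨φ, hφ⟩ := exists_isAdapted_hermitian rfl hd hj.sq x
  obtain ⟨T, hT, -⟩ := (mem_slashFibre_iff hd hφ (-1) S).1 hS
  obtain ⟨k, -, hk, -⟩ := exists_signed_pair_frame hd hT
  exact ⟨k, by omega⟩

end Bundles

section NegNeg

/-- The coordinates of `ℂ²ᵏ ⊕ ℂ²ᵏ`, cut in two halves of the same signature. -/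
def halves (k : ℕ) : Fin (2 * k) ⊕ Fin (2 * k) ≃ (Fin k ⊕ Fin k) ⊕ (Fin k ⊕ Fin k) :=
  let d : Fin (2 * k) ≃ Fin k ⊕ Fin k := (finCongr (by omega)).trans finSumFinEquiv.symm
  (Equiv.sumCongr d d).trans (Equiv.sumSumSumComm _ _ _ _)

theorem splitSign_halves_inl (k : ℕ) (i : Fin k ⊕ Fin k) :
    splitSign (2 * k) ((halves k).symm (Sum.inl i)) = Sum.elim (fun _ => 1) (fun _ => -1) i := by
  rcases i with i | i <;> rfl

theorem splitSign_halves_inr (k : ℕ) (i : Fin k ⊕ Fin k) :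
    splitSign (2 * k) ((halves k).symm (Sum.inr i)) = Sum.elim (fun _ => 1) (fun _ => -1) i := by
  rcases i with i | i <;> rfl

/-- The quaternionic Hermitian form of signature `(k, k)` is, on complex matrices, the Hermitian
form of signature `(2k, 2k)`. -/
theorem quatMatrix_signMatrix (k : ℕ) :
    quatMatrix (halves k) (signMatrix ℍ[ℝ] k k) = Matrix.diagonal (splitSign (2 * k)) := by
  have hdiag : Matrix.diagonal (splitSign (2 * k)) = (Matrix.fromBlocks
      (Matrix.diagonal (Sum.elim (fun _ : Fin k => (1 : ℂ)) fun _ : Fin k => -1)) 0 0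
      (Matrix.diagonal (Sum.elim (fun _ : Fin k => (1 : ℂ)) fun _ : Fin k => -1))).submatrix
        (halves k) (halves k) := by
    rw [Matrix.fromBlocks_diagonal, Matrix.submatrix_diagonal_equiv]
    congr 1
    funext i
    obtain ⟨i, rfl⟩ := (halves k).symm.surjective i
    rcases i with i | i
    · simp [splitSign_halves_inl]
    · simp [splitSign_halves_inr]
  have h₁ : quatFst (-1) = -1 := by apply Complex.ext <;> simp [quatFst]
  have h₂ : quatSnd (-1) = 0 := by apply Complex.ext <;> simp [quatSnd]
  rw [hdiag, quatMatrix_apply, signMatrix]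
  congr 1
  rw [quatBlocks]
  congr 1 <;> ext i l <;> rcases eq_or_ne i l with rfl | h
  all_goals first
    | (rcases i with i | i <;> simp [quatFst_one, quatSnd_one, h₁, h₂]; done)
    | simp [h, quatFst_zero, quatSnd_zero]

theorem isBundleWithFibre_neg_neg {k : ℕ} {M : Type*} [TopologicalSpace M]
    [ChartedSpace (RModel (2 * k)) M] [IsManifold 𝓘(ℝ, RModel (2 * k)) ∞ M]
    {j : ∀ x : M, TSpace (2 * k) M x →L[ℝ] TSpace (2 * k) M x} (hj : IsComplexStructure j) :
    IsBundleWithFibre j (-1)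
      (fun z w : Fin (2 * k) ⊕ Fin (2 * k) → ℂ => star z ⬝ᵥ (signMatrix ℂ (2 * k) (2 * k) *ᵥ w))
      (complexU (2 * k) (2 * k)) (quaternionSp k k) (slashFibre j (-1) (-1)) := by
  have hd := isStdData_hermitian (2 * k)
  have hε : ∀ i, splitSign (2 * k) ((halves k).symm (Sum.inr i)) =
      -(((-1 : ℤˣ) : ℤ) : ℂ) * splitSign (2 * k) ((halves k).symm (Sum.inl i)) := by
    intro i
    rw [splitSign_halves_inl, splitSign_halves_inr]
    simp
  have hS₀ := pairMatrix_mem_skewRoots hd (halves k) hε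
  rw [hermitian_eq_stdForm]
  refine isBundleWithFibre_of_orbit hj hd mem_complexU_iff hS₀
    (exists_quaternionic_isotropy_hermitian (halves k) (quatMatrix_signMatrix k) mem_complexU_iff)
    (exists_isAdapted_hermitian rfl hd hj.sq) (mem_slashFibre_iff_orbit hS₀ fun T hT => ?_)
  obtain ⟨l, v, hl, h₁, h₂, h₃⟩ := exists_signed_pair_frame hd hT
  obtain rfl : k = l := by omega
  exact exists_conjEnd_pairMatrix hT (halves k) (v := v)
    (fun i => (h₁ i).trans (splitSign_halves_inl k i).symm) hε h₂ h₃

end NegNeg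

end

theorem mainTheorem1 (m : ℕ) (M : Type*) [TopologicalSpace M] [T2Space M]
    [SecondCountableTopology M] [ChartedSpace (RModel m) M] [IsManifold 𝓘(ℝ, RModel m) ∞ M]
    (j : ∀ x : M, TSpace m M x →L[ℝ] TSpace m M x) (hj : IsComplexStructure j) :
    -- the structures are exactly the Courant involutive smooth sections of the bundles
    (∀ (lam ell : ℤˣ) (S : ∀ x : M, ExtEnd m M x), IsIntegrableStructure j lam ell S ↔
      IsSmoothSectionOf (slashFibre j lam ell) S ∧ IsCourantInvolutive lam S) ∧
    (∀ (n : ℕ) (S : ∀ x : M, ExtEnd m M x), IsIntegrableStructureSig j n S ↔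
      IsSmoothSectionOf (slashFibreSig j n) S ∧ IsCourantInvolutive 1 S) ∧
    -- `(1, 1; n)`: typical fibre `O(2m, ℂ) / O(n, 2m - n)`
    (∀ n : ℕ, n ≤ 2 * m → IsBundleWithFibre j 1 (fun z w : Fin (2 * m) → ℂ => z ⬝ᵥ w)
      (complexO (2 * m)) (realO n (2 * m - n)) (slashFibreSig j n)) ∧
    -- `(1, -1)`: typical fibre `U(m, m) / Sp(m, ℝ)`
    IsBundleWithFibre j (-1)
      (fun z w : Fin m ⊕ Fin m → ℂ => star z ⬝ᵥ (signMatrix ℂ m m *ᵥ w))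
      (complexU m m) (realSp m) (slashFibre j 1 (-1)) ∧
    -- `(-1, 1)`: typical fibre `O(2m, ℂ) / SO*(2m)`
    IsBundleWithFibre j 1 (fun z w : Fin (2 * m) → ℂ => z ⬝ᵥ w)
      (complexO (2 * m)) (quaternionSOStar m) (slashFibre j (-1) 1) ∧
    -- `(-1, -1)`: `m` is even if there is such a structure at some point, and for `m = 2k` the
    -- typical fibre is `U(2k, 2k) / Sp(k, k)`
    ((∃ x : M, (slashFibre j (-1) (-1) x).Nonempty) → Even m) ∧
    (∀ k : ℕ, m = 2 * k → IsBundleWithFibre j (-1)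
      (fun z w : Fin (2 * k) ⊕ Fin (2 * k) → ℂ => star z ⬝ᵥ (signMatrix ℂ (2 * k) (2 * k) *ᵥ w))
      (complexU (2 * k) (2 * k)) (quaternionSp k k) (slashFibre j (-1) (-1))) := by
  refine ⟨fun lam ell S => ⟨fun h => ?_, fun h => ?_⟩, fun n S => ⟨fun h => ?_, fun h => ?_⟩,
    fun n hn => isBundleWithFibre_signature hj hn, isBundleWithFibre_one_neg hj,
    isBundleWithFibre_neg_one hj, fun ⟨x, hx⟩ => even_of_slashFibre_nonempty hj hx, ?_⟩
  · exact ⟨⟨h.generalized.smooth, fun x => ⟨h.generalized.sq x, h.generalized.split x,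
      h.generalized.skew x, h.anticomm x⟩⟩, h.generalized.involutive⟩
  · exact ⟨⟨h.1.1, fun x => (h.1.2 x).1, fun x => (h.1.2 x).2.1, fun x => (h.1.2 x).2.2.1, h.2⟩,
      fun x => (h.1.2 x).2.2.2⟩
  · exact ⟨⟨h.integrable.generalized.smooth, fun x => ⟨⟨h.integrable.generalized.sq x,
      h.integrable.generalized.split x, h.integrable.generalized.skew x,
      h.integrable.anticomm x⟩, h.signature x⟩⟩, h.integrable.generalized.involutive⟩
  · exact ⟨⟨⟨h.1.1, fun x => (h.1.2 x).1.1, fun x => (h.1.2 x).1.2.1, fun x => (h.1.2 x).1.2.2.1,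
      h.2⟩, fun x => (h.1.2 x).1.2.2.2⟩, fun x => (h.1.2 x).2⟩
  · rintro k rfl
    exact isBundleWithFibre_neg_neg hj
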